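/- **Conventions.** An étale groupoid $\mathcal G$ over a Hausdorff space $X$ is a (not necessarily Hausdorff) topological groupoid with unit space $X\subset\mathcal G$ whose source and range maps $\mathsf s,\mathsf r$ are local homeomorphisms. It is *minimal* if every orbit $\mathsf r(\mathsf s^{-1}(x))$ is dense in $X$. A *bisection* is an open set $T\subset\mathcal G$ on which $\mathsf s$ and $\mathsf r$ are homeomorphisms onto their images; it induces the homeomorphism $\mathsf r|_T\circ\mathsf s|_T^{-1}:\mathsf s(T)\to\mathsf r(T)$, and $\mathcal G$ is *effective* if every bisection is determined by this homeomorphism. The set $\widetilde{\mathcal G}$ of all bisections, with set-wise product and inverse, is an inverse monoid with unit $X$ and zero $\varnothing$ (the *pseudogroup* of $\mathcal G$). A family in $\widetilde{\mathcal G}$ is *compatible* if $ST^{-1}$ and $S^{-1}T$ are idempotent for all members $S,T$; its union is then a bisection. A *continuous morphism* $\widetilde{\mathcal G}\to\widetilde{\mathcal H}$ is a semigroup homomorphism preserving unit, zero and unions of arbitrary compatible families. The *full group* $\mathsf F(\mathcal G)$ is the group of all $g\in\widetilde{\mathcal G}$ with $\mathsf s(g)=\mathsf r(g)=X$; for $x\in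 X$, $[g]_x$ is the unique element of $g$ with source $x$. A *multisection* of degree $d$ is a map $F:\{1,\dots,d\}^2\to\widetilde{\mathcal G}$ such that the $F(i,i)$ are pairwise disjoint compact open subsets of $X$ and $F(i,j)F(j,\ell)=F(i,\ell)$ for all $i,j,\ell$. For a permutation $\sigma$ of $\{1,\dots,d\}$ put $F(\sigma)=\bigcup_i F(\sigma(i),i)\cup\bigl(X\setminus\bigcup_i F(i,i)\bigr)\in\mathsf F(\mathcal G)$. The *alternating full group* $\mathsf A(\mathcal G)$ is the (normal) subgroup of $\mathsf F(\mathcal G)$ generated by all $F(\sigma)$ with $F$ a multisection of degree $d\ge3$ and $\sigma$ an even permutation. For $r\ge1$, $X^{[r]}$ is the space of non-empty subsets of $X$ with at most $r$ elements, with the quotient topology from $X^r$. The *symmetric power* $\mathcal G^{[r]}$ is the étale groupoid over $X^{[r]}$ whose elements are the non-empty sets $Q\subset\mathcal G$ of at most $r$ elements, any two distinct of which have distinct sources and distinct ranges, with set-wise source, range, product and inverse, and with the quotient topology from the subspace of $\mathcal G^r$ of the tuples any two distinct entries of which have distinct sources and distinct ranges. One regards $\mathsf F(\mathcal G)$ as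 a subgroup of $\mathsf F(\mathcal G^{[r]})\subset\widetilde{\mathcal G^{[r]}}$ via $g\mapsto g^{[r]}=\{Q\in\mathcal G^{[r]}: Q\subset g\}$. For an étale groupoid $\mathcal H$ over $Y$ and $g\in\mathsf F(\mathcal H)$, $\operatorname{supp}(g)=\{y\in Y:[g]_y\ne y\}$; the support of a subgroup is the closure of the union of the supports of its elements. For $Z\subset Y$ clopen, $\mathcal H|Z$ is the groupoid over $Z$ of all $\gamma\in\mathcal H$ with $\mathsf s(\gamma),\mathsf r(\gamma)\in Z$, and $\mathsf F(\mathcal H|Z)$ is identified with a subgroup of $\mathsf F(\mathcal H)$ by $g\mapsto g\cup(Y\setminus Z)$. **Theorem (Extension Theorem).** Let $\mathcal G$ be a minimal effective étale groupoid over a Cantor space $X$, and let $\mathcal H$ be an étale groupoid over a compact Hausdorff space $Y$. Let $G$ be a subgroup of $\mathsf F(\mathcal G)$ containing $\mathsf A(\mathcal G)$, let $\rho:G\to\mathsf F(\mathcal H)$ be a group homomorphism, and let $Z\subset Y$ be the support of $\rho(\mathsf A(\mathcal G))$. Exactly one of the following holds. 1. $Z$ is empty (and thus $\rho$ factors through the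 quotient $G/\mathsf A(\mathcal G)$). 2. There is a point $y\in Z$ such that the map $G\to\mathcal H$, $g\mapsto[\rho(g)]_y$, is injective. 3. $Z$ is non-empty and clopen in $Y$, and there is $r\ge1$ such that $\rho|_{\mathsf A(\mathcal G)}$ extends uniquely to a continuous morphism $\widetilde\rho:\widetilde{\mathcal G^{[r]}}\to\widetilde{\mathcal H|Z}$. Moreover there is a group homomorphism $\psi:G/\mathsf A(\mathcal G)\to\mathsf F(\mathcal H)$ whose image centralises $\widetilde\rho(G)$ and such that $\rho(g)=\widetilde\rho(g)\,\psi(g\mathsf A(\mathcal G))$ for every $g\in G$. -/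

import Mathlib

open Set Topology

universe u v w z

/-- An étale groupoid with Hausdorff unit space `X` : a topological groupoid (`Arr` is its set of
arrows, not assumed Hausdorff; `mul γ δ` is defined when the source of `γ` is the range of `δ`;
`unit` is the identification of `X` with the identity arrows) whose source and range maps are local
homeomorphisms. -/
structure EtaleGroupoid (X : Type u) [TopologicalSpace X] [T2Space X] where
  Arr : Type v
  [topArr : TopologicalSpace Arr]
  src : Arr → X
  rng : Arr → X
  unit : X → Arr
  inv : Arr → Arr
  mul : ∀ γ δ : Arr, src γ = rng δ → Arr
  src_unit : ∀ x, src (unit x) = x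
  rng_unit : ∀ x, rng (unit x) = x
  src_inv : ∀ γ, src (inv γ) = rng γ
  rng_inv : ∀ γ, rng (inv γ) = src γ
  src_mul : ∀ γ δ h, src (mul γ δ h) = src δ
  rng_mul : ∀ γ δ h, rng (mul γ δ h) = rng γ
  mul_unit : ∀ γ, mul γ (unit (src γ)) (rng_unit _).symm = γ
  unit_mul : ∀ γ, mul (unit (rng γ)) γ (src_unit _) = γ
  mul_assoc : ∀ α β γ (h₁ : src α = rng β) (h₂ : src β = rng γ),
    mul (mul α β h₁) γ ((src_mul _ _ h₁).trans h₂) =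
      mul α (mul β γ h₂) (h₁.trans (rng_mul _ _ h₂).symm)
  inv_mul : ∀ γ, mul (inv γ) γ (src_inv γ) = unit (src γ)
  mul_inv : ∀ γ, mul γ (inv γ) (rng_inv γ).symm = unit (rng γ)
  continuous_unit : Continuous unit
  continuous_inv : Continuous inv
  continuous_mul : Continuous fun p : {p : Arr × Arr // src p.1 = rng p.2} => mul p.1.1 p.1.2 p.2
  isLocalHomeomorph_src : IsLocalHomeomorph src
  isLocalHomeomorph_rng : IsLocalHomeomorph rng

namespace EtaleGroupoid

attribute [instance] EtaleGroupoid.topArr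
attribute [simp] src_unit rng_unit src_inv rng_inv src_mul rng_mul

section Basic

variable {X : Type u} [TopologicalSpace X] [T2Space X] (G : EtaleGroupoid.{u, v} X)

theorem mul_congr {γ γ' δ δ' : G.Arr} (h : G.src γ = G.rng δ) (h₁ : γ = γ') (h₂ : δ = δ') :
    G.mul γ δ h = G.mul γ' δ' (by rw [← h₁, ← h₂, h]) := by
  subst h₁ h₂; rfl

theorem mul_unit' (γ : G.Arr) (x : X) (h : G.src γ = G.rng (G.unit x)) :
    G.mul γ (G.unit x) h = γ := by
  have hx : x = G.src γ := by rw [h, rng_unit]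
  subst hx; exact G.mul_unit γ

theorem unit_mul' (γ : G.Arr) (x : X) (h : G.src (G.unit x) = G.rng γ) :
    G.mul (G.unit x) γ h = γ := by
  have hx : x = G.rng γ := by rw [← h, src_unit]
  subst hx; exact G.unit_mul γ

theorem mul_inv_cancel_right (γ δ : G.Arr) (h : G.src γ = G.rng δ) :
    G.mul (G.mul γ δ h) (G.inv δ) (by simp) = γ := by
  rw [G.mul_assoc γ δ (G.inv δ) h (by simp), G.mul_congr _ rfl (G.mul_inv δ), mul_unit']

theorem inv_mul_cancel_right (γ δ : G.Arr) (h : G.src γ = G.src δ) :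
    G.mul (G.mul γ (G.inv δ) (by simpa using h)) δ (by simp) = γ := by
  rw [G.mul_assoc γ (G.inv δ) δ (by simpa using h) (by simp), G.mul_congr _ rfl (G.inv_mul δ),
    mul_unit']

theorem inv_mul_cancel_left (γ δ : G.Arr) (h : G.src γ = G.rng δ) :
    G.mul (G.inv γ) (G.mul γ δ h) (by simp) = δ := by
  rw [← G.mul_assoc (G.inv γ) γ δ (by simp) h, G.mul_congr _ (G.inv_mul γ) rfl, unit_mul']

theorem inv_inv (γ : G.Arr) : G.inv (G.inv γ) = γ := by
  have h := G.mul_inv_cancel_right (G.inv (G.inv γ)) (G.inv γ) (by simp)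
  rw [← h, G.mul_congr _ (G.inv_mul (G.inv γ)) rfl, unit_mul']
  have h2 := G.mul_inv_cancel_right γ (G.inv γ) (by simp)
  rw [G.mul_congr _ (G.mul_inv γ) rfl, unit_mul'] at h2
  exact h2

theorem inv_unit (x : X) : G.inv (G.unit x) = G.unit x := by
  have h := G.inv_mul (G.unit x)
  rw [mul_unit', src_unit] at h
  exact h

theorem isOpenEmbedding_unit : IsOpenEmbedding G.unit :=
  G.isLocalHomeomorph_src.isOpenEmbedding_of_comp
    (by
      have h : G.src ∘ G.unit = id := funext G.src_unit
      rw [h]; exact IsOpenEmbedding.id)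
    G.continuous_unit

/-- The set-wise product of two sets of arrows. -/
def mulSet (S T : Set G.Arr) : Set G.Arr :=
  {ξ | ∃ γ ∈ S, ∃ δ ∈ T, ∃ h : G.src γ = G.rng δ, ξ = G.mul γ δ h}

/-- Every orbit is dense in the unit space. -/
def IsMinimal : Prop := ∀ x : X, Dense (G.rng '' {γ | G.src γ = x})

/-- A bisection: an open set of arrows on which source and range are injective. (On an open set the
source and range maps, being local homeomorphisms, are injective if and only if they are
homeomorphisms onto their images, which are open.) -/
@[ext]
structure Bisec where
  carrier : Set G.Arr
  isOpen : IsOpen carrier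
  injOn_src : InjOn G.src carrier
  injOn_rng : InjOn G.rng carrier

end Basic

namespace Bisec

section Basic

variable {X : Type u} [TopologicalSpace X] [T2Space X] {G : EtaleGroupoid.{u, v} X}

instance : SetLike G.Bisec G.Arr where
  coe := Bisec.carrier
  coe_injective _ _ h := Bisec.ext h

theorem ext_mem {S T : G.Bisec} (h : ∀ γ, γ ∈ S ↔ γ ∈ T) : S = T := SetLike.ext h

theorem isOpen_coe (T : G.Bisec) : IsOpen (T : Set G.Arr) := T.isOpen

theorem src_inj (T : G.Bisec) {γ δ : G.Arr} (h₁ : γ ∈ T) (h₂ : δ ∈ T) (h : G.src γ = G.src δ) :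
    γ = δ := T.injOn_src h₁ h₂ h

theorem rng_inj (T : G.Bisec) {γ δ : G.Arr} (h₁ : γ ∈ T) (h₂ : δ ∈ T) (h : G.rng γ = G.rng δ) :
    γ = δ := T.injOn_rng h₁ h₂ h

theorem isOpenEmbedding_src (T : G.Bisec) : IsOpenEmbedding (fun γ : T => G.src γ) :=
  (G.isLocalHomeomorph_src.comp T.isOpen.isOpenEmbedding_subtypeVal.isLocalHomeomorph
    ).isOpenEmbedding_of_injective fun γ δ h => Subtype.ext (T.src_inj γ.2 δ.2 h)

theorem isOpen_mulSet (S T : G.Bisec) : IsOpen (G.mulSet S T) := by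
  classical
  have hW : IsOpen (G.src '' (T : Set G.Arr)) := G.isLocalHomeomorph_src.isOpenMap _ T.isOpen
  have hN : IsOpen {ξ | G.src ξ ∈ G.src '' (T : Set G.Arr)} :=
    hW.preimage G.isLocalHomeomorph_src.continuous
  have hd : ∀ ξ : {ξ | G.src ξ ∈ G.src '' (T : Set G.Arr)}, ∃ δ : T, G.src δ = G.src ξ := by
    rintro ⟨ξ, δ, hδ, h⟩; exact ⟨⟨δ, hδ⟩, h⟩
  choose d hd using hd
  have hdc : Continuous d := by
    rw [T.isOpenEmbedding_src.isInducing.continuous_iff]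
    have : (fun γ : T => G.src γ) ∘ d = fun ξ => G.src ξ.1 := funext hd
    rw [this]
    exact G.isLocalHomeomorph_src.continuous.comp continuous_subtype_val
  have hc : ∀ ξ : {ξ | G.src ξ ∈ G.src '' (T : Set G.Arr)},
      G.src ξ.1 = G.rng (G.inv (d ξ)) := by
    intro ξ; rw [rng_inv, hd]
  have hm : Continuous fun ξ : {ξ | G.src ξ ∈ G.src '' (T : Set G.Arr)} =>
      G.mul ξ.1 (G.inv (d ξ)) (hc ξ) := by
    have h1 : Continuous fun ξ : {ξ | G.src ξ ∈ G.src '' (T : Set G.Arr)} =>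
        (⟨(ξ.1, G.inv (d ξ)), hc ξ⟩ : {p : G.Arr × G.Arr // G.src p.1 = G.rng p.2}) :=
      (continuous_subtype_val.prodMk
        (G.continuous_inv.comp (continuous_subtype_val.comp hdc))).subtype_mk _
    exact G.continuous_mul.comp h1
  have key := hN.isOpenMap_subtype_val _ (S.isOpen.preimage hm)
  convert key using 1
  ext ξ
  constructor
  · rintro ⟨γ, hγ, δ, hδ, h, rfl⟩
    have hmem : G.src (G.mul γ δ h) ∈ G.src '' (T : Set G.Arr) := ⟨δ, hδ, by simp⟩
    refine ⟨⟨_, hmem⟩, ?_, rfl⟩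
    have hdd : (d ⟨_, hmem⟩ : G.Arr) = δ := T.src_inj (d _).2 hδ (by rw [hd]; simp)
    change G.mul _ _ _ ∈ S
    rw [G.mul_congr _ rfl (congrArg G.inv hdd), mul_inv_cancel_right]
    exact hγ
  · rintro ⟨ξ, hξ, rfl⟩
    exact ⟨_, hξ, d ξ, (d ξ).2, by simp, (G.inv_mul_cancel_right _ _ (hd ξ).symm).symm⟩

/-- The product of two bisections is their set-wise product. -/
instance : Mul G.Bisec where
  mul S T :=
    { carrier := G.mulSet S T
      isOpen := isOpen_mulSet S T
      injOn_src := by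
        rintro _ ⟨γ, hγ, δ, hδ, h, rfl⟩ _ ⟨γ', hγ', δ', hδ', h', rfl⟩ e
        rw [src_mul, src_mul] at e
        have e1 := T.src_inj hδ hδ' e
        exact G.mul_congr _ (S.src_inj hγ hγ' (by rw [h, h', e1])) e1
      injOn_rng := by
        rintro _ ⟨γ, hγ, δ, hδ, h, rfl⟩ _ ⟨γ', hγ', δ', hδ', h', rfl⟩ e
        rw [rng_mul, rng_mul] at e
        have e1 := S.rng_inj hγ hγ' e
        exact G.mul_congr _ e1 (T.rng_inj hδ hδ' (by rw [← h, ← h', e1])) }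

/-- The identity is the unit space. -/
instance : One G.Bisec where
  one :=
    { carrier := range G.unit
      isOpen := G.isOpenEmbedding_unit.isOpen_range
      injOn_src := by
        rintro _ ⟨x, rfl⟩ _ ⟨y, rfl⟩ e
        rw [src_unit, src_unit] at e
        rw [e]
      injOn_rng := by
        rintro _ ⟨x, rfl⟩ _ ⟨y, rfl⟩ e
        rw [rng_unit, rng_unit] at e
        rw [e] }

/-- The zero of the pseudogroup is the empty bisection. -/
instance : Zero G.Bisec where
  zero := ⟨∅, isOpen_empty, injOn_empty _, injOn_empty _⟩

/-- The inverse of a bisection is its set-wise inverse. -/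
instance : Inv G.Bisec where
  inv T :=
    { carrier := {γ | G.inv γ ∈ T}
      isOpen := T.isOpen.preimage G.continuous_inv
      injOn_src := by
        intro γ hγ δ hδ e
        rw [← G.inv_inv γ, ← G.inv_inv δ, T.rng_inj hγ hδ (by simpa using e)]
      injOn_rng := by
        intro γ hγ δ hδ e
        rw [← G.inv_inv γ, ← G.inv_inv δ, T.src_inj hγ hδ (by simpa using e)] }

theorem mem_mul {S T : G.Bisec} {ξ : G.Arr} :
    ξ ∈ S * T ↔ ∃ γ ∈ S, ∃ δ ∈ T, ∃ h : G.src γ = G.rng δ, ξ = G.mul γ δ h := Iff.rfl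

theorem mem_one {ξ : G.Arr} : ξ ∈ (1 : G.Bisec) ↔ ∃ x, G.unit x = ξ := Iff.rfl

theorem mem_inv {T : G.Bisec} {ξ : G.Arr} : ξ ∈ T⁻¹ ↔ G.inv ξ ∈ T := Iff.rfl

theorem notMem_zero (ξ : G.Arr) : ξ ∉ (0 : G.Bisec) := fun h => h

instance : Monoid G.Bisec where
  mul_assoc A B C := by
    apply ext_mem
    intro ξ
    simp only [mem_mul]
    constructor
    · rintro ⟨_, ⟨α, hα, β, hβ, h1, rfl⟩, γ, hγ, h2, rfl⟩
      rw [src_mul] at h2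
      exact ⟨α, hα, _, ⟨β, hβ, γ, hγ, h2, rfl⟩, by simpa using h1, G.mul_assoc _ _ _ h1 h2⟩
    · rintro ⟨α, hα, _, ⟨β, hβ, γ, hγ, h2, rfl⟩, h1, rfl⟩
      rw [rng_mul] at h1
      exact ⟨_, ⟨α, hα, β, hβ, h1, rfl⟩, γ, hγ, by simpa using h2, (G.mul_assoc _ _ _ h1 h2).symm⟩
  one_mul A := by
    apply ext_mem
    intro ξ
    simp only [mem_mul, mem_one]
    constructor
    · rintro ⟨_, ⟨x, rfl⟩, δ, hδ, h, rfl⟩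
      rwa [unit_mul']
    · intro h
      exact ⟨_, ⟨G.rng ξ, rfl⟩, ξ, h, by simp, (G.unit_mul ξ).symm⟩
  mul_one A := by
    apply ext_mem
    intro ξ
    simp only [mem_mul, mem_one]
    constructor
    · rintro ⟨γ, hγ, _, ⟨x, rfl⟩, h, rfl⟩
      rwa [mul_unit']
    · intro h
      exact ⟨ξ, h, _, ⟨G.src ξ, rfl⟩, by simp, (G.mul_unit ξ).symm⟩

/-- Two elements of the pseudogroup are compatible if `S T⁻¹` and `S⁻¹ T` are idempotent. -/
def Compatible (S T : G.Bisec) : Prop :=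
  IsIdempotentElem (S * T⁻¹) ∧ IsIdempotentElem (S⁻¹ * T)

theorem mem_one_of_isIdempotentElem {E : G.Bisec} (hE : IsIdempotentElem E) {ξ : G.Arr}
    (h : ξ ∈ E) : ∃ x, G.unit x = ξ := by
  have h' := h
  rw [← hE.eq, mem_mul] at h'
  obtain ⟨γ, hγ, δ, hδ, e, hξ⟩ := h'
  have h1 : ξ = γ := E.rng_inj h hγ (by rw [hξ, rng_mul])
  have h2 : ξ = δ := E.src_inj h hδ (by rw [hξ, src_mul])
  subst h1 h2
  refine ⟨G.src ξ, ?_⟩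
  rw [← G.inv_mul ξ, G.mul_congr _ rfl hξ, inv_mul_cancel_left]

/-- The union of a compatible family of bisections (its join in the pseudogroup). -/
def sUnion (F : Set G.Bisec) (hF : ∀ S ∈ F, ∀ T ∈ F, Compatible S T) : G.Bisec where
  carrier := ⋃ S ∈ F, (S : Set G.Arr)
  isOpen := isOpen_biUnion fun S _ => S.isOpen
  injOn_src := by
    intro γ hγ δ hδ e
    simp only [mem_iUnion, SetLike.mem_coe] at hγ hδ
    obtain ⟨S, hS, hγ⟩ := hγ
    obtain ⟨T, hT, hδ⟩ := hδ
    obtain ⟨x, hx⟩ := mem_one_of_isIdempotentElem (hF S hS T hT).1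
      (mem_mul.2 ⟨γ, hγ, G.inv δ, by rwa [mem_inv, inv_inv], by simpa using e, rfl⟩)
    rw [← G.inv_mul_cancel_right γ δ e, G.mul_congr _ hx.symm rfl, unit_mul']
  injOn_rng := by
    intro γ hγ δ hδ e
    simp only [mem_iUnion, SetLike.mem_coe] at hγ hδ
    obtain ⟨S, hS, hγ⟩ := hγ
    obtain ⟨T, hT, hδ⟩ := hδ
    obtain ⟨x, hx⟩ := mem_one_of_isIdempotentElem (hF S hS T hT).2
      (mem_mul.2 ⟨G.inv γ, by rwa [mem_inv, inv_inv], δ, hδ, by simpa using e, rfl⟩)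
    have h1 := G.inv_mul_cancel_left (G.inv γ) δ (by simpa using e)
    rw [G.mul_congr _ rfl hx.symm, mul_unit', inv_inv] at h1
    exact h1

/-- The graph of the homeomorphism from the open set `src T` to the open set `rng T` that is
associated with the bisection `T`. -/
def graph (T : G.Bisec) : Set (X × X) := {p | ∃ γ ∈ T, G.src γ = p.1 ∧ G.rng γ = p.2}

end Basic

end Bisec

section Full

variable {X : Type u} [TopologicalSpace X] [T2Space X] (G : EtaleGroupoid.{u, v} X)

/-- Every bisection is determined by its associated partial homeomorphism. -/
def IsEffective : Prop := ∀ S T : G.Bisec, S.graph = T.graph → S = T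

/-- The (topological) full group: the bisections whose source and range are the whole unit space. -/
def fullGroup : Submonoid G.Bisec where
  carrier := {T | G.src '' (T : Set G.Arr) = univ ∧ G.rng '' (T : Set G.Arr) = univ}
  one_mem' := by
    constructor
    · exact eq_univ_of_forall fun x => ⟨G.unit x, ⟨x, rfl⟩, by simp⟩
    · exact eq_univ_of_forall fun x => ⟨G.unit x, ⟨x, rfl⟩, by simp⟩
  mul_mem' := by
    rintro S T ⟨hS, hS'⟩ ⟨hT, hT'⟩
    constructor
    · refine eq_univ_of_forall fun x => ?_
      obtain ⟨δ, hδ, rfl⟩ := hT.ge (mem_univ x)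
      obtain ⟨γ, hγ, h⟩ := hS.ge (mem_univ (G.rng δ))
      exact ⟨_, ⟨γ, hγ, δ, hδ, h, rfl⟩, by simp⟩
    · refine eq_univ_of_forall fun x => ?_
      obtain ⟨γ, hγ, rfl⟩ := hS'.ge (mem_univ x)
      obtain ⟨δ, hδ, h⟩ := hT'.ge (mem_univ (G.src γ))
      exact ⟨_, ⟨γ, hγ, δ, hδ, h.symm, rfl⟩, by simp⟩

variable {G}

theorem exists_src_eq (g : G.fullGroup) (x : X) : ∃ γ ∈ (g : G.Bisec), G.src γ = x :=
  g.2.1.ge (mem_univ x)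

theorem exists_rng_eq (g : G.fullGroup) (x : X) : ∃ γ ∈ (g : G.Bisec), G.rng γ = x :=
  g.2.2.ge (mem_univ x)

instance : Group G.fullGroup :=
  { (inferInstance : Monoid G.fullGroup) with
    inv := fun g => ⟨(g : G.Bisec)⁻¹, by
      constructor
      · refine eq_univ_of_forall fun x => ?_
        obtain ⟨γ, hγ, rfl⟩ := exists_rng_eq g x
        exact ⟨G.inv γ, Bisec.mem_inv.2 (by rwa [inv_inv]), by simp⟩
      · refine eq_univ_of_forall fun x => ?_
        obtain ⟨γ, hγ, rfl⟩ := exists_src_eq g x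
        exact ⟨G.inv γ, Bisec.mem_inv.2 (by rwa [inv_inv]), by simp⟩⟩
    inv_mul_cancel := by
      intro g
      apply Subtype.ext
      apply Bisec.ext_mem
      intro ξ
      change ξ ∈ (g : G.Bisec)⁻¹ * (g : G.Bisec) ↔ ξ ∈ (1 : G.Bisec)
      rw [Bisec.mem_mul, Bisec.mem_one]
      constructor
      · rintro ⟨γ, hγ, δ, hδ, h, rfl⟩
        rw [Bisec.mem_inv] at hγ
        have e : G.inv γ = δ := g.1.rng_inj hγ hδ (by rw [rng_inv, h])
        refine ⟨G.src δ, ?_⟩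
        rw [← G.inv_mul δ]
        exact G.mul_congr _ (by rw [← e, inv_inv]) rfl
      · rintro ⟨x, rfl⟩
        obtain ⟨γ, hγ, rfl⟩ := exists_src_eq g x
        exact ⟨G.inv γ, Bisec.mem_inv.2 (by rwa [inv_inv]), γ, hγ, by simp, (G.inv_mul γ).symm⟩ }

theorem coe_inv (g : G.fullGroup) : ((g⁻¹ : G.fullGroup) : G.Bisec) = (g : G.Bisec)⁻¹ := rfl

/-- The germ `[g]_x`: the unique arrow of `g` with source `x`. -/
noncomputable def germ (g : G.fullGroup) (x : X) : G.Arr := (exists_src_eq g x).choose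

theorem germ_mem (g : G.fullGroup) (x : X) : germ g x ∈ (g : G.Bisec) :=
  (exists_src_eq g x).choose_spec.1

theorem src_germ (g : G.fullGroup) (x : X) : G.src (germ g x) = x :=
  (exists_src_eq g x).choose_spec.2

/-- The support of an element of the full group: the points where its germ is not a unit. -/
def supp (g : G.fullGroup) : Set X := {x | germ g x ≠ G.unit x}

/-- The support of a subgroup of the full group: the closure of the union of the supports. -/
def subgroupSupp (K : Subgroup G.fullGroup) : Set X := closure (⋃ k ∈ K, supp k)

end Full

section Alternating

variable {X : Type u} [TopologicalSpace X] [T2Space X] (G : EtaleGroupoid.{u, v} X)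

/-- A multisection of degree `d`. -/
structure Multisection (d : ℕ) where
  toFun : Fin d → Fin d → G.Bisec
  exists_unit : ∀ i, ∃ U : Set X, IsCompact U ∧ IsOpen U ∧ (toFun i i : Set G.Arr) = G.unit '' U
  disjoint : ∀ i j, i ≠ j → Disjoint (toFun i i : Set G.Arr) (toFun j j : Set G.Arr)
  mul : ∀ i j l, toFun i j * toFun j l = toFun i l

variable {G}

theorem fullGroup_ext {g h : G.fullGroup} (hgh : ∀ γ ∈ (g : G.Bisec), γ ∈ (h : G.Bisec)) :
    g = h := by
  apply Subtype.ext
  apply Bisec.ext_mem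
  intro γ
  refine ⟨hgh γ, fun hγ => ?_⟩
  obtain ⟨δ, hδ, e⟩ := exists_src_eq g (G.src γ)
  rwa [← h.1.src_inj (hgh δ hδ) hγ e]

theorem germ_eq {g : G.fullGroup} {γ : G.Arr} (h : γ ∈ (g : G.Bisec)) : germ g (G.src γ) = γ :=
  g.1.src_inj (germ_mem g _) h (src_germ g _)

theorem continuous_germ (g : G.fullGroup) : Continuous (germ g) := by
  have h : Continuous fun x => (⟨germ g x, germ_mem g x⟩ : (g : G.Bisec)) := by
    rw [(Bisec.isOpenEmbedding_src (g : G.Bisec)).isInducing.continuous_iff]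
    have h2 : ((fun γ : (g : G.Bisec) => G.src γ) ∘
        fun x => (⟨germ g x, germ_mem g x⟩ : (g : G.Bisec))) = id := funext fun x => src_germ g x
    rw [h2]
    exact continuous_id
  exact continuous_subtype_val.comp h

namespace Multisection

variable {d : ℕ} (F : G.Multisection d)

/-- The domain of a multisection, as a subset of the unit space. -/
def domain : Set X := {x | ∃ i, G.unit x ∈ F.toFun i i}

theorem unit_src_mem {i j : Fin d} {γ : G.Arr} (h : γ ∈ F.toFun i j) :
    G.unit (G.src γ) ∈ F.toFun j j := by
  have h' := h
  rw [← F.mul i j j, Bisec.mem_mul] at h'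
  obtain ⟨α, -, β, hβ, e, rfl⟩ := h'
  obtain ⟨U, -, -, hU⟩ := F.exists_unit j
  have h2 : β ∈ (F.toFun j j : Set G.Arr) := hβ
  rw [hU] at h2
  obtain ⟨x, -, rfl⟩ := h2
  rwa [src_mul, src_unit]

theorem unit_rng_mem {i j : Fin d} {γ : G.Arr} (h : γ ∈ F.toFun i j) :
    G.unit (G.rng γ) ∈ F.toFun i i := by
  have h' := h
  rw [← F.mul i i j, Bisec.mem_mul] at h'
  obtain ⟨α, hα, β, -, e, rfl⟩ := h'
  obtain ⟨U, -, -, hU⟩ := F.exists_unit i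
  have h2 : α ∈ (F.toFun i i : Set G.Arr) := hα
  rw [hU] at h2
  obtain ⟨x, -, rfl⟩ := h2
  rwa [rng_mul, rng_unit]

theorem exists_src {j : Fin d} (i : Fin d) {x : X} (h : G.unit x ∈ F.toFun j j) :
    ∃ γ ∈ F.toFun i j, G.src γ = x := by
  rw [← F.mul j i j, Bisec.mem_mul] at h
  obtain ⟨α, -, β, hβ, e, h⟩ := h
  exact ⟨β, hβ, by rw [← G.src_unit x, h, src_mul]⟩

theorem exists_rng {i : Fin d} (j : Fin d) {x : X} (h : G.unit x ∈ F.toFun i i) :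
    ∃ γ ∈ F.toFun i j, G.rng γ = x := by
  rw [← F.mul i j i, Bisec.mem_mul] at h
  obtain ⟨α, hα, β, -, e, h⟩ := h
  exact ⟨α, hα, by rw [← G.rng_unit x, h, rng_mul]⟩

theorem eq_of_mem {i j : Fin d} {ξ : G.Arr} (hi : ξ ∈ F.toFun i i) (hj : ξ ∈ F.toFun j j) :
    i = j := by
  by_contra hij
  exact Set.disjoint_left.1 (F.disjoint i j hij) hi hj

theorem isClosed_domain : IsClosed F.domain := by
  have h : F.domain = ⋃ i, {x | G.unit x ∈ F.toFun i i} := by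
    ext x; simp [domain]
  rw [h]
  refine isClosed_iUnion_of_finite fun i => ?_
  obtain ⟨U, hU, -, hF⟩ := F.exists_unit i
  convert hU.isClosed using 1
  ext x
  change G.unit x ∈ (F.toFun i i : Set G.Arr) ↔ _
  rw [hF, G.isOpenEmbedding_unit.injective.mem_set_image]

theorem mem_domain_src {i j : Fin d} {γ : G.Arr} (h : γ ∈ F.toFun i j) : G.src γ ∈ F.domain :=
  ⟨j, F.unit_src_mem h⟩

theorem mem_domain_rng {i j : Fin d} {γ : G.Arr} (h : γ ∈ F.toFun i j) : G.rng γ ∈ F.domain :=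
  ⟨i, F.unit_rng_mem h⟩

/-- The element of the full group defined by a multisection and a permutation: it consists of the
arrows of the bisections `F (σ i) i` and of the units outside the domain. -/
def perm (σ : Equiv.Perm (Fin d)) : G.fullGroup where
  val :=
    { carrier := (⋃ i, (F.toFun (σ i) i : Set G.Arr)) ∪ G.unit '' F.domainᶜ
      isOpen := (isOpen_iUnion fun i => (F.toFun (σ i) i).isOpen).union
        (G.isOpenEmbedding_unit.isOpenMap _ F.isClosed_domain.isOpen_compl)
      injOn_src := by
        rintro γ (hγ | ⟨x, hx, rfl⟩) δ (hδ | ⟨y, hy, rfl⟩) e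
        · obtain ⟨i, hγ⟩ := mem_iUnion.1 hγ
          obtain ⟨j, hδ⟩ := mem_iUnion.1 hδ
          have hi := F.unit_src_mem hγ
          rw [e] at hi
          have hij := F.eq_of_mem hi (F.unit_src_mem hδ)
          subst hij
          exact (F.toFun _ _).src_inj hγ hδ e
        · obtain ⟨i, hγ⟩ := mem_iUnion.1 hγ
          exact absurd (F.mem_domain_src hγ) (by rwa [e, src_unit])
        · obtain ⟨j, hδ⟩ := mem_iUnion.1 hδ
          exact absurd (F.mem_domain_src hδ) (by rwa [← e, src_unit])
        · rw [src_unit, src_unit] at e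
          rw [e]
      injOn_rng := by
        rintro γ (hγ | ⟨x, hx, rfl⟩) δ (hδ | ⟨y, hy, rfl⟩) e
        · obtain ⟨i, hγ⟩ := mem_iUnion.1 hγ
          obtain ⟨j, hδ⟩ := mem_iUnion.1 hδ
          have hi := F.unit_rng_mem hγ
          rw [e] at hi
          have hij := σ.injective (F.eq_of_mem hi (F.unit_rng_mem hδ))
          subst hij
          exact (F.toFun _ _).rng_inj hγ hδ e
        · obtain ⟨i, hγ⟩ := mem_iUnion.1 hγ
          exact absurd (F.mem_domain_rng hγ) (by rwa [e, rng_unit])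
        · obtain ⟨j, hδ⟩ := mem_iUnion.1 hδ
          exact absurd (F.mem_domain_rng hδ) (by rwa [← e, rng_unit])
        · rw [rng_unit, rng_unit] at e
          rw [e] }
  property := by
    constructor
    · refine eq_univ_of_forall fun x => ?_
      by_cases hx : x ∈ F.domain
      · obtain ⟨i, hi⟩ := hx
        obtain ⟨γ, hγ, e⟩ := F.exists_src (σ i) hi
        exact ⟨γ, Or.inl (mem_iUnion.2 ⟨i, hγ⟩), e⟩
      · exact ⟨G.unit x, Or.inr ⟨x, hx, rfl⟩, G.src_unit x⟩
    · refine eq_univ_of_forall fun x => ?_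
      by_cases hx : x ∈ F.domain
      · obtain ⟨i, hi⟩ := hx
        obtain ⟨γ, hγ, e⟩ := F.exists_rng (σ.symm i) hi
        exact ⟨γ, Or.inl (mem_iUnion.2 ⟨σ.symm i, by simpa using hγ⟩), e⟩
      · exact ⟨G.unit x, Or.inr ⟨x, hx, rfl⟩, G.rng_unit x⟩

theorem mem_perm {σ : Equiv.Perm (Fin d)} {γ : G.Arr} : γ ∈ (F.perm σ : G.Bisec) ↔
    (∃ i, γ ∈ F.toFun (σ i) i) ∨ ∃ x ∉ F.domain, G.unit x = γ := by
  change γ ∈ (⋃ i, (F.toFun (σ i) i : Set G.Arr)) ∪ G.unit '' F.domainᶜ ↔ _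
  simp

theorem conj_set (g : G.fullGroup) (B : G.Bisec) (U : Set X)
    (hB : (B : Set G.Arr) = G.unit '' U) :
    (((g : G.Bisec) * B * ((g⁻¹ : G.fullGroup) : G.Bisec) : G.Bisec) : Set G.Arr) =
      G.unit '' ((fun x => G.rng (germ g x)) '' U) := by
  ext ξ
  constructor
  · rintro ⟨_, ⟨γ, hγ, β, hβ, h, rfl⟩, δ, hδ, h', rfl⟩
    change β ∈ (B : Set G.Arr) at hβ
    rw [hB] at hβ
    obtain ⟨x, hx, rfl⟩ := hβ
    change G.inv δ ∈ (g : G.Bisec) at hδ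
    rw [rng_unit] at h
    rw [src_mul, src_unit] at h'
    have e : G.inv δ = γ := g.1.src_inj hδ hγ (by rw [src_inv, ← h', h])
    refine ⟨G.rng (germ g x), ⟨x, hx, rfl⟩, ?_⟩
    have h2 : germ g x = γ := by rw [← h]; exact germ_eq hγ
    rw [h2, ← G.mul_inv γ]
    exact G.mul_congr _ (G.mul_unit' _ _ _).symm (by rw [← e, inv_inv])
  · rintro ⟨_, ⟨x, hx, rfl⟩, rfl⟩
    have hxB : G.unit x ∈ B := by
      change G.unit x ∈ (B : Set G.Arr)
      rw [hB]; exact ⟨x, hx, rfl⟩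
    refine ⟨_, ⟨germ g x, germ_mem g x, G.unit x, hxB, by rw [src_germ, rng_unit], rfl⟩,
      G.inv (germ g x), ?_, by rw [src_mul, src_unit, rng_inv, src_germ], ?_⟩
    · change G.inv (G.inv _) ∈ (g : G.Bisec)
      rw [inv_inv]; exact germ_mem g x
    · rw [← G.mul_inv]
      exact G.mul_congr _ (G.mul_unit' _ _ _).symm rfl

theorem inv_mul_coe (g : G.fullGroup) :
    ((g⁻¹ : G.fullGroup) : G.Bisec) * (g : G.Bisec) = 1 :=
  congrArg Subtype.val (inv_mul_cancel g)

theorem rng_germ_injective (g : G.fullGroup) : Function.Injective fun x => G.rng (germ g x) := by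
  intro x y h
  have := g.1.rng_inj (germ_mem g x) (germ_mem g y) h
  rw [← src_germ g x, this, src_germ]

/-- Conjugation of a multisection by an element of the full group. -/
def conj (g : G.fullGroup) : G.Multisection d where
  toFun i j := (g : G.Bisec) * F.toFun i j * ((g⁻¹ : G.fullGroup) : G.Bisec)
  exists_unit i := by
    obtain ⟨U, hU, hUo, hF⟩ := F.exists_unit i
    have h := conj_set g (F.toFun i i) U hF
    refine ⟨_, hU.image (G.isLocalHomeomorph_rng.continuous.comp (continuous_germ g)), ?_, h⟩
    rw [G.isOpenEmbedding_unit.isOpen_iff_image_isOpen]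
    exact h ▸ Bisec.isOpen _
  disjoint i j hij := by
    obtain ⟨U, -, -, hU⟩ := F.exists_unit i
    obtain ⟨V, -, -, hV⟩ := F.exists_unit j
    rw [conj_set g _ U hU, conj_set g _ V hV]
    have h := F.disjoint i j hij
    rw [hU, hV, Set.disjoint_image_iff G.isOpenEmbedding_unit.injective] at h
    rw [Set.disjoint_image_iff G.isOpenEmbedding_unit.injective,
      Set.disjoint_image_iff (rng_germ_injective g)]
    exact h
  mul i j l := by
    rw [← F.mul i j l]
    calc (g : G.Bisec) * F.toFun i j * ((g⁻¹ : G.fullGroup) : G.Bisec) *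
          ((g : G.Bisec) * F.toFun j l * ((g⁻¹ : G.fullGroup) : G.Bisec))
        = (g : G.Bisec) * F.toFun i j * (((g⁻¹ : G.fullGroup) : G.Bisec) * (g : G.Bisec)) *
            F.toFun j l * ((g⁻¹ : G.fullGroup) : G.Bisec) := by simp only [_root_.mul_assoc]
      _ = _ := by rw [inv_mul_coe]; simp only [_root_.mul_assoc, _root_.mul_one]

theorem perm_conj (g : G.fullGroup) (σ : Equiv.Perm (Fin d)) :
    (F.conj g).perm σ = g * F.perm σ * g⁻¹ := by
  apply fullGroup_ext
  intro ξ hξ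
  rw [mem_perm] at hξ
  obtain ⟨i, hi⟩ | ⟨y, hy, rfl⟩ := hξ
  · obtain ⟨_, ⟨γ, hγ, β, hβ, h, rfl⟩, δ, hδ, h', rfl⟩ := hi
    exact ⟨_, ⟨γ, hγ, β, (F.mem_perm).2 (Or.inl ⟨i, hβ⟩), h, rfl⟩, δ, hδ, h', rfl⟩
  · obtain ⟨γ, hγ, rfl⟩ := exists_rng_eq g y
    have hx : G.src γ ∉ F.domain := by
      rintro ⟨i, hi⟩
      apply hy
      refine ⟨i, ?_⟩
      obtain ⟨U, -, -, hU⟩ := F.exists_unit i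
      have hi' : G.unit (G.src γ) ∈ (F.toFun i i : Set G.Arr) := hi
      rw [hU] at hi'
      have hx : G.src γ ∈ U := (G.isOpenEmbedding_unit.injective.mem_set_image).1 hi'
      change _ ∈ (((g : G.Bisec) * F.toFun i i * ((g⁻¹ : G.fullGroup) : G.Bisec) : G.Bisec) :
        Set G.Arr)
      rw [conj_set g _ U hU]
      exact ⟨_, ⟨_, hx, rfl⟩, congrArg (fun δ => G.unit (G.rng δ)) (germ_eq hγ)⟩
    refine ⟨_, ⟨γ, hγ, G.unit (G.src γ), (F.mem_perm).2 (Or.inr ⟨_, hx, rfl⟩), by simp, rfl⟩,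
      G.inv γ, ?_, by simp, ?_⟩
    · change G.inv (G.inv γ) ∈ (g : G.Bisec)
      rwa [inv_inv]
    · rw [← G.mul_inv]
      exact G.mul_congr _ (G.mul_unit γ).symm rfl

end Multisection

variable (G) in
/-- The alternating full group: the subgroup of the full group generated by the elements that come
from even permutations and multisections of degree at least three. -/
def altGroup : Subgroup G.fullGroup :=
  Subgroup.closure {g | ∃ d : ℕ, 3 ≤ d ∧ ∃ F : G.Multisection d,
    ∃ σ ∈ alternatingGroup (Fin d), F.perm σ = g}

instance : (altGroup G).Normal := by
  constructor
  intro n hn g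
  induction hn using Subgroup.closure_induction with
  | mem x hx =>
    obtain ⟨d, hd, F, σ, hσ, rfl⟩ := hx
    exact Subgroup.subset_closure ⟨d, hd, F.conj g, σ, hσ, F.perm_conj g σ⟩
  | one => simp
  | mul x y _ _ hx hy =>
    have : g * (x * y) * g⁻¹ = (g * x * g⁻¹) * (g * y * g⁻¹) := by group
    rw [this]
    exact mul_mem hx hy
  | inv x _ hx =>
    have : g * x⁻¹ * g⁻¹ = (g * x * g⁻¹)⁻¹ := by group
    rw [this]
    exact inv_mem hx

end Alternating

section Restrict

variable {Y : Type u} [TopologicalSpace Y] [T2Space Y] (H : EtaleGroupoid.{u, v} Y)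

/-- The restriction `H|Z` of an étale groupoid to an open subset `Z` of its unit space: the
groupoid over `Z` of all arrows with source and range in `Z`. -/
def restrict (Z : Set Y) (hZ : IsOpen Z) : EtaleGroupoid.{u, v} Z where
  Arr := {γ : H.Arr // H.src γ ∈ Z ∧ H.rng γ ∈ Z}
  src γ := ⟨H.src γ.1, γ.2.1⟩
  rng γ := ⟨H.rng γ.1, γ.2.2⟩
  unit y := ⟨H.unit y.1, (H.src_unit y.1).symm ▸ y.2, (H.rng_unit y.1).symm ▸ y.2⟩
  inv γ := ⟨H.inv γ.1, (H.src_inv γ.1).symm ▸ γ.2.2, (H.rng_inv γ.1).symm ▸ γ.2.1⟩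
  mul γ δ h := ⟨H.mul γ.1 δ.1 (congrArg Subtype.val h),
    (H.src_mul γ.1 δ.1 (congrArg Subtype.val h)).symm ▸ δ.2.1,
    (H.rng_mul γ.1 δ.1 (congrArg Subtype.val h)).symm ▸ γ.2.2⟩
  src_unit y := Subtype.ext (H.src_unit _)
  rng_unit y := Subtype.ext (H.rng_unit _)
  src_inv γ := Subtype.ext (H.src_inv _)
  rng_inv γ := Subtype.ext (H.rng_inv _)
  src_mul γ δ h := Subtype.ext (H.src_mul _ _ _)
  rng_mul γ δ h := Subtype.ext (H.rng_mul _ _ _)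
  mul_unit γ := Subtype.ext (H.mul_unit _)
  unit_mul γ := Subtype.ext (H.unit_mul _)
  mul_assoc α β γ h₁ h₂ := Subtype.ext (H.mul_assoc _ _ _ _ _)
  inv_mul γ := Subtype.ext (H.inv_mul _)
  mul_inv γ := Subtype.ext (H.mul_inv _)
  continuous_unit := (H.continuous_unit.comp continuous_subtype_val).subtype_mk _
  continuous_inv := (H.continuous_inv.comp continuous_subtype_val).subtype_mk _
  continuous_mul := by
    refine Continuous.subtype_mk ?_ _
    let f : {p : {γ : H.Arr // H.src γ ∈ Z ∧ H.rng γ ∈ Z} ×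
        {γ : H.Arr // H.src γ ∈ Z ∧ H.rng γ ∈ Z} //
        (⟨H.src p.1.1, p.1.2.1⟩ : Z) = ⟨H.rng p.2.1, p.2.2.2⟩} →
        {p : H.Arr × H.Arr // H.src p.1 = H.rng p.2} :=
      fun p => ⟨(p.1.1.1, p.1.2.1), congrArg Subtype.val p.2⟩
    have hf : Continuous f :=
      ((continuous_subtype_val.comp (continuous_fst.comp continuous_subtype_val)).prodMk
        (continuous_subtype_val.comp (continuous_snd.comp continuous_subtype_val))).subtype_mk _
    exact H.continuous_mul.comp hf
  isLocalHomeomorph_src := by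
    have hA : IsOpen {γ : H.Arr | H.src γ ∈ Z ∧ H.rng γ ∈ Z} :=
      (hZ.preimage H.isLocalHomeomorph_src.continuous).inter
        (hZ.preimage H.isLocalHomeomorph_rng.continuous)
    exact IsLocalHomeomorph.of_comp
      (H.isLocalHomeomorph_src.comp hA.isOpenEmbedding_subtypeVal.isLocalHomeomorph)
      hZ.isOpenEmbedding_subtypeVal.isLocalHomeomorph
      ((H.isLocalHomeomorph_src.continuous.comp continuous_subtype_val).subtype_mk _)
  isLocalHomeomorph_rng := by
    have hA : IsOpen {γ : H.Arr | H.src γ ∈ Z ∧ H.rng γ ∈ Z} :=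
      (hZ.preimage H.isLocalHomeomorph_src.continuous).inter
        (hZ.preimage H.isLocalHomeomorph_rng.continuous)
    exact IsLocalHomeomorph.of_comp
      (H.isLocalHomeomorph_rng.comp hA.isOpenEmbedding_subtypeVal.isLocalHomeomorph)
      hZ.isOpenEmbedding_subtypeVal.isLocalHomeomorph
      ((H.isLocalHomeomorph_rng.continuous.comp continuous_subtype_val).subtype_mk _)

variable {H}

/-- The identification of the full group of `H|Z`, for `Z` clopen, with a subset of the full group
of `H`: a bisection of `H|Z` is completed by the units outside `Z`. -/
def extendFull {Z : Set Y} (hZ : IsClopen Z) (g : (H.restrict Z hZ.isOpen).fullGroup) :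
    H.fullGroup where
  val :=
    { carrier := Subtype.val '' ((g : (H.restrict Z hZ.isOpen).Bisec) :
        Set (H.restrict Z hZ.isOpen).Arr) ∪ H.unit '' Zᶜ
      isOpen := by
        have hA : IsOpen {γ : H.Arr | H.src γ ∈ Z ∧ H.rng γ ∈ Z} :=
          (hZ.isOpen.preimage H.isLocalHomeomorph_src.continuous).inter
            (hZ.isOpen.preimage H.isLocalHomeomorph_rng.continuous)
        exact (hA.isOpenMap_subtype_val _ (Bisec.isOpen g.1)).union
          (H.isOpenEmbedding_unit.isOpenMap _ hZ.isClosed.isOpen_compl)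
      injOn_src := by
        rintro _ (⟨γ, hγ, rfl⟩ | ⟨x, hx, rfl⟩) _ (⟨δ, hδ, rfl⟩ | ⟨y, hy, rfl⟩) e
        · exact congrArg Subtype.val (g.1.src_inj hγ hδ (Subtype.ext e))
        · exact absurd γ.2.1 (by rw [e, src_unit]; exact hy)
        · exact absurd δ.2.1 (by rw [← e, src_unit]; exact hx)
        · rw [src_unit, src_unit] at e
          rw [e]
      injOn_rng := by
        rintro _ (⟨γ, hγ, rfl⟩ | ⟨x, hx, rfl⟩) _ (⟨δ, hδ, rfl⟩ | ⟨y, hy, rfl⟩) e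
        · exact congrArg Subtype.val (g.1.rng_inj hγ hδ (Subtype.ext e))
        · exact absurd γ.2.2 (by rw [e, rng_unit]; exact hy)
        · exact absurd δ.2.2 (by rw [← e, rng_unit]; exact hx)
        · rw [rng_unit, rng_unit] at e
          rw [e] }
  property := by
    constructor
    · refine eq_univ_of_forall fun x => ?_
      by_cases hx : x ∈ Z
      · obtain ⟨γ, hγ, e⟩ := exists_src_eq g ⟨x, hx⟩
        exact ⟨γ.1, Or.inl ⟨γ, hγ, rfl⟩, congrArg Subtype.val e⟩
      · exact ⟨H.unit x, Or.inr ⟨x, hx, rfl⟩, H.src_unit x⟩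
    · refine eq_univ_of_forall fun x => ?_
      by_cases hx : x ∈ Z
      · obtain ⟨γ, hγ, e⟩ := exists_rng_eq g ⟨x, hx⟩
        exact ⟨γ.1, Or.inl ⟨γ, hγ, rfl⟩, congrArg Subtype.val e⟩
      · exact ⟨H.unit x, Or.inr ⟨x, hx, rfl⟩, H.rng_unit x⟩

end Restrict

section SymmetricPower

/-- The space `X^[r]` of non-empty subsets of `X` with at most `r` elements. -/
def SymSpace (X : Type u) (r : ℕ) : Type u := {A : Set X // A.Nonempty ∧ A.encard ≤ r}

theorem encard_range_le {α : Type w} {r : ℕ} (f : Fin r → α) : (range f).encard ≤ r := by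
  rw [← image_univ]
  refine (encard_image_le f univ).trans ?_
  simp

theorem exists_range_eq {α : Type w} {r : ℕ} {A : Set α} (h : A.Nonempty) (hA : A.encard ≤ r) :
    ∃ f : Fin r → α, range f = A := by
  classical
  have hfin : A.Finite := finite_of_encard_le_coe hA
  have := hfin.fintype
  have := h.to_subtype
  have hc : Fintype.card A ≤ Fintype.card (Fin r) := by
    rw [Fintype.card_fin]
    have h1 : ((Fintype.card A : ℕ) : ℕ∞) ≤ r := by
      rwa [← Nat.card_eq_fintype_card, Nat.card_coe_set_eq, hfin.cast_ncard_eq]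
    exact_mod_cast h1
  obtain ⟨e⟩ := Function.Embedding.nonempty_of_card_le hc
  refine ⟨fun i => (Function.invFun e i : A), ?_⟩
  have hs : Function.Surjective (Function.invFun e) := Function.invFun_surjective e.injective
  ext x
  constructor
  · rintro ⟨i, rfl⟩; exact Subtype.coe_prop _
  · intro hx
    obtain ⟨i, hi⟩ := hs ⟨x, hx⟩
    exact ⟨i, by simp [hi]⟩

variable {X : Type u} [TopologicalSpace X]

/-- The quotient map from the cartesian power `X^r` to `X^[r]`. -/
def SymSpace.mk {r : ℕ} [NeZero r] (f : Fin r → X) : SymSpace X r :=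
  ⟨range f, range_nonempty f, encard_range_le f⟩

/-- The quotient of the product topology on `X^r`. -/
instance (r : ℕ) [NeZero r] : TopologicalSpace (SymSpace X r) :=
  TopologicalSpace.coinduced SymSpace.mk Pi.topologicalSpace

namespace SymSpace

variable {r : ℕ} [NeZero r]

theorem isOpen_subset {U : Set X} (hU : IsOpen U) : IsOpen {A : SymSpace X r | A.1 ⊆ U} := by
  rw [isOpen_coinduced]
  have : (SymSpace.mk ⁻¹' {A : SymSpace X r | A.1 ⊆ U}) = ⋂ i, {f : Fin r → X | f i ∈ U} := by
    ext f; simp [SymSpace.mk, range_subset_iff]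
  rw [this]
  exact isOpen_iInter_of_finite fun i => hU.preimage (continuous_apply i)

theorem isOpen_inter {U : Set X} (hU : IsOpen U) :
    IsOpen {A : SymSpace X r | (A.1 ∩ U).Nonempty} := by
  rw [isOpen_coinduced]
  have : (SymSpace.mk ⁻¹' {A : SymSpace X r | (A.1 ∩ U).Nonempty}) =
      ⋃ i, {f : Fin r → X | f i ∈ U} := by
    ext f; simp [SymSpace.mk, Set.Nonempty]
  rw [this]
  exact isOpen_iUnion fun i => hU.preimage (continuous_apply i)

theorem isOpen_box {ι : Type w} {I : Set ι} (hI : I.Finite) {W : ι → Set X}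
    (hW : ∀ i, IsOpen (W i)) :
    IsOpen {A : SymSpace X r | A.1 ⊆ ⋃ i ∈ I, W i ∧ ∀ i ∈ I, (A.1 ∩ W i).Nonempty} := by
  have : {A : SymSpace X r | A.1 ⊆ ⋃ i ∈ I, W i ∧ ∀ i ∈ I, (A.1 ∩ W i).Nonempty} =
      {A : SymSpace X r | A.1 ⊆ ⋃ i ∈ I, W i} ∩
        ⋂ i ∈ I, {A : SymSpace X r | (A.1 ∩ W i).Nonempty} := by
    ext A; simp
  rw [this]
  exact (isOpen_subset (isOpen_biUnion fun i _ => hW i)).inter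
    (hI.isOpen_biInter fun i _ => isOpen_inter (hW i))

theorem exists_separation [T2Space X] {A B : SymSpace X r} {a : X} (ha : a ∈ A.1)
    (hb : a ∉ B.1) : ∃ U V : Set (SymSpace X r), IsOpen U ∧ IsOpen V ∧ A ∈ U ∧ B ∈ V ∧
      Disjoint U V := by
  have hfin : B.1.Finite := finite_of_encard_le_coe B.2.2
  obtain ⟨U, V, hU, hV, hUa, hVB, hd⟩ :=
    SeparatedNhds.of_isCompact_isCompact (isCompact_singleton (x := a)) hfin.isCompact
      (disjoint_singleton_left.2 hb)
  refine ⟨_, _, isOpen_inter hU, isOpen_subset hV, ⟨a, ha, hUa rfl⟩, hVB, ?_⟩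
  rw [Set.disjoint_left]
  rintro C ⟨c, hc, hcU⟩ hCV
  exact Set.disjoint_left.1 hd hcU (hCV hc)

instance [T2Space X] : T2Space (SymSpace X r) := by
  constructor
  intro A B hAB
  have h : ¬ (A.1 ⊆ B.1 ∧ B.1 ⊆ A.1) := fun h => hAB (Subtype.ext (h.1.antisymm h.2))
  rw [not_and_or, not_subset, not_subset] at h
  obtain ⟨a, ha, hb⟩ | ⟨a, ha, hb⟩ := h
  · exact exists_separation ha hb
  · obtain ⟨U, V, hU, hV, h1, h2, h3⟩ := exists_separation ha hb
    exact ⟨V, U, hV, hU, h2, h1, h3.symm⟩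

end SymSpace

variable [T2Space X] (G : EtaleGroupoid.{u, v} X)

/-- The set of arrows of the symmetric power: the non-empty sets of at most `r` arrows, any two
distinct of which have distinct sources and distinct ranges. -/
def SymArr (r : ℕ) : Type v :=
  {Q : Set G.Arr // Q.Nonempty ∧ Q.encard ≤ r ∧ InjOn G.src Q ∧ InjOn G.rng Q}

/-- The set of `r`-tuples of arrows in which any two distinct entries have distinct sources and
distinct ranges, with the topology induced from the cartesian power. -/
abbrev SymTuple (r : ℕ) : Type v :=
  {f : Fin r → G.Arr // InjOn G.src (range f) ∧ InjOn G.rng (range f)}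

variable {G}

/-- The quotient map from tuples to arrows of the symmetric power. -/
def SymArr.mk {r : ℕ} [NeZero r] (f : G.SymTuple r) : G.SymArr r :=
  ⟨range f.1, range_nonempty f.1, encard_range_le f.1, f.2.1, f.2.2⟩

instance (r : ℕ) [NeZero r] : TopologicalSpace (G.SymArr r) :=
  TopologicalSpace.coinduced SymArr.mk instTopologicalSpaceSubtype

theorem mulSet_assoc (A B C : Set G.Arr) :
    G.mulSet (G.mulSet A B) C = G.mulSet A (G.mulSet B C) := by
  ext ξ
  constructor
  · rintro ⟨_, ⟨α, hα, β, hβ, h1, rfl⟩, γ, hγ, h2, rfl⟩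
    rw [src_mul] at h2
    exact ⟨α, hα, _, ⟨β, hβ, γ, hγ, h2, rfl⟩, by simpa using h1, G.mul_assoc _ _ _ h1 h2⟩
  · rintro ⟨α, hα, _, ⟨β, hβ, γ, hγ, h2, rfl⟩, h1, rfl⟩
    rw [rng_mul] at h1
    exact ⟨_, ⟨α, hα, β, hβ, h1, rfl⟩, γ, hγ, by simpa using h2, (G.mul_assoc _ _ _ h1 h2).symm⟩

theorem mulSet_unit (A : Set G.Arr) : G.mulSet A (G.unit '' (G.src '' A)) = A := by
  ext ξ
  constructor
  · rintro ⟨γ, hγ, _, ⟨x, -, rfl⟩, h, rfl⟩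
    rwa [mul_unit']
  · intro h
    exact ⟨ξ, h, _, ⟨_, ⟨ξ, h, rfl⟩, rfl⟩, by simp, (G.mul_unit ξ).symm⟩

theorem unit_mulSet (A : Set G.Arr) : G.mulSet (G.unit '' (G.rng '' A)) A = A := by
  ext ξ
  constructor
  · rintro ⟨_, ⟨x, -, rfl⟩, γ, hγ, h, rfl⟩
    rwa [unit_mul']
  · intro h
    exact ⟨_, ⟨_, ⟨ξ, h, rfl⟩, rfl⟩, ξ, h, by simp, (G.unit_mul ξ).symm⟩

theorem inv_mulSet {A : Set G.Arr} (hA : InjOn G.rng A) :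
    G.mulSet (G.inv '' A) A = G.unit '' (G.src '' A) := by
  ext ξ
  constructor
  · rintro ⟨_, ⟨γ, hγ, rfl⟩, δ, hδ, h, rfl⟩
    have e : γ = δ := hA hγ hδ (by simpa using h)
    subst e
    exact ⟨_, ⟨γ, hγ, rfl⟩, (G.inv_mul γ).symm⟩
  · rintro ⟨_, ⟨γ, hγ, rfl⟩, rfl⟩
    exact ⟨_, ⟨γ, hγ, rfl⟩, γ, hγ, by simp, (G.inv_mul γ).symm⟩

theorem mulSet_inv {A : Set G.Arr} (hA : InjOn G.src A) :
    G.mulSet A (G.inv '' A) = G.unit '' (G.rng '' A) := by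
  ext ξ
  constructor
  · rintro ⟨δ, hδ, _, ⟨γ, hγ, rfl⟩, h, rfl⟩
    have e : δ = γ := hA hδ hγ (by simpa using h)
    subst e
    exact ⟨_, ⟨δ, hγ, rfl⟩, (G.mul_inv δ).symm⟩
  · rintro ⟨_, ⟨γ, hγ, rfl⟩, rfl⟩
    exact ⟨γ, hγ, _, ⟨γ, hγ, rfl⟩, by simp, (G.mul_inv γ).symm⟩

namespace SymArr

variable {r : ℕ}

/-- The source of an arrow of the symmetric power. -/
def src (Q : G.SymArr r) : SymSpace X r :=
  ⟨G.src '' Q.1, Q.2.1.image _, (encard_image_le _ _).trans Q.2.2.1⟩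

/-- The range of an arrow of the symmetric power. -/
def rng (Q : G.SymArr r) : SymSpace X r :=
  ⟨G.rng '' Q.1, Q.2.1.image _, (encard_image_le _ _).trans Q.2.2.1⟩

/-- The units of the symmetric power. -/
def unit (A : SymSpace X r) : G.SymArr r :=
  ⟨G.unit '' A.1, A.2.1.image _, (encard_image_le _ _).trans A.2.2, by
    rintro _ ⟨x, -, rfl⟩ _ ⟨y, -, rfl⟩ e
    rw [src_unit, src_unit] at e
    rw [e], by
    rintro _ ⟨x, -, rfl⟩ _ ⟨y, -, rfl⟩ e
    rw [rng_unit, rng_unit] at e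
    rw [e]⟩

/-- The inverse of an arrow of the symmetric power. -/
def inv (Q : G.SymArr r) : G.SymArr r :=
  ⟨G.inv '' Q.1, Q.2.1.image _, (encard_image_le _ _).trans Q.2.2.1, by
    rintro _ ⟨γ, hγ, rfl⟩ _ ⟨δ, hδ, rfl⟩ e
    rw [Q.2.2.2.2 hγ hδ (by simpa using e)], by
    rintro _ ⟨γ, hγ, rfl⟩ _ ⟨δ, hδ, rfl⟩ e
    rw [Q.2.2.2.1 hγ hδ (by simpa using e)]⟩

theorem exists_left {P Q : G.SymArr r} (h : src P = rng Q) {δ : G.Arr} (hδ : δ ∈ Q.1) :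
    ∃ γ ∈ P.1, G.src γ = G.rng δ := by
  have h' : G.src '' P.1 = G.rng '' Q.1 := congrArg Subtype.val h
  exact h'.ge ⟨δ, hδ, rfl⟩

theorem exists_right {P Q : G.SymArr r} (h : src P = rng Q) {γ : G.Arr} (hγ : γ ∈ P.1) :
    ∃ δ ∈ Q.1, G.src γ = G.rng δ := by
  have h' : G.src '' P.1 = G.rng '' Q.1 := congrArg Subtype.val h
  obtain ⟨δ, hδ, e⟩ := h'.le ⟨γ, hγ, rfl⟩
  exact ⟨δ, hδ, e.symm⟩

theorem src_mulSet {P Q : G.SymArr r} (h : src P = rng Q) :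
    G.src '' G.mulSet P.1 Q.1 = G.src '' Q.1 := by
  ext x
  constructor
  · rintro ⟨_, ⟨γ, hγ, δ, hδ, e, rfl⟩, rfl⟩
    exact ⟨δ, hδ, by simp⟩
  · rintro ⟨δ, hδ, rfl⟩
    obtain ⟨γ, hγ, e⟩ := exists_left h hδ
    exact ⟨_, ⟨γ, hγ, δ, hδ, e, rfl⟩, by simp⟩

theorem rng_mulSet {P Q : G.SymArr r} (h : src P = rng Q) :
    G.rng '' G.mulSet P.1 Q.1 = G.rng '' P.1 := by
  ext x
  constructor
  · rintro ⟨_, ⟨γ, hγ, δ, hδ, e, rfl⟩, rfl⟩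
    exact ⟨γ, hγ, by simp⟩
  · rintro ⟨γ, hγ, rfl⟩
    obtain ⟨δ, hδ, e⟩ := exists_right h hγ
    exact ⟨_, ⟨γ, hγ, δ, hδ, e, rfl⟩, by simp⟩

theorem injOn_src_mulSet (P Q : G.SymArr r) : InjOn G.src (G.mulSet P.1 Q.1) := by
  rintro _ ⟨γ, hγ, δ, hδ, h, rfl⟩ _ ⟨γ', hγ', δ', hδ', h', rfl⟩ e
  rw [src_mul, src_mul] at e
  have e1 := Q.2.2.2.1 hδ hδ' e
  exact G.mul_congr _ (P.2.2.2.1 hγ hγ' (by rw [h, h', e1])) e1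

theorem injOn_rng_mulSet (P Q : G.SymArr r) : InjOn G.rng (G.mulSet P.1 Q.1) := by
  rintro _ ⟨γ, hγ, δ, hδ, h, rfl⟩ _ ⟨γ', hγ', δ', hδ', h', rfl⟩ e
  rw [rng_mul, rng_mul] at e
  have e1 := P.2.2.2.2 hγ hγ' e
  exact G.mul_congr _ e1 (Q.2.2.2.2 hδ hδ' (by rw [← h, ← h', e1]))

/-- The product of two composable arrows of the symmetric power is their set-wise product. -/
def mul (P Q : G.SymArr r) (h : src P = rng Q) : G.SymArr r :=
  ⟨G.mulSet P.1 Q.1, by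
    rw [← image_nonempty (f := G.src), src_mulSet h]
    exact Q.2.1.image _, by
    rw [← (injOn_src_mulSet P Q).encard_image, src_mulSet h]
    exact (encard_image_le _ _).trans Q.2.2.1,
    injOn_src_mulSet P Q, injOn_rng_mulSet P Q⟩

theorem finite (Q : G.SymArr r) : Q.1.Finite := finite_of_encard_le_coe Q.2.2.1

theorem exists_separated (Q : G.SymArr r) (W : G.Arr → Set G.Arr) (hW : ∀ γ, IsOpen (W γ))
    (hm : ∀ γ, γ ∈ W γ) : ∃ N : G.Arr → Set G.Arr, (∀ γ, IsOpen (N γ) ∧ γ ∈ N γ ∧ N γ ⊆ W γ) ∧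
      (∀ γ ∈ Q.1, ∀ γ' ∈ Q.1, ∀ α ∈ N γ, ∀ β ∈ N γ', G.src α = G.src β → α = β ∧ γ = γ') ∧
      (∀ γ ∈ Q.1, ∀ γ' ∈ Q.1, ∀ α ∈ N γ, ∀ β ∈ N γ', G.rng α = G.rng β → α = β ∧ γ = γ') := by
  obtain ⟨U, hU, hUd⟩ := (Q.finite.image G.src).t2_separation
  obtain ⟨V, hV, hVd⟩ := (Q.finite.image G.rng).t2_separation
  choose A hAo hA hAi using G.isLocalHomeomorph_src.isLocallyInjective
  choose B hBo hB hBi using G.isLocalHomeomorph_rng.isLocallyInjective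
  refine ⟨fun γ => W γ ∩ (A γ ∩ B γ) ∩ (G.src ⁻¹' U (G.src γ) ∩ G.rng ⁻¹' V (G.rng γ)),
    fun γ => ⟨?_, ?_, ?_⟩, ?_, ?_⟩
  · exact ((hW γ).inter ((hAo γ).inter (hBo γ))).inter
      (((hU _).2.preimage G.isLocalHomeomorph_src.continuous).inter
        ((hV _).2.preimage G.isLocalHomeomorph_rng.continuous))
  · exact ⟨⟨hm γ, hA γ, hB γ⟩, (hU _).1, (hV _).1⟩
  · exact fun x hx => hx.1.1
  · rintro γ hγ γ' hγ' α hα β hβ e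
    have h : γ = γ' := by
      by_contra hne
      have hs : G.src γ ≠ G.src γ' := fun h => hne (Q.2.2.2.1 hγ hγ' h)
      have h1 : G.src β ∈ U (G.src γ) := e ▸ hα.2.1
      exact Set.disjoint_left.1 (hUd ⟨γ, hγ, rfl⟩ ⟨γ', hγ', rfl⟩ hs) h1 hβ.2.1
    subst h
    exact ⟨hAi γ hα.1.2.1 hβ.1.2.1 e, rfl⟩
  · rintro γ hγ γ' hγ' α hα β hβ e
    have h : γ = γ' := by
      by_contra hne
      have hs : G.rng γ ≠ G.rng γ' := fun h => hne (Q.2.2.2.2 hγ hγ' h)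
      have h1 : G.rng β ∈ V (G.rng γ) := e ▸ hα.2.2
      exact Set.disjoint_left.1 (hVd ⟨γ, hγ, rfl⟩ ⟨γ', hγ', rfl⟩ hs) h1 hβ.2.2
    subst h
    exact ⟨hBi γ hα.1.2.2 hβ.1.2.2 e, rfl⟩

variable [NeZero r]

theorem continuous_src : Continuous (src : G.SymArr r → SymSpace X r) := by
  rw [continuous_coinduced_dom]
  have h : (src : G.SymArr r → SymSpace X r) ∘ mk =
      SymSpace.mk ∘ fun f : G.SymTuple r => fun i => G.src (f.1 i) := by
    funext f
    exact Subtype.ext (range_comp G.src f.1).symm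
  rw [h]
  exact continuous_coinduced_rng.comp (continuous_pi fun i =>
    G.isLocalHomeomorph_src.continuous.comp ((continuous_apply i).comp continuous_subtype_val))

theorem continuous_unit : Continuous (unit : SymSpace X r → G.SymArr r) := by
  rw [continuous_coinduced_dom]
  have hf : ∀ f : Fin r → X, InjOn G.src (range fun i => G.unit (f i)) ∧
      InjOn G.rng (range fun i => G.unit (f i)) := by
    intro f
    constructor
    · rintro _ ⟨i, rfl⟩ _ ⟨j, rfl⟩ e
      rw [src_unit, src_unit] at e
      simp only [e]
    · rintro _ ⟨i, rfl⟩ _ ⟨j, rfl⟩ e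
      rw [rng_unit, rng_unit] at e
      simp only [e]
  have h : (unit : SymSpace X r → G.SymArr r) ∘ SymSpace.mk =
      mk ∘ fun f : Fin r → X => (⟨fun i => G.unit (f i), hf f⟩ : G.SymTuple r) := by
    funext f
    exact Subtype.ext (range_comp G.unit f).symm
  rw [h]
  exact continuous_coinduced_rng.comp (Continuous.subtype_mk (continuous_pi fun i =>
    G.continuous_unit.comp (continuous_apply i)) _)

theorem continuous_inv : Continuous (inv : G.SymArr r → G.SymArr r) := by
  rw [continuous_coinduced_dom]
  have hf : ∀ f : G.SymTuple r, InjOn G.src (range fun i => G.inv (f.1 i)) ∧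
      InjOn G.rng (range fun i => G.inv (f.1 i)) := by
    intro f
    constructor
    · rintro _ ⟨i, rfl⟩ _ ⟨j, rfl⟩ e
      simp only [src_inv] at e
      simp only [f.2.2 ⟨i, rfl⟩ ⟨j, rfl⟩ e]
    · rintro _ ⟨i, rfl⟩ _ ⟨j, rfl⟩ e
      simp only [rng_inv] at e
      simp only [f.2.1 ⟨i, rfl⟩ ⟨j, rfl⟩ e]
  have h : (inv : G.SymArr r → G.SymArr r) ∘ mk =
      mk ∘ fun f : G.SymTuple r => (⟨fun i => G.inv (f.1 i), hf f⟩ : G.SymTuple r) := by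
    funext f
    exact Subtype.ext (range_comp G.inv f.1).symm
  rw [h]
  exact continuous_coinduced_rng.comp (Continuous.subtype_mk (continuous_pi fun i =>
    G.continuous_inv.comp ((continuous_apply i).comp continuous_subtype_val)) _)

theorem isOpen_subset {U : Set G.Arr} (hU : IsOpen U) : IsOpen {Q : G.SymArr r | Q.1 ⊆ U} := by
  rw [isOpen_coinduced]
  have : (SymArr.mk ⁻¹' {Q : G.SymArr r | Q.1 ⊆ U}) =
      ⋂ i, {f : G.SymTuple r | f.1 i ∈ U} := by
    ext f; simp [SymArr.mk, range_subset_iff]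
  rw [this]
  exact isOpen_iInter_of_finite fun i =>
    hU.preimage ((continuous_apply i).comp continuous_subtype_val)

theorem isOpen_inter {U : Set G.Arr} (hU : IsOpen U) :
    IsOpen {Q : G.SymArr r | (Q.1 ∩ U).Nonempty} := by
  rw [isOpen_coinduced]
  have : (SymArr.mk ⁻¹' {Q : G.SymArr r | (Q.1 ∩ U).Nonempty}) =
      ⋃ i, {f : G.SymTuple r | f.1 i ∈ U} := by
    ext f; simp [SymArr.mk, Set.Nonempty]
  rw [this]
  exact isOpen_iUnion fun i => hU.preimage ((continuous_apply i).comp continuous_subtype_val)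

theorem isOpen_box {ι : Type w} {I : Set ι} (hI : I.Finite) {W : ι → Set G.Arr}
    (hW : ∀ i, IsOpen (W i)) :
    IsOpen {Q : G.SymArr r | Q.1 ⊆ ⋃ i ∈ I, W i ∧ ∀ i ∈ I, (Q.1 ∩ W i).Nonempty} := by
  have : {Q : G.SymArr r | Q.1 ⊆ ⋃ i ∈ I, W i ∧ ∀ i ∈ I, (Q.1 ∩ W i).Nonempty} =
      {Q : G.SymArr r | Q.1 ⊆ ⋃ i ∈ I, W i} ∩
        ⋂ i ∈ I, {Q : G.SymArr r | (Q.1 ∩ W i).Nonempty} := by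
    ext A; simp
  rw [this]
  exact (isOpen_subset (isOpen_biUnion fun i _ => hW i)).inter
    (hI.isOpen_biInter fun i _ => isOpen_inter (hW i))

theorem exists_box {V : Set (G.SymArr r)} (hV : IsOpen V) (Q : G.SymArr r) (hQ : Q ∈ V) :
    ∃ N : G.Arr → Set G.Arr, (∀ γ, IsOpen (N γ) ∧ γ ∈ N γ) ∧
      (∀ γ ∈ Q.1, ∀ γ' ∈ Q.1, ∀ α ∈ N γ, ∀ β ∈ N γ', G.src α = G.src β → α = β ∧ γ = γ') ∧
      (∀ γ ∈ Q.1, ∀ γ' ∈ Q.1, ∀ α ∈ N γ, ∀ β ∈ N γ', G.rng α = G.rng β → α = β ∧ γ = γ') ∧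
      ∀ P : G.SymArr r, P.1 ⊆ ⋃ γ ∈ Q.1, N γ → (∀ γ ∈ Q.1, (P.1 ∩ N γ).Nonempty) → P ∈ V := by
  classical
  have : Finite Q.1 := Q.finite
  rw [isOpen_coinduced, isOpen_induced_iff] at hV
  obtain ⟨O, hO, hOV⟩ := hV
  rw [isOpen_pi_iff'] at hO
  have hf : ∀ f : Fin r → Q.1, ∃ B : Fin r → Set G.Arr,
      (∀ i, IsOpen (B i) ∧ (f i : G.Arr) ∈ B i) ∧ (Function.Surjective f → univ.pi B ⊆ O) := by
    intro f
    by_cases hs : Function.Surjective f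
    · have hr : range (fun i => (f i : G.Arr)) = Q.1 := by
        ext γ
        constructor
        · rintro ⟨i, rfl⟩; exact (f i).2
        · intro hγ
          obtain ⟨i, hi⟩ := hs ⟨γ, hγ⟩
          exact ⟨i, by simp [hi]⟩
      have hmem : (fun i => (f i : G.Arr)) ∈ O := by
        have : (⟨fun i => (f i : G.Arr), by rw [hr]; exact Q.2.2.2⟩ : G.SymTuple r) ∈
            Subtype.val ⁻¹' O := by
          rw [hOV]
          change SymArr.mk _ ∈ V
          convert hQ
          exact Subtype.ext hr
        exact this
      obtain ⟨B, hB, hBO⟩ := hO _ hmem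
      exact ⟨B, hB, fun _ => hBO⟩
    · exact ⟨fun _ => univ, fun i => ⟨isOpen_univ, trivial⟩, fun h => absurd h hs⟩
  choose B hB hBO using hf
  obtain ⟨N, hN, hNs, hNr⟩ := Q.exists_separated
    (fun γ => ⋂ (f : Fin r → Q.1) (i : Fin r) (_ : (f i : G.Arr) = γ), B f i)
    (fun γ => isOpen_iInter_of_finite fun f => isOpen_iInter_of_finite fun i =>
      isOpen_iInter_of_finite fun _ => (hB f i).1)
    (fun γ => by
      simp only [mem_iInter]
      rintro f i rfl
      exact (hB f i).2)
  refine ⟨N, fun γ => ⟨(hN γ).1, (hN γ).2.1⟩, hNs, hNr, fun P hP hP' => ?_⟩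
  obtain ⟨e, he⟩ := exists_range_eq P.2.1 P.2.2.1
  have hsel : ∀ i, ∃ γ : Q.1, e i ∈ N γ := by
    intro i
    have h1 : e i ∈ P.1 := he ▸ mem_range_self i
    obtain ⟨γ, hγ, h2⟩ := mem_iUnion₂.1 (hP h1)
    exact ⟨⟨γ, hγ⟩, h2⟩
  choose f hf using hsel
  have hs : Function.Surjective f := by
    rintro ⟨γ, hγ⟩
    obtain ⟨τ, hτ, hτN⟩ := hP' γ hγ
    rw [← he] at hτ
    obtain ⟨i, rfl⟩ := hτ
    exact ⟨i, Subtype.ext (hNs _ (f i).2 _ hγ _ (hf i) _ hτN rfl).2⟩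
  have hmem : e ∈ O := by
    refine hBO f hs fun i _ => ?_
    have h1 := (hN (f i)).2.2 (hf i)
    simp only [mem_iInter] at h1
    exact h1 f i rfl
  have h2 : (⟨e, by rw [he]; exact P.2.2.2⟩ : G.SymTuple r) ∈ Subtype.val ⁻¹' O := hmem
  rw [hOV] at h2
  have h3 : SymArr.mk ⟨e, by rw [he]; exact P.2.2.2⟩ = P := Subtype.ext he
  rw [← h3]
  exact h2

theorem isOpenMap_src : IsOpenMap (src : G.SymArr r → SymSpace X r) := by
  intro V hV
  rw [isOpen_iff_mem_nhds]
  rintro _ ⟨Q, hQ, rfl⟩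
  obtain ⟨N, hN, hNs, hNr, hNV⟩ := exists_box hV Q hQ
  have ho := SymSpace.isOpen_box (r := r) Q.finite (W := fun γ => G.src '' N γ)
    (fun γ => G.isLocalHomeomorph_src.isOpenMap _ (hN γ).1)
  refine Filter.mem_of_superset (ho.mem_nhds ⟨?_, ?_⟩) ?_
  · rintro _ ⟨γ, hγ, rfl⟩
    exact mem_iUnion₂.2 ⟨γ, hγ, γ, (hN γ).2, rfl⟩
  · intro γ hγ
    exact ⟨G.src γ, ⟨γ, hγ, rfl⟩, γ, (hN γ).2, rfl⟩
  · rintro A ⟨hA, hA'⟩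
    have hs : InjOn G.src {τ | τ ∈ ⋃ γ ∈ Q.1, N γ ∧ G.src τ ∈ A.1} := by
      rintro α ⟨hα, -⟩ β ⟨hβ, -⟩ e
      obtain ⟨γ, hγ, hα⟩ := mem_iUnion₂.1 hα
      obtain ⟨γ', hγ', hβ⟩ := mem_iUnion₂.1 hβ
      exact (hNs γ hγ γ' hγ' α hα β hβ e).1
    have hr : InjOn G.rng {τ | τ ∈ ⋃ γ ∈ Q.1, N γ ∧ G.src τ ∈ A.1} := by
      rintro α ⟨hα, -⟩ β ⟨hβ, -⟩ e
      obtain ⟨γ, hγ, hα⟩ := mem_iUnion₂.1 hα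
      obtain ⟨γ', hγ', hβ⟩ := mem_iUnion₂.1 hβ
      exact (hNr γ hγ γ' hγ' α hα β hβ e).1
    have himg : G.src '' {τ | τ ∈ ⋃ γ ∈ Q.1, N γ ∧ G.src τ ∈ A.1} = A.1 := by
      ext x
      constructor
      · rintro ⟨τ, ⟨-, h⟩, rfl⟩; exact h
      · intro hx
        obtain ⟨γ, hγ, τ, hτ, rfl⟩ := mem_iUnion₂.1 (hA hx)
        exact ⟨τ, ⟨mem_iUnion₂.2 ⟨γ, hγ, hτ⟩, hx⟩, rfl⟩
    refine ⟨⟨{τ | τ ∈ ⋃ γ ∈ Q.1, N γ ∧ G.src τ ∈ A.1}, ?_, ?_, hs, hr⟩, hNV _ ?_ ?_,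
      Subtype.ext himg⟩
    · rw [← image_nonempty (f := G.src), himg]; exact A.2.1
    · rw [← hs.encard_image, himg]; exact A.2.2
    · exact fun τ hτ => hτ.1
    · intro γ hγ
      obtain ⟨_, hx, τ, hτ, rfl⟩ := hA' γ hγ
      exact ⟨τ, ⟨mem_iUnion₂.2 ⟨γ, hγ, hτ⟩, hx⟩, hτ⟩

theorem isLocalHomeomorph_src : IsLocalHomeomorph (src : G.SymArr r → SymSpace X r) := by
  rw [isLocalHomeomorph_iff_isOpenEmbedding_restrict]
  intro Q
  obtain ⟨N, hN, hNs, -⟩ := Q.exists_separated (fun _ => univ) (fun _ => isOpen_univ)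
    fun _ => trivial
  have ho := isOpen_box (G := G) (r := r) Q.finite (W := N) fun γ => (hN γ).1
  have key : ∀ P P' : G.SymArr r, P.1 ⊆ ⋃ γ ∈ Q.1, N γ → P'.1 ⊆ ⋃ γ ∈ Q.1, N γ →
      G.src '' P.1 = G.src '' P'.1 → P.1 ⊆ P'.1 := by
    intro P P' h h' e τ hτ
    obtain ⟨τ', hτ', e'⟩ := e.le ⟨τ, hτ, rfl⟩
    obtain ⟨γ, hγ, h1⟩ := mem_iUnion₂.1 (h hτ)
    obtain ⟨γ', hγ', h2⟩ := mem_iUnion₂.1 (h' hτ')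
    rwa [(hNs γ hγ γ' hγ' τ h1 τ' h2 e'.symm).1]
  refine ⟨_, ho.mem_nhds ⟨?_, ?_⟩, IsOpenEmbedding.of_continuous_injective_isOpenMap
    (continuous_src.comp continuous_subtype_val) ?_ (isOpenMap_src.domRestrict ho)⟩
  · exact fun γ hγ => mem_iUnion₂.2 ⟨γ, hγ, (hN γ).2.1⟩
  · exact fun γ hγ => ⟨γ, hγ, (hN γ).2.1⟩
  · rintro ⟨P, hP, _⟩ ⟨P', hP', _⟩ e
    have e' : G.src '' P.1 = G.src '' P'.1 := congrArg Subtype.val e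
    exact Subtype.ext (Subtype.ext ((key P P' hP hP' e').antisymm (key P' P hP' hP e'.symm)))

theorem continuous_mul : Continuous fun p : {p : G.SymArr r × G.SymArr r // src p.1 = rng p.2} =>
    mul p.1.1 p.1.2 p.2 := by
  rw [continuous_def]
  intro V hV
  rw [isOpen_iff_mem_nhds]
  rintro ⟨⟨P, Q⟩, hPQ⟩ hmem
  change src P = rng Q at hPQ
  change mul P Q hPQ ∈ V at hmem
  obtain ⟨N, hN, -, -, hNV⟩ := exists_box hV _ hmem
  have hO : ∀ γ δ : G.Arr, ∃ A B : Set G.Arr, IsOpen A ∧ IsOpen B ∧ γ ∈ A ∧ δ ∈ B ∧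
      ∀ α ∈ A, ∀ β ∈ B, ∀ h : G.src α = G.rng β, ∃ h' : G.src γ = G.rng δ,
        G.mul α β h ∈ N (G.mul γ δ h') := by
    intro γ δ
    by_cases h : G.src γ = G.rng δ
    · have h1 := (hN (G.mul γ δ h)).1.preimage G.continuous_mul
      rw [isOpen_induced_iff] at h1
      obtain ⟨O, hO, hO'⟩ := h1
      have h2 : (γ, δ) ∈ O := by
        have : (⟨(γ, δ), h⟩ : {p : G.Arr × G.Arr // G.src p.1 = G.rng p.2}) ∈
            Subtype.val ⁻¹' O := by
          rw [hO']; exact (hN _).2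
        exact this
      obtain ⟨A, B, hA, hB, hγ, hδ, hAB⟩ := isOpen_prod_iff.1 hO γ δ h2
      refine ⟨A, B, hA, hB, hγ, hδ, fun α hα β hβ h' => ⟨h, ?_⟩⟩
      have h3 : (⟨(α, β), h'⟩ : {p : G.Arr × G.Arr // G.src p.1 = G.rng p.2}) ∈
          Subtype.val ⁻¹' O := hAB ⟨hα, hβ⟩
      rw [hO'] at h3
      exact h3
    · obtain ⟨A, B, hA, hB, h1, h2, hd⟩ := t2_separation h
      refine ⟨_, _, hA.preimage G.isLocalHomeomorph_src.continuous,
        hB.preimage G.isLocalHomeomorph_rng.continuous, h1, h2, fun α hα β hβ h' => ?_⟩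
      have hα' : G.rng β ∈ A := h' ▸ hα
      exact absurd hβ (Set.disjoint_left.1 hd hα')
  choose A B hA hB hAm hBm hAB using hO
  have hP := isOpen_box (G := G) (r := r) P.finite (W := fun γ => ⋂ δ ∈ Q.1, A γ δ)
    fun γ => Q.finite.isOpen_biInter fun δ _ => hA γ δ
  have hQ := isOpen_box (G := G) (r := r) Q.finite (W := fun δ => ⋂ γ ∈ P.1, B γ δ)
    fun δ => P.finite.isOpen_biInter fun γ _ => hB γ δ
  have hnh := ((hP.prod hQ).preimage (continuous_subtype_val
    (p := fun p : G.SymArr r × G.SymArr r => src p.1 = rng p.2))).mem_nhds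
    (x := ⟨(P, Q), hPQ⟩) (by
      refine ⟨⟨fun γ hγ => ?_, fun γ hγ => ?_⟩, ⟨fun δ hδ => ?_, fun δ hδ => ?_⟩⟩
      · exact mem_iUnion₂.2 ⟨γ, hγ, mem_iInter₂.2 fun δ _ => hAm γ δ⟩
      · exact ⟨γ, hγ, mem_iInter₂.2 fun δ _ => hAm γ δ⟩
      · exact mem_iUnion₂.2 ⟨δ, hδ, mem_iInter₂.2 fun γ _ => hBm γ δ⟩
      · exact ⟨δ, hδ, mem_iInter₂.2 fun γ _ => hBm γ δ⟩)
  refine Filter.mem_of_superset hnh ?_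
  rintro ⟨⟨P', Q'⟩, hPQ'⟩ ⟨⟨hP1, hP2⟩, hQ1, hQ2⟩
  change src P' = rng Q' at hPQ'
  change P'.1 ⊆ _ at hP1
  change Q'.1 ⊆ _ at hQ1
  refine hNV (mul P' Q' hPQ') ?_ ?_
  · rintro _ ⟨α, hα, β, hβ, h, rfl⟩
    obtain ⟨γ, hγ, h1⟩ := mem_iUnion₂.1 (hP1 hα)
    obtain ⟨δ, hδ, h2⟩ := mem_iUnion₂.1 (hQ1 hβ)
    obtain ⟨h', h3⟩ := hAB γ δ α (mem_iInter₂.1 h1 δ hδ) β (mem_iInter₂.1 h2 γ hγ) h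
    exact mem_iUnion₂.2 ⟨_, ⟨γ, hγ, δ, hδ, h', rfl⟩, h3⟩
  · rintro _ ⟨γ, hγ, δ, hδ, h, rfl⟩
    obtain ⟨α, hα, h1⟩ := hP2 γ hγ
    obtain ⟨β, hβ, e⟩ := exists_right hPQ' hα
    obtain ⟨δ', hδ', h2⟩ := mem_iUnion₂.1 (hQ1 hβ)
    obtain ⟨h', h3⟩ := hAB γ δ' α (mem_iInter₂.1 h1 δ' hδ') β (mem_iInter₂.1 h2 γ hγ) e
    have e2 : δ' = δ := Q.2.2.2.2 hδ' hδ (h'.symm.trans h)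
    subst e2
    exact ⟨_, ⟨α, hα, β, hβ, e, rfl⟩, h3⟩

end SymArr

theorem image_src_inv (A : Set G.Arr) : G.src '' (G.inv '' A) = G.rng '' A := by
  rw [image_image]; simp

theorem image_rng_inv (A : Set G.Arr) : G.rng '' (G.inv '' A) = G.src '' A := by
  rw [image_image]; simp

theorem image_inv_inv (A : Set G.Arr) : G.inv '' (G.inv '' A) = A := by
  rw [image_image]; simp [inv_inv]

theorem image_src_unit (A : Set X) : G.src '' (G.unit '' A) = A := by
  rw [image_image]; simp

theorem image_rng_unit (A : Set X) : G.rng '' (G.unit '' A) = A := by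
  rw [image_image]; simp

variable (G)

/-- The symmetric power `G^[r]`, an étale groupoid over `X^[r]`. -/
def symPow (r : ℕ) [NeZero r] : EtaleGroupoid.{u, v} (SymSpace X r) where
  Arr := G.SymArr r
  src := SymArr.src
  rng := SymArr.rng
  unit := SymArr.unit
  inv := SymArr.inv
  mul := SymArr.mul
  src_unit A := Subtype.ext (image_src_unit A.1)
  rng_unit A := Subtype.ext (image_rng_unit A.1)
  src_inv Q := Subtype.ext (image_src_inv Q.1)
  rng_inv Q := Subtype.ext (image_rng_inv Q.1)
  src_mul _ _ h := Subtype.ext (SymArr.src_mulSet h)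
  rng_mul _ _ h := Subtype.ext (SymArr.rng_mulSet h)
  mul_unit Q := Subtype.ext (mulSet_unit Q.1)
  unit_mul Q := Subtype.ext (unit_mulSet Q.1)
  mul_assoc P Q R _ _ := Subtype.ext (mulSet_assoc P.1 Q.1 R.1)
  inv_mul Q := Subtype.ext (inv_mulSet Q.2.2.2.2)
  mul_inv Q := Subtype.ext (mulSet_inv Q.2.2.2.1)
  continuous_unit := SymArr.continuous_unit
  continuous_inv := SymArr.continuous_inv
  continuous_mul := SymArr.continuous_mul
  isLocalHomeomorph_src := SymArr.isLocalHomeomorph_src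
  isLocalHomeomorph_rng := by
    have h : (SymArr.rng : G.SymArr r → SymSpace X r) = SymArr.src ∘ SymArr.inv :=
      funext fun Q => Subtype.ext (image_src_inv Q.1).symm
    have hi : Function.Involutive (SymArr.inv : G.SymArr r → G.SymArr r) :=
      fun Q => Subtype.ext (image_inv_inv Q.1)
    rw [h]
    exact SymArr.isLocalHomeomorph_src.comp
      (Homeomorph.isLocalHomeomorph
        { hi.toPerm with
          continuous_toFun := SymArr.continuous_inv
          continuous_invFun := SymArr.continuous_inv })

variable {G}

/-- The embedding of the full group of `G` into that of `G^[r]`: the bisection `g^[r]` consists of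
the arrows of `G^[r]` that are contained in `g`. -/
def powFull (r : ℕ) [NeZero r] (g : G.fullGroup) : (G.symPow r).fullGroup where
  val :=
    { carrier := {Q : G.SymArr r | Q.1 ⊆ ((g : G.Bisec) : Set G.Arr)}
      isOpen := SymArr.isOpen_subset (Bisec.isOpen _)
      injOn_src := by
        have key : ∀ P Q : G.SymArr r, P.1 ⊆ ((g : G.Bisec) : Set G.Arr) →
            Q.1 ⊆ ((g : G.Bisec) : Set G.Arr) → G.src '' P.1 = G.src '' Q.1 → P.1 ⊆ Q.1 := by
          intro P Q hP hQ e γ hγ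
          obtain ⟨δ, hδ, e'⟩ := e.le ⟨γ, hγ, rfl⟩
          rwa [← g.1.src_inj (hQ hδ) (hP hγ) e']
        intro P hP Q hQ e
        have e' : G.src '' P.1 = G.src '' Q.1 := congrArg Subtype.val e
        exact Subtype.ext ((key P Q hP hQ e').antisymm (key Q P hQ hP e'.symm))
      injOn_rng := by
        have key : ∀ P Q : G.SymArr r, P.1 ⊆ ((g : G.Bisec) : Set G.Arr) →
            Q.1 ⊆ ((g : G.Bisec) : Set G.Arr) → G.rng '' P.1 = G.rng '' Q.1 → P.1 ⊆ Q.1 := by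
          intro P Q hP hQ e γ hγ
          obtain ⟨δ, hδ, e'⟩ := e.le ⟨γ, hγ, rfl⟩
          rwa [← g.1.rng_inj (hQ hδ) (hP hγ) e']
        intro P hP Q hQ e
        have e' : G.rng '' P.1 = G.rng '' Q.1 := congrArg Subtype.val e
        exact Subtype.ext ((key P Q hP hQ e').antisymm (key Q P hQ hP e'.symm)) }
  property := by
    have hs : ∀ A : Set G.Arr, A ⊆ ((g : G.Bisec) : Set G.Arr) → InjOn G.src A :=
      fun A hA => (g : G.Bisec).injOn_src.mono hA
    have hr : ∀ A : Set G.Arr, A ⊆ ((g : G.Bisec) : Set G.Arr) → InjOn G.rng A :=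
      fun A hA => (g : G.Bisec).injOn_rng.mono hA
    constructor
    · refine eq_univ_of_forall fun A => ?_
      have hsub : {γ | γ ∈ (g : G.Bisec) ∧ G.src γ ∈ A.1} ⊆ ((g : G.Bisec) : Set G.Arr) :=
        fun γ h => h.1
      have himg : G.src '' {γ | γ ∈ (g : G.Bisec) ∧ G.src γ ∈ A.1} = A.1 := by
        ext x
        constructor
        · rintro ⟨γ, ⟨-, h⟩, rfl⟩; exact h
        · intro hx
          obtain ⟨γ, hγ, rfl⟩ := exists_src_eq g x
          exact ⟨γ, ⟨hγ, hx⟩, rfl⟩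
      refine ⟨(⟨_, ?_, ?_, hs _ hsub, hr _ hsub⟩ : G.SymArr r), hsub, Subtype.ext himg⟩
      · rw [← image_nonempty (f := G.src), himg]; exact A.2.1
      · rw [← (hs _ hsub).encard_image, himg]; exact A.2.2
    · refine eq_univ_of_forall fun A => ?_
      have hsub : {γ | γ ∈ (g : G.Bisec) ∧ G.rng γ ∈ A.1} ⊆ ((g : G.Bisec) : Set G.Arr) :=
        fun γ h => h.1
      have himg : G.rng '' {γ | γ ∈ (g : G.Bisec) ∧ G.rng γ ∈ A.1} = A.1 := by
        ext x
        constructor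
        · rintro ⟨γ, ⟨-, h⟩, rfl⟩; exact h
        · intro hx
          obtain ⟨γ, hγ, rfl⟩ := exists_rng_eq g x
          exact ⟨γ, ⟨hγ, hx⟩, rfl⟩
      refine ⟨(⟨_, ?_, ?_, hs _ hsub, hr _ hsub⟩ : G.SymArr r), hsub, Subtype.ext himg⟩
      · rw [← image_nonempty (f := G.rng), himg]; exact A.2.1
      · rw [← (hr _ hsub).encard_image, himg]; exact A.2.2

end SymmetricPower

section Morphism

variable {X : Type u} [TopologicalSpace X] [T2Space X] {Y : Type w} [TopologicalSpace Y]
  [T2Space Y]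

/-- A continuous morphism between the pseudogroups of bisections of two étale groupoids: a
semigroup homomorphism that preserves zero, unit and the unions of compatible families. -/
structure ContMorphism (G : EtaleGroupoid.{u, v} X) (H : EtaleGroupoid.{w, z} Y) where
  toFun : G.Bisec → H.Bisec
  map_mul : ∀ S T, toFun (S * T) = toFun S * toFun T
  map_zero : toFun 0 = 0
  map_one : toFun 1 = 1
  map_sUnion : ∀ (F : Set G.Bisec) (hF : ∀ S ∈ F, ∀ T ∈ F, Bisec.Compatible S T),
    (toFun (Bisec.sUnion F hF) : Set H.Arr) = ⋃ S ∈ F, (toFun S : Set H.Arr)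

variable {G : EtaleGroupoid.{u, v} X} {H : EtaleGroupoid.{w, z} Y}

/-- The restriction of a continuous morphism to the full groups. -/
def ContMorphism.fullMap (φ : ContMorphism G H) : G.fullGroup →* H.fullGroup where
  toFun g := ⟨φ.toFun g, by
    constructor
    · refine eq_univ_of_forall fun y => ?_
      have h : H.unit y ∈ φ.toFun ((g⁻¹ : G.fullGroup) : G.Bisec) * φ.toFun (g : G.Bisec) := by
        have e : ((g⁻¹ : G.fullGroup) : G.Bisec) * (g : G.Bisec) = 1 :=
          congrArg Subtype.val (inv_mul_cancel g)
        rw [← φ.map_mul, e]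
        exact φ.map_one ▸ Bisec.mem_one.2 ⟨y, rfl⟩
      obtain ⟨α, -, β, hβ, e, h⟩ := h
      exact ⟨β, hβ, by rw [← H.src_unit y, h, src_mul]⟩
    · refine eq_univ_of_forall fun y => ?_
      have h : H.unit y ∈ φ.toFun (g : G.Bisec) * φ.toFun ((g⁻¹ : G.fullGroup) : G.Bisec) := by
        have e : (g : G.Bisec) * ((g⁻¹ : G.fullGroup) : G.Bisec) = 1 :=
          congrArg Subtype.val (mul_inv_cancel g)
        rw [← φ.map_mul, e]
        exact φ.map_one ▸ Bisec.mem_one.2 ⟨y, rfl⟩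
      obtain ⟨α, hα, β, -, e, h⟩ := h
      exact ⟨α, hα, by rw [← H.rng_unit y, h, rng_mul]⟩⟩
  map_one' := Subtype.ext φ.map_one
  map_mul' g h := Subtype.ext (φ.map_mul g h)

end Morphism

section Cases

variable {X : Type u} [TopologicalSpace X] [T2Space X] {Y : Type w} [TopologicalSpace Y]
  [T2Space Y] {G : EtaleGroupoid.{u, v} X} {H : EtaleGroupoid.{w, z} Y}
  {K : Subgroup G.fullGroup} (ρ : K →* H.fullGroup)

/-- The support `Z` of the image of the alternating full group of `G` under a homomorphism
`ρ` defined on a subgroup `K` of the full group. -/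
def altSupp : Set Y := subgroupSupp ((G.altGroup.subgroupOf K).map ρ)

/-- For some point of `Z`, the germ map `g ↦ [ρ g]_y` is injective. -/
def HasInjectiveGermMap : Prop :=
  ∃ y ∈ altSupp ρ, Function.Injective fun g : K => germ (ρ g) y

/-- For `Z` clopen and a continuous morphism `φ` from the pseudogroup of `G^[r]` to that of `H|Z`,
the homomorphism induced by `φ` from the full group of `G`, embedded in that of `G^[r]`, to the
full group of `H|Z`, which is identified with a subset of the full group of `H`. -/
def inducedFull {Z : Set Y} (hZ : IsClopen Z) {r : ℕ} [NeZero r]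
    (φ : ContMorphism (G.symPow r) (H.restrict Z hZ.isOpen)) (g : G.fullGroup) : H.fullGroup :=
  extendFull hZ (φ.fullMap (powFull r g))

/-- The continuous morphism `φ` extends the restriction of `ρ` to the alternating full group. -/
def Extends {Z : Set Y} (hZ : IsClopen Z) {r : ℕ} [NeZero r]
    (φ : ContMorphism (G.symPow r) (H.restrict Z hZ.isOpen)) : Prop :=
  ∀ a : K, (a : G.fullGroup) ∈ G.altGroup → inducedFull hZ φ a = ρ a

/-- The set `Z` is non-empty and clopen and, for some `r ≥ 1`, there is exactly one continuous
morphism `φ` from the pseudogroup of `G^[r]` to that of `H|Z` extending the restriction of `ρ`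
to the alternating full group; moreover `ρ g = φ g * ψ [g]` for a homomorphism `ψ` on the quotient
of `K` by the alternating full group whose image centralises `φ K`. -/
def HasUniqueExtension : Prop :=
  (altSupp ρ).Nonempty ∧ ∃ hZ : IsClopen (altSupp ρ), ∃ (r : ℕ) (_ : NeZero r),
    ∃ φ : ContMorphism (G.symPow r) (H.restrict (altSupp ρ) hZ.isOpen),
      Extends ρ hZ φ ∧
      (∀ φ' : ContMorphism (G.symPow r) (H.restrict (altSupp ρ) hZ.isOpen),
        Extends ρ hZ φ' → φ' = φ) ∧
      ∃ ψ : K ⧸ G.altGroup.subgroupOf K →* H.fullGroup,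
        (∀ (x : K ⧸ G.altGroup.subgroupOf K) (g : K), Commute (ψ x) (inducedFull hZ φ g)) ∧
        ∀ g : K, ρ g = inducedFull hZ φ g * ψ (QuotientGroup.mk g)

end Cases

end EtaleGroupoid

/-!
The full group of `G` acts on the unit space `X`, and the alternating full group is generated by
`3`-cycles `a • U → b • U → c • U → a • U` of small clopen sets. For an open set `W` of `X` let
`altOn Γ W` be the group generated by the `3`-cycles in `W`. The proof looks, for each point `y` of
the support `Z`, at the group `isotropy ρ y` of the elements `g` for which `ρ g` has a unit germ at
`y`.

If no germ map is injective, then each of these groups is non-trivial, and by compactness of `Z` a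
finite set of non-trivial elements meets all of them. The elements of the alternating full group
permute these groups by conjugation, so each group is confined: all its conjugates meet one finite
set. `FullAction.ConfinedBy.exists_finite_compl` shows that a confined subgroup contains
`altOn Γ W` for an open set `W` whose complement is finite, with a bound on its cardinality. This
rests on three facts: the groups `altOn Γ W` are perfect, they have no proper subgroups of finite
index, and overlapping ones generate that of the union. Together with a coloring argument
(`FullAction.exists_pair_of_coloring`), which replaces one of the conjugates by a commutator, they
give some non-empty open set first, and then a cofinite one.

So each `y` in `Z` has a smallest finite set `germSupp ρ y`, its support, such that the germ of `ρ a`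
at `y`, for `a` in the alternating full group, only depends on the germs of `a` at the support. That
it suffices for the latter germs to be units, as opposed to `a` being generated by `3`-cycles outside
the support, is `FullAction.mem_altOn_compl`. Supports move with the action, and they are non-empty
and vary continuously with `y`; it follows that `Z` is open. Hence `y ↦ germSupp ρ y` is a
continuous equivariant map from `Z` to the symmetric power of `X`. The extension maps a bisection
`S` of the symmetric power to the set of the germs of `ρ a` at `y` for which the germ of `a` at the
support of `y` belongs to `S`; it is defined on all of `S` because, by minimality, finitely many
germs with distinct sources and ranges are germs of one element of the alternating full group.

Any extension attaches to each `y` a point of the symmetric power, which has to be the support of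
`y` (`EtaleGroupoid.FinitelySupported.eq_suppPt`), and this gives uniqueness. The elements
`(φ g)⁻¹ * ρ g`, for the extension `φ`, commute with the image of the alternating full group; so they
preserve supports and commute with the image of `φ`, which makes `g ↦ (φ g)⁻¹ * ρ g` a homomorphism
that is trivial on the alternating full group.

The three cases exclude each other because an extension maps non-trivial elements with unit germs at
the finite set attached to `y` to elements with unit germ at `y`.
-/

/-! ### Full actions and permutations of clopen sets -/

/-- An action of a group on a topological space that is continuous and faithful, and such that the
group contains every bijection of the space that agrees locally with elements of the group. -/
class IsFullAction (Γ : Type*) (X : Type*) [Group Γ] [TopologicalSpace X] [MulAction Γ X] : Prop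
    extends ContinuousConstSMul Γ X, FaithfulSMul Γ X where
  exists_of_locally : ∀ f : X → X, Function.Bijective f →
    (∀ x, ∃ g : Γ, ∀ᶠ y in 𝓝 x, f y = g • y) → ∃ g : Γ, ∀ x, g • x = f x

namespace FullAction

open Equiv Pointwise

section Shuffle

variable {Γ : Type*} {X : Type*} [Group Γ] [TopologicalSpace X] [MulAction Γ X] {ι : Type*}

/-- A frame: a family `g` of group elements and a clopen set `U` whose translates by the members of
the family are pairwise disjoint. -/
structure IsFrame (g : ι → Γ) (U : Set X) : Prop where
  isClopen : IsClopen U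
  index_eq : ∀ i j, ∀ x ∈ U, ∀ y ∈ U, g i • x = g j • y → i = j

/-- The element `c` permutes the translates `g i • U` by the permutation `σ` of their indices,
through the maps `g (σ i) * (g i)⁻¹`, and fixes the points outside them. -/
def IsShuffle (g : ι → Γ) (U : Set X) (σ : Perm ι) (c : Γ) : Prop :=
  (∀ i, ∀ x ∈ U, c • g i • x = g (σ i) • x) ∧
    ∀ y : X, (∀ i, ∀ x ∈ U, g i • x ≠ y) → c • y = y

open Classical in
/-- The element of the group that permutes the translates of a frame by a given permutation; the
identity if there is none. -/
noncomputable def shuffle (g : ι → Γ) (U : Set X) (σ : Perm ι) : Γ :=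
  if h : ∃ c, IsShuffle g U σ c then h.choose else 1

theorem IsFrame.mono {g : ι → Γ} {U V : Set X} (hg : IsFrame g U) (hV : IsClopen V) (h : V ⊆ U) :
    IsFrame g V :=
  ⟨hV, fun _ _ x hx y hy e => hg.index_eq _ _ x (h hx) y (h hy) e⟩

theorem IsFrame.comp {κ : Type*} {g : ι → Γ} {U : Set X} (hg : IsFrame g U) {e : κ → ι}
    (he : Function.Injective e) : IsFrame (fun k => g (e k)) U :=
  ⟨hg.isClopen, fun _ _ x hx y hy h => he (hg.index_eq _ _ x hx y hy h)⟩

theorem IsFrame.mul_left {g : ι → Γ} {U : Set X} (hg : IsFrame g U) (h : Γ) :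
    IsFrame (fun i => h * g i) U :=
  ⟨hg.isClopen, fun i j x hx y hy e => hg.index_eq i j x hx y hy
    (by simpa [mul_smul] using e)⟩

theorem IsFrame.congr {g g' : ι → Γ} {U : Set X} (hg : IsFrame g U)
    (h : ∀ i, ∀ x ∈ U, g i • x = g' i • x) : IsFrame g' U :=
  ⟨hg.isClopen, fun i j x hx y hy e => hg.index_eq i j x hx y hy
    (by rw [h i x hx, h j y hy, e])⟩

variable [IsFullAction Γ X]

theorem ext_smul {g h : Γ} (H : ∀ x : X, g • x = h • x) : g = h :=
  FaithfulSMul.eq_of_smul_eq_smul H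

theorem IsFrame.mul_right {g : ι → Γ} {U : Set X} {k : Γ} (hg : IsFrame g (k • U)) :
    IsFrame (fun i => g i * k) U := by
  refine ⟨?_, fun i j x hx y hy e => ?_⟩
  · have := hg.isClopen.preimage (continuous_const_smul k)
    convert this using 1
    ext x
    simp
  · rw [mul_smul, mul_smul] at e
    exact hg.index_eq i j _ (smul_mem_smul_set hx) _ (smul_mem_smul_set hy) e

theorem IsShuffle.unique {g : ι → Γ} {U : Set X} {σ : Perm ι} {c d : Γ}
    (hc : IsShuffle g U σ c) (hd : IsShuffle g U σ d) : c = d := by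
  refine ext_smul (X := X) fun y => ?_
  by_cases h : ∀ i, ∀ x ∈ U, g i • x ≠ y
  · rw [hc.2 y h, hd.2 y h]
  · push Not at h
    obtain ⟨i, x, hx, rfl⟩ := h
    rw [hc.1 i x hx, hd.1 i x hx]

theorem IsShuffle.eq {g : ι → Γ} {U : Set X} {σ : Perm ι} {c : Γ} (hc : IsShuffle g U σ c) :
    shuffle g U σ = c := by
  have h : ∃ c, IsShuffle g U σ c := ⟨c, hc⟩
  rw [shuffle, dif_pos h]
  exact h.choose_spec.unique hc

variable [Finite ι] in
/-- Frames with finitely many members have shuffles, because the group of a full action contains all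
bijections that are locally given by its elements. -/
theorem IsFrame.isShuffle {g : ι → Γ} {U : Set X} (hg : IsFrame g U) (σ : Perm ι) :
    IsShuffle g U σ (shuffle g U σ) := by
  classical
  suffices h : ∃ c, IsShuffle g U σ c by
    rw [shuffle, dif_pos h]; exact h.choose_spec
  let f : Perm ι → X → X := fun τ y =>
    if h : ∃ i, (g i)⁻¹ • y ∈ U then g (τ h.choose) • (g h.choose)⁻¹ • y else y
  have f1 : ∀ τ i, ∀ x ∈ U, f τ (g i • x) = g (τ i) • x := by
    intro τ i x hx
    have h : ∃ j, (g j)⁻¹ • g i • x ∈ U := ⟨i, by simpa using hx⟩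
    have e : h.choose = i := hg.index_eq _ _ _ h.choose_spec x hx (by simp)
    simp only [f]
    rw [dif_pos h, e]
    simp
  have f2 : ∀ τ y, (∀ i, ∀ x ∈ U, g i • x ≠ y) → f τ y = y := by
    intro τ y hy
    have h : ¬ ∃ i, (g i)⁻¹ • y ∈ U := fun ⟨i, hi⟩ => hy i _ hi (by simp)
    simp only [f]
    rw [dif_neg h]
  have f3 : ∀ τ τ', τ * τ' = 1 → ∀ y, f τ (f τ' y) = y := by
    intro τ τ' e y
    by_cases h : ∀ i, ∀ x ∈ U, g i • x ≠ y
    · rw [f2 τ' y h, f2 τ y h]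
    · push Not at h
      obtain ⟨i, x, hx, rfl⟩ := h
      rw [f1 τ' i x hx, f1 τ _ x hx, ← Perm.mul_apply, e, Perm.one_apply]
  have hb : Function.Bijective (f σ) :=
    Function.bijective_iff_has_inverse.2
      ⟨f σ⁻¹, f3 _ _ (inv_mul_cancel σ), f3 _ _ (mul_inv_cancel σ)⟩
  have hcl : ∀ i, IsClopen {y | (g i)⁻¹ • y ∈ U} := fun i =>
    hg.isClopen.preimage (continuous_const_smul (g i)⁻¹)
  obtain ⟨c, hc⟩ := IsFullAction.exists_of_locally (Γ := Γ) (f σ) hb (by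
    intro y
    by_cases h : ∃ i, (g i)⁻¹ • y ∈ U
    · obtain ⟨i, hi⟩ := h
      refine ⟨g (σ i) * (g i)⁻¹, ?_⟩
      filter_upwards [(hcl i).isOpen.mem_nhds hi] with z hz
      have := f1 σ i _ hz
      rw [smul_inv_smul] at this
      rw [this, mul_smul]
    · refine ⟨1, ?_⟩
      have ho : IsOpen {z | ∃ i, (g i)⁻¹ • z ∈ U}ᶜ := by
        have : {z | ∃ i, (g i)⁻¹ • z ∈ U} = ⋃ i, {z | (g i)⁻¹ • z ∈ U} := by ext; simp
        rw [this]
        exact (isClosed_iUnion_of_finite fun i => (hcl i).isClosed).isOpen_compl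
      filter_upwards [ho.mem_nhds h] with z hz
      rw [one_smul]
      exact f2 σ z fun i x hx e => hz ⟨i, by rw [← e]; simpa using hx⟩)
  exact ⟨c, fun i x hx => by rw [hc, f1 σ i x hx], fun y hy => by rw [hc, f2 σ y hy]⟩

variable [Finite ι]

theorem shuffle_mul {g : ι → Γ} {U : Set X} (hg : IsFrame g U) (σ τ : Perm ι) :
    shuffle g U (σ * τ) = shuffle g U σ * shuffle g U τ := by
  refine IsShuffle.eq ⟨fun i x hx => ?_, fun y hy => ?_⟩
  · rw [mul_smul, (hg.isShuffle τ).1 i x hx, (hg.isShuffle σ).1 _ x hx, Perm.mul_apply]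
  · rw [mul_smul, (hg.isShuffle τ).2 y hy, (hg.isShuffle σ).2 y hy]

omit [Finite ι] in
theorem shuffle_one (g : ι → Γ) (U : Set X) : shuffle g U 1 = 1 :=
  IsShuffle.eq ⟨fun i x _ => by simp, fun y _ => by simp⟩

theorem shuffle_inv {g : ι → Γ} {U : Set X} (hg : IsFrame g U) (σ : Perm ι) :
    shuffle g U σ⁻¹ = (shuffle g U σ)⁻¹ := by
  rw [eq_inv_iff_mul_eq_one, ← shuffle_mul hg, inv_mul_cancel, shuffle_one]

/-- The homomorphism from the symmetric group given by a frame. -/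
noncomputable def shuffleHom {g : ι → Γ} {U : Set X} (hg : IsFrame g U) : Perm ι →* Γ where
  toFun := shuffle g U
  map_one' := shuffle_one g U
  map_mul' := shuffle_mul hg

theorem conj_shuffle {g : ι → Γ} {U : Set X} (hg : IsFrame g U) (σ : Perm ι) (h : Γ) :
    h * shuffle g U σ * h⁻¹ = shuffle (fun i => h * g i) U σ := by
  refine (IsShuffle.eq ⟨fun i x hx => ?_, fun y hy => ?_⟩).symm
  · rw [mul_smul, mul_smul, mul_smul, inv_smul_smul, (hg.isShuffle σ).1 i x hx, mul_smul]
  · rw [mul_smul, mul_smul, (hg.isShuffle σ).2, smul_inv_smul]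
    intro i x hx e
    exact hy i x hx (by rw [mul_smul, e, smul_inv_smul])

theorem shuffle_smul_set {g : ι → Γ} {U : Set X} {k : Γ} (hg : IsFrame g (k • U)) (σ : Perm ι) :
    shuffle (fun i => g i * k) U σ = shuffle g (k • U) σ := by
  refine IsShuffle.eq ⟨fun i x hx => ?_, fun y hy => ?_⟩
  · rw [mul_smul, (hg.isShuffle σ).1 i _ (smul_mem_smul_set hx), mul_smul]
  · refine (hg.isShuffle σ).2 y ?_
    rintro i _ ⟨x, hx, rfl⟩ e
    exact hy i x hx (by rw [mul_smul]; exact e)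

theorem shuffle_congr {g g' : ι → Γ} {U : Set X} (hg : IsFrame g U) (σ : Perm ι)
    (h : ∀ i, ∀ x ∈ U, g i • x = g' i • x) : shuffle g U σ = shuffle g' U σ := by
  refine IsShuffle.eq ⟨fun i x hx => ?_, fun y hy => ?_⟩
  · rw [h i x hx, ((hg.congr h).isShuffle σ).1 i x hx, h _ x hx]
  · exact ((hg.congr h).isShuffle σ).2 y fun i x hx e => hy i x hx (by rw [h i x hx, e])

theorem shuffle_union {g : ι → Γ} {U V : Set X} (hg : IsFrame g (U ∪ V)) (hU : IsClopen U)
    (hV : IsClopen V) (hd : Disjoint U V) (σ : Perm ι) :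
    shuffle g (U ∪ V) σ = shuffle g U σ * shuffle g V σ := by
  have hgU := hg.mono hU subset_union_left
  have hgV := hg.mono hV subset_union_right
  have key : ∀ i j, ∀ x ∈ U, ∀ y ∈ V, g i • x ≠ g j • y := by
    intro i j x hx y hy e
    obtain rfl := hg.index_eq i j x (Or.inl hx) y (Or.inr hy) e
    rw [smul_left_cancel_iff] at e
    exact Set.disjoint_left.1 hd hx (e ▸ hy)
  refine IsShuffle.eq ⟨fun i x hx => ?_, fun y hy => ?_⟩
  · rw [mul_smul]
    rcases hx with hx | hx
    · rw [(hgV.isShuffle σ).2 (g i • x) fun j y hy => (key i j x hx y hy).symm,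
        (hgU.isShuffle σ).1 i x hx]
    · rw [(hgV.isShuffle σ).1 i x hx,
        (hgU.isShuffle σ).2 _ fun j y hy => key j _ y hy x hx]
  · rw [mul_smul, (hgV.isShuffle σ).2 y fun i x hx => hy i x (Or.inr hx),
      (hgU.isShuffle σ).2 y fun i x hx => hy i x (Or.inl hx)]

omit [Finite ι] in
theorem shuffle_empty (g : ι → Γ) (σ : Perm ι) : shuffle g (∅ : Set X) σ = 1 :=
  IsShuffle.eq ⟨fun i x hx => hx.elim, fun y _ => by simp⟩

/-- The `3`-cycle `a • U → b • U → c • U → a • U`. -/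
noncomputable def tri (a b c : Γ) (U : Set X) : Γ := shuffle ![a, b, c] U (finRotate 3)

/-- The `3`-cycle `i → j → k → i`. -/
def cyc {ι : Type*} [DecidableEq ι] (i j k : ι) : Perm ι := swap i j * swap j k

theorem tri_eq_shuffle [DecidableEq ι] {g : ι → Γ} {U : Set X} (hg : IsFrame g U) {i j k : ι}
    (hij : i ≠ j) (hjk : j ≠ k) (hik : i ≠ k) :
    tri (g i) (g j) (g k) U = shuffle g U (cyc i j k) := by
  have h1 : cyc i j k i = j := by simp [cyc, swap_apply_of_ne_of_ne hij hik]
  have h2 : cyc i j k j = k := by simp [cyc, swap_apply_of_ne_of_ne hik.symm hjk.symm]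
  have h3 : cyc i j k k = i := by simp [cyc]
  have h4 : ∀ l, l ≠ i → l ≠ j → l ≠ k → cyc i j k l = l := by
    intro l a b c
    simp [cyc, swap_apply_of_ne_of_ne, a, b, c]
  have e0 : finRotate 3 0 = 1 := by decide
  have e1 : finRotate 3 1 = 2 := by decide
  have e2 : finRotate 3 2 = 0 := by decide
  refine IsShuffle.eq ⟨fun l x hx => ?_, fun y hy => ?_⟩
  · fin_cases l
    · simpa [h1, e0] using (hg.isShuffle (cyc i j k)).1 i x hx
    · simpa [h2, e1] using (hg.isShuffle (cyc i j k)).1 j x hx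
    · simpa [h3, e2] using (hg.isShuffle (cyc i j k)).1 k x hx
  · by_cases h : ∀ l, ∀ x ∈ U, g l • x ≠ y
    · exact (hg.isShuffle _).2 y h
    · push Not at h
      obtain ⟨l, x, hx, rfl⟩ := h
      rw [(hg.isShuffle _).1 l x hx, h4 l]
      · rintro rfl; exact hy 0 x hx rfl
      · rintro rfl; exact hy 1 x hx rfl
      · rintro rfl; exact hy 2 x hx rfl

theorem conj_tri {a b c : Γ} {U : Set X} (hg : IsFrame ![a, b, c] U) (h : Γ) :
    h * tri a b c U * h⁻¹ = tri (h * a) (h * b) (h * c) U := by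
  rw [tri, conj_shuffle hg, tri]
  congr 1
  ext i
  fin_cases i <;> rfl

theorem IsFrame.conj_tri {a b c : Γ} {U : Set X} (hg : IsFrame ![a, b, c] U) (h : Γ) :
    IsFrame ![h * a, h * b, h * c] U := by
  convert hg.mul_left h using 1
  ext i
  fin_cases i <;> rfl

theorem tri_congr {a b c a' b' c' : Γ} {U : Set X} (hg : IsFrame ![a, b, c] U)
    (ha : ∀ x ∈ U, a • x = a' • x) (hb : ∀ x ∈ U, b • x = b' • x)
    (hc : ∀ x ∈ U, c • x = c' • x) : tri a b c U = tri a' b' c' U :=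
  shuffle_congr hg _ fun i x hx => by
    fin_cases i
    · exact ha x hx
    · exact hb x hx
    · exact hc x hx

theorem tri_smul_set {a b c : Γ} {U : Set X} {k : Γ} (hg : IsFrame ![a, b, c] (k • U)) :
    tri (a * k) (b * k) (c * k) U = tri a b c (k • U) := by
  rw [tri, tri, ← shuffle_smul_set hg]
  congr 1
  ext i
  fin_cases i <;> rfl

theorem tri_smul_fst {a b c : Γ} {U : Set X} (hg : IsFrame ![a, b, c] U) {x : X} (hx : x ∈ U) :
    tri a b c U • a • x = b • x := (hg.isShuffle (finRotate 3)).1 0 x hx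

theorem tri_smul_of_forall_ne {a b c : Γ} {U : Set X} (hg : IsFrame ![a, b, c] U) {y : X}
    (h : ∀ x ∈ U, a • x ≠ y ∧ b • x ≠ y ∧ c • x ≠ y) : tri a b c U • y = y := by
  refine (hg.isShuffle (finRotate 3)).2 y fun i x hx => ?_
  fin_cases i
  · exact (h x hx).1
  · exact (h x hx).2.1
  · exact (h x hx).2.2

theorem tri_rotate (a b c : Γ) {U : Set X} (hg : IsFrame ![a, b, c] U) :
    tri b c a U = tri a b c U ∧ IsFrame ![b, c, a] U := by
  have h1 := tri_eq_shuffle hg (i := 1) (j := 2) (k := 0) (by decide) (by decide) (by decide)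
  have h2 := tri_eq_shuffle hg (i := 0) (j := 1) (k := 2) (by decide) (by decide) (by decide)
  have e : cyc (1 : Fin 3) 2 0 = cyc 0 1 2 := by decide
  rw [e, ← h2] at h1
  refine ⟨h1, ?_⟩
  convert hg.comp (e := ![1, 2, 0]) (by decide) using 1
  ext i
  fin_cases i <;> rfl

end Shuffle

end FullAction

/-! ### Groups generated by 3-cycles -/

namespace FullAction

open Equiv Pointwise

section AltOn

variable {Γ : Type*} {X : Type*} [Group Γ] [TopologicalSpace X] [MulAction Γ X]

variable (Γ) in
/-- The alternating group of `W`: the subgroup generated by the `3`-cycles whose three pieces are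
contained in `W`. -/
def altOn (W : Set X) : Subgroup Γ :=
  Subgroup.closure {t | ∃ (a b c : Γ) (U : Set X), IsFrame ![a, b, c] U ∧
    (∀ x ∈ U, a • x ∈ W ∧ b • x ∈ W ∧ c • x ∈ W) ∧ t = tri a b c U}

theorem tri_mem_altOn {W : Set X} {a b c : Γ} {U : Set X} (hg : IsFrame ![a, b, c] U)
    (h : ∀ x ∈ U, a • x ∈ W ∧ b • x ∈ W ∧ c • x ∈ W) : tri a b c U ∈ altOn Γ W :=
  Subgroup.subset_closure ⟨a, b, c, U, hg, h, rfl⟩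

theorem altOn_mono {W W' : Set X} (h : W ⊆ W') : altOn Γ W ≤ altOn Γ W' :=
  Subgroup.closure_mono fun _ ⟨a, b, c, U, hg, hW, e⟩ =>
    ⟨a, b, c, U, hg, fun x hx => ⟨h (hW x hx).1, h (hW x hx).2.1, h (hW x hx).2.2⟩, e⟩

variable [IsFullAction Γ X]

theorem conj_mem_altOn {W : Set X} {t : Γ} (ht : t ∈ altOn Γ W) (h : Γ) :
    h * t * h⁻¹ ∈ altOn Γ (h • W) := by
  induction ht using Subgroup.closure_induction with
  | mem t ht =>
    obtain ⟨a, b, c, U, hg, hW, rfl⟩ := ht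
    rw [conj_tri hg]
    refine tri_mem_altOn (hg.conj_tri h) fun x hx => ?_
    simp only [mul_smul, smul_mem_smul_set_iff]
    exact hW x hx
  | one => simp
  | mul x y _ _ hx hy =>
    have : h * (x * y) * h⁻¹ = (h * x * h⁻¹) * (h * y * h⁻¹) := by group
    rw [this]
    exact mul_mem hx hy
  | inv x _ hx =>
    have : h * x⁻¹ * h⁻¹ = (h * x * h⁻¹)⁻¹ := by group
    rw [this]
    exact inv_mem hx

theorem conj_mem_altOn' {W : Set X} {t h : Γ} (ht : h * t * h⁻¹ ∈ altOn Γ (h • W)) :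
    t ∈ altOn Γ W := by
  have := conj_mem_altOn ht h⁻¹
  rw [inv_smul_smul] at this
  convert this using 1
  group

/-- Elements of `altOn Γ W` are trivial near every point outside `W`. -/
theorem eventually_smul_eq {W : Set X} {t : Γ} (ht : t ∈ altOn Γ W) {x : X} (hx : x ∉ W) :
    ∀ᶠ y in 𝓝 x, t • y = y := by
  induction ht using Subgroup.closure_induction with
  | mem t ht =>
    obtain ⟨a, b, c, U, hg, hW, rfl⟩ := ht
    have hcl : ∀ k : Γ, IsOpen {y | k⁻¹ • y ∉ U} := fun k =>
      (hg.isClopen.isClosed.preimage (continuous_const_smul k⁻¹)).isOpen_compl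
    have hxm : ∀ k : Γ, (∀ y ∈ U, k • y ∈ W) → x ∈ {y | k⁻¹ • y ∉ U} := fun k hk h =>
      hx (by simpa using hk _ h)
    filter_upwards [(hcl a).mem_nhds (hxm a fun y hy => (hW y hy).1),
      (hcl b).mem_nhds (hxm b fun y hy => (hW y hy).2.1),
      (hcl c).mem_nhds (hxm c fun y hy => (hW y hy).2.2)] with y ha hb hc
    refine tri_smul_of_forall_ne hg fun z hz => ⟨?_, ?_, ?_⟩ <;> rintro rfl
    · exact ha (by simpa using hz)
    · exact hb (by simpa using hz)
    · exact hc (by simpa using hz)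
  | one => simp
  | mul s t _ _ hs ht =>
    filter_upwards [hs, ht] with y h1 h2
    rw [mul_smul, h2, h1]
  | inv s _ hs =>
    filter_upwards [hs] with y h1
    rw [inv_smul_eq_iff, h1]

theorem smul_eq_of_notMem {W : Set X} {t : Γ} (ht : t ∈ altOn Γ W) {x : X} (hx : x ∉ W) :
    t • x = x := (eventually_smul_eq ht hx).self_of_nhds

theorem smul_mem_of_mem {W : Set X} {t : Γ} (ht : t ∈ altOn Γ W) {x : X} (hx : x ∈ W) :
    t • x ∈ W := by
  by_contra h
  have := smul_eq_of_notMem ht h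
  rw [smul_left_cancel_iff] at this
  exact h (by rwa [this])

theorem smul_set_eq {W : Set X} {t : Γ} (ht : t ∈ altOn Γ W) : t • W = W := by
  ext x
  rw [mem_smul_set_iff_inv_smul_mem]
  exact ⟨fun h => by simpa using smul_mem_of_mem ht h, smul_mem_of_mem (inv_mem ht)⟩

theorem commute_of_disjoint {W W' : Set X} (h : Disjoint W W') {s t : Γ} (hs : s ∈ altOn Γ W)
    (ht : t ∈ altOn Γ W') : Commute s t := by
  refine ext_smul (X := X) fun x => ?_
  rw [mul_smul, mul_smul]
  by_cases hx : x ∈ W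
  · rw [smul_eq_of_notMem ht (Set.disjoint_left.1 h hx),
      smul_eq_of_notMem ht (Set.disjoint_left.1 h (smul_mem_of_mem hs hx))]
  · rw [smul_eq_of_notMem hs hx]
    by_cases hx' : x ∈ W'
    · rw [smul_eq_of_notMem hs (Set.disjoint_right.1 h (smul_mem_of_mem ht hx'))]
    · rw [smul_eq_of_notMem ht hx', smul_eq_of_notMem hs hx]

section Compact

variable [CompactSpace X] [T2Space X] [TotallyDisconnectedSpace X]

omit [IsFullAction Γ X] in
theorem exists_clopen {x : X} {V : Set X} (hV : V ∈ 𝓝 x) : ∃ U, IsClopen U ∧ x ∈ U ∧ U ⊆ V := by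
  obtain ⟨U, hU, hx, hUV⟩ := compact_exists_isClopen_in_isOpen isOpen_interior
    (mem_interior_iff_mem_nhds.2 hV)
  exact ⟨U, hU, hx, hUV.trans interior_subset⟩

/-- To show that a subgroup contains `altOn Γ W` it is enough to show that it contains all
`3`-cycles in `W` with sufficiently small pieces. -/
theorem altOn_le_of_local {W : Set X} {N : Subgroup Γ}
    (h : ∀ (x : X) (a b c : Γ), a • x ∈ W → b • x ∈ W → c • x ∈ W → a • x ≠ b • x →
      b • x ≠ c • x → a • x ≠ c • x → ∃ V ∈ 𝓝 x, ∀ U ⊆ V, IsFrame ![a, b, c] U →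
        tri a b c U ∈ N) : altOn Γ W ≤ N := by
  rw [altOn, Subgroup.closure_le]
  rintro _ ⟨a, b, c, U, hg, hW, rfl⟩
  have hU : IsCompact U := hg.isClopen.isClosed.isCompact
  suffices h : ∃ T, U ⊆ T ∧ IsClopen T ∧ ∀ U' ⊆ T, U' ⊆ U → IsClopen U' → tri a b c U' ∈ N by
    obtain ⟨T, hUT, -, hT⟩ := h
    exact hT U hUT subset_rfl hg.isClopen
  refine hU.induction_on
    (p := fun S => ∃ T, S ⊆ T ∧ IsClopen T ∧ ∀ U' ⊆ T, U' ⊆ U → IsClopen U' →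
      tri a b c U' ∈ N) ?_ ?_ ?_ ?_
  · refine ⟨∅, subset_rfl, isClopen_empty, fun U' hU' _ _ => ?_⟩
    obtain rfl := subset_empty_iff.1 hU'
    rw [tri, shuffle_empty]
    exact one_mem N
  · rintro S S' hSS ⟨T, hT, h⟩
    exact ⟨T, hSS.trans hT, h⟩
  · rintro S S' ⟨T, hST, hT, h⟩ ⟨T', hST', hT', h'⟩
    refine ⟨T ∪ T', union_subset_union hST hST', hT.union hT', fun U' hU' hUU hc => ?_⟩
    have e : U' = (U' ∩ T) ∪ (U' \ T) := (inter_union_sdiff U' T).symm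
    rw [tri, e, shuffle_union (e ▸ hg.mono hc hUU) (hc.inter hT) (hc.diff hT)
      (disjoint_sdiff_inter.symm)]
    refine mul_mem (h _ inter_subset_right (inter_subset_left.trans hUU) (hc.inter hT))
      (h' _ ?_ (sdiff_subset.trans hUU) (hc.diff hT))
    rintro x ⟨hx, hxT⟩
    exact (hU' hx).resolve_left hxT
  · intro x hx
    have hne : ∀ i j : Fin 3, i ≠ j → (![a, b, c] i) • x ≠ (![a, b, c] j) • x :=
      fun i j hij e => hij (hg.index_eq i j x hx x hx e)
    obtain ⟨V, hV, hVN⟩ := h x a b c (hW x hx).1 (hW x hx).2.1 (hW x hx).2.2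
      (hne 0 1 (by decide)) (hne 1 2 (by decide)) (hne 0 2 (by decide))
    obtain ⟨T, hT, hxT, hTV⟩ := exists_clopen hV
    exact ⟨T, mem_nhdsWithin_of_mem_nhds (hT.isOpen.mem_nhds hxT), T, subset_rfl, hT,
      fun U' hU' hUU hc => hVN U' (hU'.trans hTV) (hg.mono hc hUU)⟩

omit [CompactSpace X] [TotallyDisconnectedSpace X] in
/-- Sufficiently small clopen neighbourhoods of a point are bases of frames, with translates in
prescribed neighbourhoods. -/
theorem exists_frame_nhds {ι : Type*} [Finite ι] (g : ι → Γ) (x : X)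
    (hg : Function.Injective fun i => g i • x) (O : ι → Set X) (hO : ∀ i, O i ∈ 𝓝 (g i • x)) :
    ∃ V ∈ 𝓝 x, (∀ i, ∀ y ∈ V, g i • y ∈ O i) ∧ ∀ U ⊆ V, IsClopen U → IsFrame g U := by
  obtain ⟨D, hD, hDd⟩ := (Set.finite_range fun i => g i • x).t2_separation
  refine ⟨⋂ i, {y | g i • y ∈ D (g i • x) ∩ O i}, ?_, ?_, ?_⟩
  · refine Filter.iInter_mem.2 fun i => ?_
    exact (continuous_const_smul (g i)).continuousAt.preimage_mem_nhds
      (Filter.inter_mem ((hD _).2.mem_nhds (hD _).1) (hO i))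
  · intro i y hy
    exact (mem_iInter.1 hy i).2
  · intro U hU hc
    refine ⟨hc, fun i j y hy z hz e => ?_⟩
    by_contra hij
    have h1 := (mem_iInter.1 (hU hy) i).1
    have h2 := (mem_iInter.1 (hU hz) j).1
    rw [e] at h1
    exact Set.disjoint_left.1 (hDd ⟨i, rfl⟩ ⟨j, rfl⟩ fun h => hij (hg h)) h1 h2

variable [PerfectSpace X]

variable (Γ X) in
/-- Every orbit is dense. -/
def DenseOrbits : Prop := ∀ x : X, Dense (MulAction.orbit Γ x)

omit [IsFullAction Γ X] [CompactSpace X] [TotallyDisconnectedSpace X] in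
theorem DenseOrbits.exists_fresh (hd : DenseOrbits Γ X) (x : X) {W : Set X} (hW : IsOpen W)
    (hne : W.Nonempty) {E : Set X} (hE : E.Finite) : ∃ h : Γ, h • x ∈ W ∧ h • x ∉ E := by
  obtain ⟨_, ⟨⟨h, rfl⟩, hh⟩, hW⟩ := ((hd x).sdiff_finite hE).exists_mem_open hW hne
  exact ⟨h, hW, hh⟩

omit [IsFullAction Γ X] [CompactSpace X] [TotallyDisconnectedSpace X] in
theorem DenseOrbits.infinite (hd : DenseOrbits Γ X) (x : X) {W : Set X} (hW : IsOpen W)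
    (hne : W.Nonempty) : (MulAction.orbit Γ x ∩ W).Infinite := by
  intro hf
  obtain ⟨h, h1, h2⟩ := hd.exists_fresh x hW hne hf
  exact h2 ⟨⟨h, rfl⟩, h1⟩

theorem exists_altOn_of_ne (hd : DenseOrbits Γ X) {W : Set X} (hW : IsOpen W) {u : X} {k : Γ}
    (hu : u ∈ W) (hk : k • u ∈ W) (hne : k • u ≠ u) :
    ∃ b ∈ altOn Γ W, ∀ᶠ y in 𝓝 u, b • y = k • y := by
  obtain ⟨h, hh, hE⟩ := hd.exists_fresh u hW ⟨u, hu⟩ (E := {u, k • u}) (by simp)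
  simp only [mem_insert_iff, mem_singleton_iff, not_or] at hE
  have hinj : Function.Injective fun i => (![1, k, h] : Fin 3 → Γ) i • u := by
    have h1 : u ≠ k • u := Ne.symm hne
    have h2 : u ≠ h • u := Ne.symm hE.1
    have h3 : k • u ≠ h • u := Ne.symm hE.2
    intro i j e
    fin_cases i <;> fin_cases j <;> simp [hne, hE.1, hE.2, h1, h2, h3] at e ⊢
  obtain ⟨V, hV, hVO, hVF⟩ := exists_frame_nhds _ u hinj (fun _ => W) (by
    intro i
    refine hW.mem_nhds ?_
    fin_cases i
    · simpa using hu
    · exact hk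
    · exact hh)
  obtain ⟨U, hU, hxU, hUV⟩ := exists_clopen hV
  have hF := hVF U hUV hU
  refine ⟨tri 1 k h U, tri_mem_altOn hF fun x hx => ⟨hVO 0 x (hUV hx), hVO 1 x (hUV hx),
    hVO 2 x (hUV hx)⟩, ?_⟩
  filter_upwards [hU.isOpen.mem_nhds hxU] with y hy
  have := tri_smul_fst hF hy
  rwa [one_smul] at this

/-- Every germ between points of the open set `W` is the germ of an element of `altOn Γ W`. -/
theorem exists_altOn (hd : DenseOrbits Γ X) {W : Set X} (hW : IsOpen W) {u : X} {k : Γ}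
    (hu : u ∈ W) (hk : k • u ∈ W) : ∃ b ∈ altOn Γ W, ∀ᶠ y in 𝓝 u, b • y = k • y := by
  obtain ⟨h, hh, hE⟩ := hd.exists_fresh u hW ⟨u, hu⟩ (E := {u, k • u}) (by simp)
  simp only [mem_insert_iff, mem_singleton_iff, not_or] at hE
  obtain ⟨b, hb, hb'⟩ := exists_altOn_of_ne hd hW hu hh hE.1
  obtain ⟨c, hc, hc'⟩ := exists_altOn_of_ne hd hW (u := h • u) (k := k * h⁻¹) hh
    (by simpa [mul_smul] using hk) (by simpa [mul_smul] using Ne.symm hE.2)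
  refine ⟨c * b, mul_mem hc hb, ?_⟩
  have := (continuous_const_smul h).continuousAt.eventually hc'
  filter_upwards [hb', this] with y h1 h2
  rw [mul_smul, h1, h2, mul_smul, inv_smul_smul]

/-- Finitely many germs with distinct sources and distinct ranges are germs of one element of the
alternating group. -/
theorem exists_altOn_finset (hd : DenseOrbits Γ X) (s : Set X) (hs : s.Finite) (k : X → Γ)
    (hk : InjOn (fun x => k x • x) s) :
    ∃ a ∈ altOn Γ (univ : Set X), ∀ x ∈ s, ∀ᶠ y in 𝓝 x, a • y = k x • y := by
  induction s, hs using Set.Finite.induction_on with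
  | empty => exact ⟨1, one_mem _, by simp⟩
  | @insert m s hm hs ih =>
    obtain ⟨a, ha, hak⟩ := ih (hk.mono (subset_insert _ _))
    have hWo : IsOpen ((fun x => k x • x) '' s)ᶜ := (hs.image _).isClosed.isOpen_compl
    have hu : a • m ∈ ((fun x => k x • x) '' s)ᶜ := by
      rintro ⟨x, hx, e⟩
      dsimp only at e
      rw [← (hak x hx).self_of_nhds, smul_left_cancel_iff] at e
      exact hm (e ▸ hx)
    have hu' : (k m * a⁻¹) • a • m ∈ ((fun x => k x • x) '' s)ᶜ := by
      rw [mul_smul, inv_smul_smul]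
      rintro ⟨x, hx, e⟩
      have := hk (mem_insert_of_mem _ hx) (mem_insert _ _) e
      exact hm (this ▸ hx)
    obtain ⟨b, hb, hb'⟩ := exists_altOn hd hWo hu hu'
    refine ⟨b * a, mul_mem (altOn_mono (subset_univ _) hb) ha, ?_⟩
    rintro x (rfl | hx)
    · have := (continuous_const_smul a).continuousAt.eventually hb'
      filter_upwards [this] with y h1
      rw [mul_smul, h1, mul_smul, inv_smul_smul]
    · have h1 : ∀ᶠ y in 𝓝 (a • x), b • y = y := by
        refine eventually_smul_eq hb ?_
        rw [(hak x hx).self_of_nhds]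
        exact fun h => h ⟨x, hx, rfl⟩
      have := (continuous_const_smul a).continuousAt.eventually h1
      filter_upwards [this, hak x hx] with y h1 h2
      rw [mul_smul, h1, h2]

end Compact

end AltOn

end FullAction

/-! ### Perfectness, finite index and unions -/

namespace FullAction

open Equiv Pointwise

section Generation

variable {Γ : Type*} {X : Type*} [Group Γ] [TopologicalSpace X] [MulAction Γ X]
  [IsFullAction Γ X]

/-- A frame in `W` gives a homomorphism from the alternating group to `altOn Γ W`. -/
theorem shuffle_mem_altOn {ι : Type*} [Fintype ι] [DecidableEq ι] {g : ι → Γ} {U W : Set X}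
    (hg : IsFrame g U) (hW : ∀ i, ∀ x ∈ U, g i • x ∈ W) {σ : Perm ι}
    (hσ : σ ∈ alternatingGroup ι) : shuffle g U σ ∈ altOn Γ W := by
  suffices h : alternatingGroup ι ≤ (altOn Γ W).comap (shuffleHom hg) from h hσ
  rw [← Equiv.Perm.closure_three_cycles_eq_alternating, Subgroup.closure_le]
  intro τ hτ
  have hτ3 : τ.IsThreeCycle := hτ
  obtain ⟨i, hi⟩ : τ.support.Nonempty := by
    rw [← Finset.card_pos, hτ3.card_support]; norm_num
  have h1 := hτ3.nodup_iff_mem_support.2 hi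
  have h2 := hτ3.eq_swap_mul_swap_iff_mem_support.2 hi
  simp only [List.nodup_cons, List.mem_cons, List.not_mem_nil, or_false, not_or] at h1
  have h3 := tri_eq_shuffle hg h1.1.1 h1.2.1 h1.1.2
  rw [cyc, ← h2] at h3
  change shuffle g U τ ∈ altOn Γ W
  rw [← h3]
  refine tri_mem_altOn ?_ fun x hx => ⟨hW _ x hx, hW _ x hx, hW _ x hx⟩
  convert hg.comp (e := ![i, τ i, τ (τ i)]) ?_ using 1
  · ext l; fin_cases l <;> rfl
  · intro l l' e
    have h4 := h1.1.1
    have h5 := h1.1.2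
    have h6 := h1.2.1
    fin_cases l <;> fin_cases l' <;> first | rfl | (exfalso; first
      | exact h4 e | exact h5 e | exact h6 e | exact h4 e.symm | exact h5 e.symm | exact h6 e.symm)

theorem cyc_mem {ι : Type*} [Fintype ι] [DecidableEq ι] {i j k : ι} (hij : i ≠ j) (hjk : j ≠ k) :
    cyc i j k ∈ alternatingGroup ι :=
  Equiv.Perm.mul_mem_alternatingGroup_of_isSwap ⟨i, j, hij, rfl⟩ ⟨j, k, hjk, rfl⟩

section Compact

variable [T2Space X]

/-- Small clopen neighbourhoods are bases of frames in a given open set. -/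
theorem exists_frame_nhds_subset {ι : Type*} [Finite ι] (g : ι → Γ) (x : X)
    (hg : Function.Injective fun i => g i • x) {W : Set X} (hW : IsOpen W)
    (hgW : ∀ i, g i • x ∈ W) :
    ∃ V ∈ 𝓝 x, ∀ U ⊆ V, IsClopen U → IsFrame g U ∧ ∀ i, ∀ y ∈ U, g i • y ∈ W := by
  obtain ⟨V, hV, h1, h2⟩ := exists_frame_nhds g x hg (fun _ => W) fun i => hW.mem_nhds (hgW i)
  exact ⟨V, hV, fun U hU hc => ⟨h2 U hU hc, fun i y hy => h1 i y (hU hy)⟩⟩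

theorem injective_triple {x : X} {a b c : Γ} (hab : a • x ≠ b • x) (hbc : b • x ≠ c • x)
    (hac : a • x ≠ c • x) : Function.Injective fun i => (![a, b, c] : Fin 3 → Γ) i • x := by
  intro l l' e
  fin_cases l <;> fin_cases l' <;> first | rfl | (exfalso; first
    | exact hab e | exact hbc e | exact hac e | exact hab e.symm | exact hbc e.symm
    | exact hac e.symm)

variable [PerfectSpace X]

/-- Finitely many distinct points of an orbit can be completed by one more point of the orbit, in a
given open set and outside a given finite set. -/
theorem DenseOrbits.exists_cons (hd : DenseOrbits Γ X) {x : X} {n : ℕ} {g : Fin n → Γ}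
    (hg : Function.Injective fun i => g i • x) {W : Set X} (hW : IsOpen W) (hne : W.Nonempty)
    {E : Set X} (hE : E.Finite) :
    ∃ h : Γ, h • x ∈ W ∧ h • x ∉ E ∧
      Function.Injective fun i => (Matrix.vecCons h g : Fin (n + 1) → Γ) i • x := by
  obtain ⟨h, h1, h2⟩ := hd.exists_fresh x hW hne (hE.union (finite_range fun i => g i • x))
  rw [mem_union, not_or] at h2
  refine ⟨h, h1, h2.1, fun i j e => ?_⟩
  induction i using Fin.cases with
  | zero =>
    induction j using Fin.cases with
    | zero => rfl
    | succ j => exact absurd ⟨j, e.symm⟩ h2.2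
  | succ i =>
    induction j using Fin.cases with
    | zero => exact absurd ⟨i, e⟩ h2.2
    | succ j => exact congrArg Fin.succ (hg e)

/-- Three distinct points of an orbit in `W` are among `n + 3` distinct points of the orbit in `W`. -/
theorem DenseOrbits.exists_extend (hd : DenseOrbits Γ X) {x : X} {W : Set X} (hW : IsOpen W)
    (hne : W.Nonempty) (n : ℕ) {a b c : Γ} (hab : a • x ≠ b • x) (hbc : b • x ≠ c • x)
    (hac : a • x ≠ c • x) (ha : a • x ∈ W) (hb : b • x ∈ W) (hc : c • x ∈ W) :
    ∃ (g : Fin (n + 3) → Γ) (i j k : Fin (n + 3)), i ≠ j ∧ j ≠ k ∧ i ≠ k ∧ g i = a ∧ g j = b ∧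
      g k = c ∧ (∀ l, g l • x ∈ W) ∧ Function.Injective fun l => g l • x := by
  induction n with
  | zero =>
    refine ⟨![a, b, c], 0, 1, 2, by decide, by decide, by decide, rfl, rfl, rfl, fun l => ?_,
      injective_triple hab hbc hac⟩
    fin_cases l
    · exact ha
    · exact hb
    · exact hc
  | succ n ih =>
    obtain ⟨g, i, j, k, hij, hjk, hik, e1, e2, e3, hgW, hg⟩ := ih
    obtain ⟨h, h1, -, h2⟩ := hd.exists_cons hg hW hne finite_empty
    refine ⟨Matrix.vecCons h g, i.succ, j.succ, k.succ, by simpa using hij, by simpa using hjk,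
      by simpa using hik, e1, e2, e3, fun l => ?_, h2⟩
    induction l using Fin.cases with
    | zero => exact h1
    | succ l => exact hgW l

variable [CompactSpace X] [TotallyDisconnectedSpace X]

/-- The group `altOn Γ W` is perfect: it is contained in every subgroup that contains its
commutators, since with two auxiliary pieces a `3`-cycle is a commutator of `3`-cycles. -/
theorem altOn_le_of_commutator (hd : DenseOrbits Γ X) {W : Set X} (hW : IsOpen W)
    {N : Subgroup Γ} (h : ∀ s ∈ altOn Γ W, ∀ t ∈ altOn Γ W, s * t * (s⁻¹ * t⁻¹) ∈ N) :
    altOn Γ W ≤ N := by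
  refine altOn_le_of_local fun x a b c ha hb hc hab hbc hac => ?_
  obtain ⟨d, hdW, -, hd1⟩ := hd.exists_cons (injective_triple hab hbc hac) hW ⟨_, ha⟩ finite_empty
  obtain ⟨e, heW, -, he1⟩ := hd.exists_cons hd1 hW ⟨_, ha⟩ finite_empty
  obtain ⟨V, hV, hVF⟩ := exists_frame_nhds_subset _ x he1 hW (fun i => by
    fin_cases i
    · exact heW
    · exact hdW
    · exact ha
    · exact hb
    · exact hc)
  refine ⟨V, hV, fun U hU hF => ?_⟩
  obtain ⟨hg, hgW⟩ := hVF U hU hF.isClopen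
  have e1 := tri_eq_shuffle hg (i := 2) (j := 3) (k := 4) (by decide) (by decide) (by decide)
  have e2 : (cyc 2 3 4 : Perm (Fin 5)) = cyc 0 2 3 * cyc 1 2 4 * ((cyc 0 2 3)⁻¹ * (cyc 1 2 4)⁻¹) := by
    decide
  have e3 : tri a b c U = shuffle _ U (cyc 2 3 4 : Perm (Fin 5)) := e1
  rw [e3, e2, shuffle_mul hg, shuffle_mul hg, shuffle_mul hg, shuffle_inv hg, shuffle_inv hg]
  exact h _ (shuffle_mem_altOn hg hgW (cyc_mem (by decide) (by decide))) _ (shuffle_mem_altOn hg hgW (cyc_mem (by decide) (by decide)))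

omit [T2Space X] [PerfectSpace X] [CompactSpace X] [TotallyDisconnectedSpace X]
  [IsFullAction Γ X] [MulAction Γ X] [TopologicalSpace X] [Group Γ] in
/-- Alternating groups of large degree have no proper subgroups of small index: the normal core of
such a subgroup is not trivial by a count, hence everything by simplicity. -/
theorem alternatingGroup_eq_top_of_index_le {m n : ℕ} (hn : n = m + 5)
    (J : Subgroup (alternatingGroup (Fin n))) (hJ : J.index ≤ m) : J = ⊤ := by
  subst hn
  have := alternatingGroup.isSimpleGroup (α := Fin (m + 5)) (by simp)
  have hfin : J.index ≠ 0 := Subgroup.FiniteIndex.index_ne_zero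
  rcases (inferInstance : J.normalCore.Normal).eq_bot_or_eq_top with h | h
  · exfalso
    have h1 : J.normalCore.index ∣ J.index.factorial := by
      rw [Subgroup.normalCore_eq_ker, Subgroup.index_ker, Subgroup.index_eq_card, ← Nat.card_perm]
      exact Subgroup.card_subgroup_dvd_card _
    rw [h, Subgroup.index_bot] at h1
    have h2 := Nat.le_of_dvd (Nat.factorial_pos _) h1
    have h3 := two_mul_nat_card_alternatingGroup (α := Fin (m + 5))
    rw [Nat.card_perm, Nat.card_eq_fintype_card (α := Fin (m + 5)), Fintype.card_fin] at h3
    have h4 : J.index.factorial ≤ m.factorial := Nat.factorial_le hJ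
    have h5 : (m + 5).factorial = (m + 5) * (m + 4).factorial := Nat.factorial_succ _
    have h6 : m.factorial ≤ (m + 4).factorial := Nat.factorial_le (by omega)
    have h7 := Nat.factorial_pos m
    nlinarith
  · exact top_le_iff.1 (h ▸ J.normalCore_le)

/-- The group `altOn Γ W` has no proper subgroup of finite index: every small `3`-cycle is in the
image of an alternating group whose degree is large compared to the index. -/
theorem altOn_le_of_relIndex_ne_zero (hd : DenseOrbits Γ X) {W : Set X} (hW : IsOpen W)
    {K : Subgroup Γ} (hK : K.relIndex (altOn Γ W) ≠ 0) : altOn Γ W ≤ K := by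
  refine altOn_le_of_local fun x a b c ha hb hc hab hbc hac => ?_
  obtain ⟨g, i, j, k, hij, hjk, hik, rfl, rfl, rfl, hgW, hg⟩ :=
    hd.exists_extend hW ⟨_, ha⟩ (K.relIndex (altOn Γ W) + 2) hab hbc hac ha hb hc
  obtain ⟨V, hV, hVF⟩ := exists_frame_nhds_subset _ x hg hW hgW
  refine ⟨V, hV, fun U hU hF => ?_⟩
  obtain ⟨hg, hgW⟩ := hVF U hU hF.isClopen
  let Φ := (shuffleHom hg).comp (alternatingGroup (Fin (K.relIndex (altOn Γ W) + 2 + 3))).subtype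
  have hΦ : Φ.range ≤ altOn Γ W := by
    rintro _ ⟨σ, rfl⟩
    exact shuffle_mem_altOn hg hgW σ.2
  have h1 : K.comap Φ = ⊤ := alternatingGroup_eq_top_of_index_le rfl _ (by
    rw [Subgroup.index_comap]
    exact Subgroup.relIndex_le_of_le_right hΦ hK)
  rw [tri_eq_shuffle hg hij hjk hik]
  have h2 := cyc_mem hij hjk
  have h3 : (⟨_, h2⟩ : alternatingGroup _) ∈ K.comap Φ := h1 ▸ Subgroup.mem_top _
  exact h3

/-- The alternating groups of two overlapping open sets generate that of their union: with two pieces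
`0` and `1` in the intersection, `3`-cycles `(0 1 i)` with `i` in one of the two sets generate all
`3`-cycles. -/
theorem altOn_union_le (hd : DenseOrbits Γ X) {U V : Set X} (hU : IsOpen U) (hV : IsOpen V)
    (hUV : (U ∩ V).Nonempty) {N : Subgroup Γ} (hUN : altOn Γ U ≤ N) (hVN : altOn Γ V ≤ N) :
    altOn Γ (U ∪ V) ≤ N := by
  refine altOn_le_of_local fun x a b c ha hb hc hab hbc hac => ?_
  obtain ⟨d, hdW, -, hd1⟩ := hd.exists_cons (injective_triple hab hbc hac) (hU.inter hV) hUV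
    finite_empty
  obtain ⟨e, heW, -, he1⟩ := hd.exists_cons hd1 (hU.inter hV) hUV finite_empty
  let g : Fin 5 → Γ := ![e, d, a, b, c]
  have hg0 : ∀ i, g i • x ∈ U ∪ V := fun i => by
    fin_cases i
    · exact Or.inl heW.1
    · exact Or.inl hdW.1
    · exact ha
    · exact hb
    · exact hc
  have key : ∀ i : Fin 5, i ≠ 0 → i ≠ 1 → ∃ Q ∈ 𝓝 x, ∀ T ⊆ Q, IsFrame g T →
      shuffle g T (cyc 0 1 i) ∈ N := by
    intro i h0 h1
    have hO : ∃ O, IsOpen O ∧ altOn Γ O ≤ N ∧ g i • x ∈ O ∧ g 0 • x ∈ O ∧ g 1 • x ∈ O := by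
      rcases hg0 i with h | h
      · exact ⟨U, hU, hUN, h, heW.1, hdW.1⟩
      · exact ⟨V, hV, hVN, h, heW.2, hdW.2⟩
    obtain ⟨O, hO, hON, hi, h0', h1'⟩ := hO
    have hinj := injective_triple (a := g 0) (b := g 1) (c := g i) (x := x)
      (fun h => by simpa using he1 h) (fun h => h1 (he1 h).symm) (fun h => h0 (he1 h).symm)
    obtain ⟨Q, hQ, hQF⟩ := exists_frame_nhds_subset _ x hinj hO (fun l => by
      fin_cases l
      · exact h0'
      · exact h1'
      · exact hi)
    refine ⟨Q, hQ, fun T hT hF => hON ?_⟩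
    obtain ⟨h2, h3⟩ := hQF T hT hF.isClopen
    rw [← tri_eq_shuffle hF (by decide) h1.symm h0.symm]
    exact tri_mem_altOn h2 fun y hy => ⟨h3 0 y hy, h3 1 y hy, h3 2 y hy⟩
  obtain ⟨Q2, hQ2, h2⟩ := key 2 (by decide) (by decide)
  obtain ⟨Q3, hQ3, h3⟩ := key 3 (by decide) (by decide)
  obtain ⟨Q4, hQ4, h4⟩ := key 4 (by decide) (by decide)
  obtain ⟨V', hV', hVF⟩ := exists_frame_nhds g x he1 (fun _ => univ) fun i => Filter.univ_mem
  refine ⟨Q2 ∩ (Q3 ∩ (Q4 ∩ V')), by simp [hQ2, hQ3, hQ4, hV'], fun T hT hF => ?_⟩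
  have hgF := hVF.2 T (fun y hy => (hT hy).2.2.2) hF.isClopen
  have e1 := tri_eq_shuffle hgF (i := 2) (j := 3) (k := 4) (by decide) (by decide) (by decide)
  have e2 : (cyc 2 3 4 : Perm (Fin 5)) =
      (cyc 0 1 3 * (cyc 0 1 2)⁻¹) * (cyc 0 1 4 * (cyc 0 1 3)⁻¹) := by decide
  have e3 : tri a b c T = shuffle g T (cyc 2 3 4 : Perm (Fin 5)) := e1
  rw [e3, e2, shuffle_mul hgF, shuffle_mul hgF, shuffle_mul hgF, shuffle_inv hgF, shuffle_inv hgF]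
  have m2 := h2 T (fun y hy => (hT hy).1) hgF
  have m3 := h3 T (fun y hy => (hT hy).2.1) hgF
  have m4 := h4 T (fun y hy => (hT hy).2.2.1) hgF
  exact mul_mem (mul_mem m3 (inv_mem m2)) (mul_mem m4 (inv_mem m3))

/-- The alternating groups of the open sets that meet a fixed open set generate that of their
union. -/
theorem altOn_sUnion_le (hd : DenseOrbits Γ X) {W : Set X} (hW : IsOpen W) {N : Subgroup Γ}
    (hWN : altOn Γ W ≤ N) (F : Set (Set X)) (hF : ∀ U ∈ F, IsOpen U ∧ (U ∩ W).Nonempty ∧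
      altOn Γ U ≤ N) : altOn Γ (⋃₀ F) ≤ N := by
  refine altOn_le_of_local fun x a b c ⟨A, hA, ha⟩ ⟨B, hB, hb⟩ ⟨C, hC, hc⟩ hab hbc hac => ?_
  have step : ∀ O, IsOpen O → W ⊆ O → altOn Γ O ≤ N → ∀ U ∈ F, altOn Γ (O ∪ U) ≤ N := by
    intro O hO hWO hON U hU
    obtain ⟨y, hyU, hyW⟩ := (hF U hU).2.1
    exact altOn_union_le hd hO (hF U hU).1 ⟨y, hWO hyW, hyU⟩ hON (hF U hU).2.2
  have h1 := step W hW subset_rfl hWN A hA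
  have h2 := step _ (hW.union (hF A hA).1) subset_union_left h1 B hB
  have h3 := step _ ((hW.union (hF A hA).1).union (hF B hB).1)
    (subset_union_left.trans subset_union_left) h2 C hC
  obtain ⟨V, hV, hVF⟩ := exists_frame_nhds_subset _ x (injective_triple hab hbc hac)
    (((hW.union (hF A hA).1).union (hF B hB).1).union (hF C hC).1) (fun i => by
      fin_cases i
      · exact Or.inl (Or.inl (Or.inr ha))
      · exact Or.inl (Or.inr hb)
      · exact Or.inr hc)
  refine ⟨V, hV, fun U hU hF => h3 ?_⟩
  have h4 := (hVF U hU hF.isClopen).2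
  exact tri_mem_altOn hF fun y hy => ⟨h4 0 y hy, h4 1 y hy, h4 2 y hy⟩

end Compact

end Generation

end FullAction

/-! ### Elements that are trivial near finitely many points -/

namespace FullAction

open Equiv Pointwise

section Germ

variable {Γ : Type*} {X : Type*} [Group Γ] [TopologicalSpace X] [MulAction Γ X]
  [IsFullAction Γ X]

theorem IsFrame.tri_mul_right {a b c k : Γ} {U : Set X} (hg : IsFrame ![a, b, c] (k • U)) :
    IsFrame ![a * k, b * k, c * k] U := by
  convert hg.mul_right using 1
  ext i
  fin_cases i <;> rfl

/-- Let `τ` be the `3`-cycle `U → k • U → l • k • U`, for a small clopen neighbourhood `U` of `u`, and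
let `τ_f` be the `3`-cycle `f • U → k • U → l • k • U`. The element `τ_f * f * τ⁻¹` fixes the point
`k • u`; the property `Avoids W f u` says that it is generated by `3`-cycles in `W` that avoid this
point, if `k • u` and `l • k • u` are distinct points of `W` outside a certain finite set.

The property passes to products, because the `3`-cycles in the middle cancel. If `f` is trivial near
`u`, then `τ_f = τ`, and the property says that `f` itself is generated by `3`-cycles in `W` that
avoid `u`. -/
def Avoids (W : Set X) (f : Γ) (u : X) : Prop :=
  ∃ E : Set X, E.Finite ∧ ∀ k l : Γ, k • u ∈ W → (l * k) • u ∈ W → k • u ∉ E → (l * k) • u ∉ E →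
    k • u ≠ (l * k) • u → ∃ V ∈ 𝓝 u, ∀ U ⊆ V, IsClopen U → u ∈ U →
      IsFrame ![f, k, l * k] U ∧ IsFrame ![1, k, l * k] U ∧
        tri f k (l * k) U * f * (tri 1 k (l * k) U)⁻¹ ∈ altOn Γ (W \ {k • u})

theorem Avoids.mul {W : Set X} {f g : Γ} {u : X} (hg : Avoids W g u) (hf : Avoids W f (g • u)) :
    Avoids W (f * g) u := by
  obtain ⟨E, hE, h⟩ := hg
  obtain ⟨E', hE', h'⟩ := hf
  refine ⟨E ∪ E', hE.union hE', fun k l hk hl hkE hlE hne => ?_⟩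
  rw [mem_union, not_or] at hkE hlE
  obtain ⟨V, hV, H⟩ := h k l hk hl hkE.1 hlE.1 hne
  have e1 : (k * g⁻¹) • g • u = k • u := by rw [mul_smul, inv_smul_smul]
  have e2 : (l * (k * g⁻¹)) • g • u = (l * k) • u := by
    rw [mul_smul, e1, mul_smul]
  obtain ⟨V', hV', H'⟩ := h' (k * g⁻¹) l (by rwa [e1]) (by rwa [e2]) (by rw [e1]; exact hkE.2)
    (by rw [e2]; exact hlE.2) (by rwa [e1, e2])
  refine ⟨V ∩ (g • ·) ⁻¹' V', Filter.inter_mem hV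
    ((continuous_const_smul g).continuousAt.preimage_mem_nhds hV'), fun U hU hc hu => ?_⟩
  obtain ⟨F1, F2, m⟩ := H U (fun x hx => (hU hx).1) hc hu
  have hc' : IsClopen (g • U) := by
    have := hc.preimage (continuous_const_smul g⁻¹)
    rwa [preimage_smul_inv] at this
  obtain ⟨F1', F2', m'⟩ := H' (g • U) (by
    rintro _ ⟨x, hx, rfl⟩
    exact (hU hx).2) hc' (smul_mem_smul_set hu)
  have F1u := F1'.tri_mul_right
  rw [e1, ← tri_smul_set F1', ← tri_smul_set F2'] at m'
  simp only [mul_assoc, inv_mul_cancel, mul_one, one_mul] at m' F1u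
  refine ⟨F1u, F2, ?_⟩
  convert mul_mem m' m using 1
  simp only [mul_assoc, inv_mul_cancel_left]

theorem Avoids.inv {W : Set X} {f : Γ} {u : X} (hf : Avoids W f (f⁻¹ • u)) : Avoids W f⁻¹ u := by
  obtain ⟨E, hE, h⟩ := hf
  refine ⟨E, hE, fun k l hk hl hkE hlE hne => ?_⟩
  have e1 : (k * f) • f⁻¹ • u = k • u := by rw [mul_smul, smul_inv_smul]
  have e2 : (l * (k * f)) • f⁻¹ • u = (l * k) • u := by rw [mul_smul, e1, mul_smul]
  obtain ⟨V, hV, H⟩ := h (k * f) l (by rwa [e1]) (by rwa [e2]) (by rwa [e1]) (by rwa [e2])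
    (by rwa [e1, e2])
  refine ⟨(f⁻¹ • ·) ⁻¹' V, (continuous_const_smul f⁻¹).continuousAt.preimage_mem_nhds hV,
    fun U hU hc hu => ?_⟩
  have hc' : IsClopen (f⁻¹ • U) := by
    have := hc.preimage (continuous_const_smul f)
    rwa [preimage_smul] at this
  obtain ⟨F1, F2, m⟩ := H (f⁻¹ • U) (by
    rintro _ ⟨x, hx, rfl⟩
    exact hU hx) hc' (smul_mem_smul_set hu)
  have F1u := F1.tri_mul_right
  have F2u := F2.tri_mul_right
  rw [e1, ← tri_smul_set F1, ← tri_smul_set F2] at m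
  simp only [mul_assoc, mul_inv_cancel, mul_one, one_mul] at m F1u F2u
  refine ⟨F2u, F1u, ?_⟩
  convert inv_mem m using 1
  simp only [mul_inv_rev, inv_inv, mul_assoc]

variable [T2Space X]

theorem avoids_of_mem_altOn_diff {W : Set X} (hW : IsOpen W) {f : Γ} {u : X} (hu : u ∈ W)
    (hf : f ∈ altOn Γ (W \ {u})) : Avoids W f u := by
  refine ⟨{u}, finite_singleton u, fun k l hk hl hkE hlE hne => ?_⟩
  rw [mem_singleton_iff] at hkE hlE
  obtain ⟨V, hV, H⟩ := exists_frame_nhds_subset ![1, k, l * k] u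
    (injective_triple (by rw [one_smul]; exact Ne.symm hkE) hne
      (by rw [one_smul]; exact Ne.symm hlE)) hW (fun i => by
      fin_cases i
      · simpa using hu
      · exact hk
      · exact hl)
  refine ⟨V ∩ {y | f • y = y}, Filter.inter_mem hV (eventually_smul_eq hf (by simp)),
    fun U hU hc huU => ?_⟩
  obtain ⟨F, FW⟩ := H U (fun x hx => (hU hx).1) hc
  have hfU : ∀ x ∈ U, (1 : Γ) • x = f • x := fun x hx => by rw [(hU hx).2, one_smul]
  have e := tri_congr F hfU (fun _ _ => rfl) (fun _ _ => rfl)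
  have hT : tri 1 k (l * k) U ∈ altOn Γ W :=
    tri_mem_altOn F fun x hx => ⟨FW 0 x hx, FW 1 x hx, FW 2 x hx⟩
  refine ⟨F.congr fun i x hx => ?_, F, ?_⟩
  · fin_cases i
    · exact hfU x hx
    · rfl
    · rfl
  · rw [← e]
    convert conj_mem_altOn hf (tri 1 k (l * k) U) using 2
    have h1 := tri_smul_fst F huU
    rw [one_smul] at h1
    rw [smul_set_sdiff, smul_set_eq hT, smul_set_singleton, h1]

/-- The case of a `3`-cycle with base point in its support: up to an element that avoids the base
point it is a small `3`-cycle, and `(1 3 4) (0 1 2) (0 3 4)⁻¹ = (0 1 2)` avoids `3`. -/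
theorem avoids_tri {W : Set X} (hW : IsOpen W) {b c : Γ} {U₀ : Set X}
    (hF : IsFrame ![1, b, c] U₀) (hU₀ : ∀ x ∈ U₀, x ∈ W ∧ b • x ∈ W ∧ c • x ∈ W) {u : X}
    (hu : u ∈ U₀) : Avoids W (tri 1 b c U₀) u := by
  refine ⟨{u, b • u, c • u}, by simp, fun k l hk hl hkE hlE hne => ?_⟩
  simp only [mem_insert_iff, mem_singleton_iff, not_or] at hkE hlE
  have hne0 : ∀ i j : Fin 3, i ≠ j → (![1, b, c] i) • u ≠ (![1, b, c] j) • u :=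
    fun i j hij e => hij (hF.index_eq i j u hu u hu e)
  have n01 : u ≠ b • u := by simpa using hne0 0 1 (by decide)
  have n02 : u ≠ c • u := by simpa using hne0 0 2 (by decide)
  have n12 : b • u ≠ c • u := by simpa using hne0 1 2 (by decide)
  let g : Fin 5 → Γ := ![1, b, c, k, l * k]
  have hg : Function.Injective fun i => g i • u := by
    have h : List.Nodup [u, b • u, c • u, k • u, (l * k) • u] := by
      simp only [List.nodup_cons, List.mem_cons, List.not_mem_nil, or_false, not_or,
        not_false_eq_true, List.nodup_nil, and_true]
      exact ⟨⟨n01, n02, Ne.symm hkE.1, Ne.symm hlE.1⟩, ⟨n12, Ne.symm hkE.2.1, Ne.symm hlE.2.1⟩,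
        ⟨Ne.symm hkE.2.2, Ne.symm hlE.2.2⟩, hne⟩
    have h2 := List.nodup_iff_injective_get.1 h
    have h3 : (fun i => g i • u) = [u, b • u, c • u, k • u, (l * k) • u].get := by
      ext i
      fin_cases i
      · exact one_smul Γ u
      all_goals rfl
    rw [h3]
    exact h2
  have hgW : ∀ i, g i • u ∈ W := by
    intro i
    fin_cases i
    · simpa [g] using (hU₀ u hu).1
    · exact (hU₀ u hu).2.1
    · exact (hU₀ u hu).2.2
    · exact hk
    · exact hl
  obtain ⟨V, hV, H⟩ := exists_frame_nhds_subset g u hg hW hgW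
  refine ⟨V ∩ U₀, Filter.inter_mem hV (hF.isClopen.isOpen.mem_nhds hu), fun U hU hc huU => ?_⟩
  obtain ⟨F, FW⟩ := H U (fun x hx => (hU hx).1) hc
  have hUU : U ⊆ U₀ := fun x hx => (hU hx).2
  have sub : ∀ i j l : Fin 5, i ≠ j → j ≠ l → i ≠ l → IsFrame ![g i, g j, g l] U := by
    intro i j l h1 h2 h3
    convert F.comp (e := ![i, j, l]) ?_ using 1
    · ext x; fin_cases x <;> rfl
    · intro x y e
      fin_cases x <;> fin_cases y <;> first | rfl | (exfalso; first
        | exact h1 e | exact h2 e | exact h3 e | exact h1 e.symm | exact h2 e.symm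
        | exact h3 e.symm)
  have F034 : IsFrame ![1, k, l * k] U := sub 0 3 4 (by decide) (by decide) (by decide)
  have F134 : IsFrame ![b, k, l * k] U := sub 1 3 4 (by decide) (by decide) (by decide)
  have F012 : IsFrame ![1, b, c] U := sub 0 1 2 (by decide) (by decide) (by decide)
  have e034 : tri 1 k (l * k) U = shuffle g U (cyc 0 3 4) :=
    tri_eq_shuffle F (i := 0) (j := 3) (k := 4) (by decide) (by decide) (by decide)
  have e134 : tri b k (l * k) U = shuffle g U (cyc 1 3 4) :=
    tri_eq_shuffle F (i := 1) (j := 3) (k := 4) (by decide) (by decide) (by decide)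
  have e012 : tri 1 b c U = shuffle g U (cyc 0 1 2) :=
    tri_eq_shuffle F (i := 0) (j := 1) (k := 2) (by decide) (by decide) (by decide)
  have hfU : ∀ x ∈ U, b • x = tri 1 b c U₀ • x := by
    intro x hx
    have := tri_smul_fst hF (hUU hx)
    rw [one_smul] at this
    exact this.symm
  have ef : tri b k (l * k) U = tri (tri 1 b c U₀) k (l * k) U :=
    tri_congr F134 hfU (fun _ _ => rfl) (fun _ _ => rfl)
  have hT : tri 1 k (l * k) U ∈ altOn Γ W :=
    tri_mem_altOn F034 fun x hx => ⟨FW 0 x hx, FW 3 x hx, FW 4 x hx⟩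
  have hsplit : tri 1 b c U₀ = tri 1 b c U * tri 1 b c (U₀ \ U) := by
    have e : U ∪ (U₀ \ U) = U₀ := union_sdiff_cancel hUU
    have := shuffle_union (g := ![1, b, c]) (e.symm ▸ hF) hc (hF.isClopen.diff hc)
      disjoint_sdiff_right (finRotate 3)
    rwa [e] at this
  refine ⟨F134.congr fun i x hx => ?_, F034, ?_⟩
  · fin_cases i
    · exact hfU x hx
    · rfl
    · rfl
  have hm : tri 1 b c (U₀ \ U) ∈ altOn Γ (W \ {u}) := by
    have hav : ∀ i, ∀ x ∈ U₀ \ U, (![1, b, c] : Fin 3 → Γ) i • x ≠ u := by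
      intro i x hx e
      have h0 : (![1, b, c] : Fin 3 → Γ) i • x = (![1, b, c] : Fin 3 → Γ) 0 • u := by
        simpa using e
      obtain rfl := hF.index_eq i 0 x hx.1 u hu h0
      have hxu : x = u := by simpa using e
      exact hx.2 (hxu ▸ huU)
    refine tri_mem_altOn (hF.mono (hF.isClopen.diff hc) sdiff_subset) fun x hx =>
      ⟨⟨?_, hav 0 x hx⟩, ⟨(hU₀ x hx.1).2.1, hav 1 x hx⟩, ⟨(hU₀ x hx.1).2.2, hav 2 x hx⟩⟩
    rw [one_smul]
    exact (hU₀ x hx.1).1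
  have h1 : tri 1 b c U ∈ altOn Γ (W \ {k • u}) := by
    have hav : ∀ i : Fin 5, i ≠ 3 → ∀ x ∈ U, g i • x ≠ k • u := fun i hi x hx e =>
      hi (F.index_eq i 3 x hx u huU e)
    exact tri_mem_altOn F012 fun x hx => ⟨⟨FW 0 x hx, hav 0 (by decide) x hx⟩,
      ⟨FW 1 x hx, hav 1 (by decide) x hx⟩, ⟨FW 2 x hx, hav 2 (by decide) x hx⟩⟩
  have h2 := conj_mem_altOn hm (tri 1 k (l * k) U)
  have h3 := tri_smul_fst F034 huU
  rw [one_smul] at h3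
  rw [smul_set_sdiff, smul_set_eq hT, smul_set_singleton, h3] at h2
  have h4 : tri b k (l * k) U * tri 1 b c U * (tri 1 k (l * k) U)⁻¹ = tri 1 b c U := by
    rw [e034, e134, e012, ← shuffle_inv F, ← shuffle_mul F, ← shuffle_mul F]
    congr 1
    decide
  have h5 : tri (tri 1 b c U₀) k (l * k) U * tri 1 b c U₀ * (tri 1 k (l * k) U)⁻¹ =
      (tri b k (l * k) U * tri 1 b c U * (tri 1 k (l * k) U)⁻¹) *
        (tri 1 k (l * k) U * tri 1 b c (U₀ \ U) * (tri 1 k (l * k) U)⁻¹) := by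
    rw [← ef, hsplit]
    group
  rw [h5, h4]
  exact mul_mem h1 h2

theorem avoids_of_mem_altOn {W : Set X} (hW : IsOpen W) {f : Γ} (hf : f ∈ altOn Γ W) :
    ∀ u ∈ W, Avoids W f u := by
  induction hf using Subgroup.closure_induction with
  | mem f hf =>
    obtain ⟨a, b, c, U, hF, hUW, rfl⟩ := hf
    intro u hu
    have key : ∀ a b c : Γ, IsFrame ![a, b, c] U → (∀ x ∈ U, a • x ∈ W ∧ b • x ∈ W ∧ c • x ∈ W) →
        a⁻¹ • u ∈ U → Avoids W (tri a b c U) u := by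
      intro a b c hF hUW h
      have e : a⁻¹ • a • U = U := inv_smul_smul a U
      have hF1 : IsFrame ![a, b, c] (a⁻¹ • a • U) := by rwa [e]
      have hF2 := hF1.tri_mul_right
      have h1 := tri_smul_set hF1
      rw [e] at h1
      rw [← h1]
      rw [mul_inv_cancel] at hF2 ⊢
      refine avoids_tri hW hF2 ?_ (mem_smul_set_iff_inv_smul_mem.2 h)
      rintro _ ⟨x, hx, rfl⟩
      simpa [mul_smul] using hUW x hx
    by_cases ha : a⁻¹ • u ∈ U
    · exact key a b c hF hUW ha
    have hr := tri_rotate a b c hF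
    by_cases hb : b⁻¹ • u ∈ U
    · rw [← hr.1]
      exact key b c a hr.2 (fun x hx => ⟨(hUW x hx).2.1, (hUW x hx).2.2, (hUW x hx).1⟩) hb
    have hr' := tri_rotate b c a hr.2
    by_cases hc : c⁻¹ • u ∈ U
    · rw [← hr.1, ← hr'.1]
      exact key c a b hr'.2 (fun x hx => ⟨(hUW x hx).2.2, (hUW x hx).1, (hUW x hx).2.1⟩) hc
    refine avoids_of_mem_altOn_diff hW hu (tri_mem_altOn hF fun x hx =>
      ⟨⟨(hUW x hx).1, ?_⟩, ⟨(hUW x hx).2.1, ?_⟩, ⟨(hUW x hx).2.2, ?_⟩⟩) <;>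
    · rintro rfl
      simp_all
  | one => exact fun u hu => avoids_of_mem_altOn_diff hW hu (one_mem _)
  | mul f g _ hg ihf ihg =>
    exact fun u hu => (ihg u hu).mul (ihf _ (smul_mem_of_mem hg hu))
  | inv f hf ih => exact fun u hu => (ih _ (smul_mem_of_mem (inv_mem hf) hu)).inv

variable [PerfectSpace X] [CompactSpace X] [TotallyDisconnectedSpace X]

/-- An element of `altOn Γ W` that is trivial near a point is generated by `3`-cycles that avoid
the point. -/
theorem mem_altOn_diff_singleton (hd : DenseOrbits Γ X) {W : Set X} (hW : IsOpen W) {f : Γ}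
    (hf : f ∈ altOn Γ W) {q : X} (hq : q ∈ W) (hfq : ∀ᶠ y in 𝓝 q, f • y = y) :
    f ∈ altOn Γ (W \ {q}) := by
  obtain ⟨E, hE, h⟩ := avoids_of_mem_altOn hW hf q hq
  obtain ⟨k, hkW, hkE⟩ := hd.exists_fresh q hW ⟨q, hq⟩ hE
  obtain ⟨m, hmW, hmE⟩ := hd.exists_fresh q hW ⟨q, hq⟩ (hE.insert (k • q))
  rw [mem_insert_iff, not_or] at hmE
  have e : m * k⁻¹ * k = m := by group
  obtain ⟨V, hV, H⟩ := h k (m * k⁻¹) hkW (by rwa [e]) hkE (by rw [e]; exact hmE.2)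
    (by rw [e]; exact Ne.symm hmE.1)
  rw [e] at H
  obtain ⟨T, hT, hqT, hTV⟩ := exists_clopen hV
  have hF := (H T hTV hT hqT).2.1
  have hinj : Function.Injective fun i => (![1, k, m] : Fin 3 → Γ) i • q :=
    fun i j e' => hF.index_eq i j q hqT q hqT e'
  obtain ⟨V', hV', H'⟩ := exists_frame_nhds_subset ![1, k, m] q hinj hW (fun i => by
    fin_cases i
    · simpa using hq
    · exact hkW
    · exact hmW)
  obtain ⟨U, hU, hqU, hUV⟩ := exists_clopen (Filter.inter_mem hV (Filter.inter_mem hV' hfq))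
  obtain ⟨F1, F2, hm⟩ := H U (fun x hx => (hUV hx).1) hU hqU
  have hT : tri 1 k m U ∈ altOn Γ W := by
    have h1 := (H' U (fun x hx => (hUV hx).2.1) hU).2
    exact tri_mem_altOn F2 fun x hx => ⟨h1 0 x hx, h1 1 x hx, h1 2 x hx⟩
  have e2 : tri f k m U = tri 1 k m U := tri_congr F1
    (fun x hx => by rw [one_smul]; exact (hUV hx).2.2) (fun _ _ => rfl) (fun _ _ => rfl)
  rw [e2] at hm
  refine conj_mem_altOn' (h := tri 1 k m U) ?_
  have h3 := tri_smul_fst F2 hqU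
  rw [one_smul] at h3
  rwa [smul_set_sdiff, smul_set_eq hT, smul_set_singleton, h3]

/-- An element of the alternating group that is trivial near every point of a finite set is
generated by `3`-cycles that avoid this set. -/
theorem mem_altOn_compl (hd : DenseOrbits Γ X) {f : Γ} (hf : f ∈ altOn Γ (univ : Set X))
    {Q : Set X} (hQ : Q.Finite) (hfQ : ∀ q ∈ Q, ∀ᶠ y in 𝓝 q, f • y = y) : f ∈ altOn Γ Qᶜ := by
  induction Q, hQ using Set.Finite.induction_on with
  | empty => simpa using hf
  | @insert q Q hq hQ ih =>
    have h := mem_altOn_diff_singleton hd hQ.isClosed.isOpen_compl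
      (ih fun x hx => hfQ x (mem_insert_of_mem _ hx)) hq (hfQ q (mem_insert _ _))
    convert h using 2
    ext x
    simp [not_or, and_comm]

end Germ

end FullAction

/-! ### Confined subgroups and a coloring argument -/

namespace FullAction

open Equiv Pointwise

/-- Colour the functions from an `n`-element set `ι` to `n + 1` values by the elements of `ι`. Some
two functions that differ at exactly one place have this place as their common colour. -/
theorem exists_pair_of_coloring {ι : Type*} [Fintype ι] [DecidableEq ι]
    (c : (ι → Fin (Fintype.card ι + 1)) → ι) :
    ∃ f f' : ι → Fin (Fintype.card ι + 1), ∃ i, c f = i ∧ c f' = i ∧ f i ≠ f' i ∧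
      ∀ j, j ≠ i → f j = f' j := by
  by_contra! hc
  -- A function is determined by its colour and its values at the other places, but there are
  -- `(n + 1) ^ n` functions and only `n * (n + 1) ^ (n - 1)` such data.
  have hinj : Function.Injective fun f : ι → Fin (Fintype.card ι + 1) =>
      (⟨c f, fun q => f q.1⟩ : Σ i, ({q // q ≠ i} → Fin (Fintype.card ι + 1))) := by
    intro f f' h
    rw [Sigma.mk.injEq] at h
    obtain ⟨h1, h2⟩ := h
    have h3 : ∀ q, q ≠ c f → f q = f' q := by
      generalize c f = i at h1 h2
      subst h1
      exact fun q hq => congrFun (eq_of_heq h2) ⟨q, hq⟩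
    by_contra hne
    refine absurd ?_ (show ¬ ∃ j, j ≠ c f ∧ f j ≠ f' j from fun ⟨j, hj, h⟩ => h (h3 j hj))
    refine hc f f' (c f) rfl h1.symm ?_
    intro h4
    refine hne (funext fun q => ?_)
    by_cases hq : q = c f
    · rw [hq, h4]
    · exact h3 q hq
  have hcard := Fintype.card_le_of_injective _ hinj
  rw [Fintype.card_sigma] at hcard
  simp only [Fintype.card_fun, Fintype.card_fin, Fintype.card_subtype_compl,
    Fintype.card_unique, Finset.sum_const, Finset.card_univ, smul_eq_mul] at hcard
  have hpos : 0 < Fintype.card ι := Fintype.card_pos_iff.2 ⟨c fun _ => 0⟩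
  obtain ⟨n, hn⟩ : ∃ n, Fintype.card ι = n + 1 := ⟨_, (Nat.succ_pred_eq_of_pos hpos).symm⟩
  rw [hn, Nat.add_sub_cancel, pow_succ] at hcard
  have := Nat.pos_of_ne_zero (pow_ne_zero n (show n + 1 + 1 ≠ 0 by omega))
  nlinarith

/-- Distinct representatives of finitely many infinite sets, outside a given finite set. -/
theorem exists_injective_choice {X : Type*} {κ : Type*} [Fintype κ] (T : κ → Set X)
    (hT : ∀ i, (T i).Infinite) {F : Set X} (hF : F.Finite) :
    ∃ v : κ → X, Function.Injective v ∧ ∀ i, v i ∈ T i ∧ v i ∉ F := by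
  classical
  suffices h : ∀ s : Finset κ, ∃ v : κ → X, (∀ i ∈ s, ∀ j ∈ s, v i = v j → i = j) ∧
      ∀ i ∈ s, v i ∈ T i ∧ v i ∉ F by
    obtain ⟨v, h1, h2⟩ := h Finset.univ
    exact ⟨v, fun i j e => h1 i (Finset.mem_univ _) j (Finset.mem_univ _) e,
      fun i => h2 i (Finset.mem_univ _)⟩
  intro s
  induction s using Finset.induction_on with
  | empty =>
    refine isEmpty_or_nonempty κ |>.elim (fun _ => ⟨isEmptyElim, by simp⟩) fun ⟨i⟩ => ?_
    obtain ⟨x, -⟩ := (hT i).nonempty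
    exact ⟨fun _ => x, by simp⟩
  | insert m s hm ih =>
    obtain ⟨v, h1, h2⟩ := ih
    obtain ⟨x, hxT, hxF⟩ := (hT m).exists_notMem_finite (hF.union (s.finite_toSet.image v))
    rw [mem_union, not_or] at hxF
    have hne : ∀ i ∈ s, v i ≠ x := fun i hi e => hxF.2 ⟨i, hi, e⟩
    have hsm : ∀ i ∈ s, i ≠ m := fun i hi e => hm (e ▸ hi)
    refine ⟨Function.update v m x, ?_, ?_⟩
    · intro i hi j hj e
      rcases Finset.mem_insert.1 hi with rfl | his <;> rcases Finset.mem_insert.1 hj with rfl | hjs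
      · rfl
      · rw [Function.update_self, Function.update_of_ne (hsm j hjs)] at e
        exact absurd e.symm (hne j hjs)
      · rw [Function.update_self, Function.update_of_ne (hsm i his)] at e
        exact absurd e (hne i his)
      · rw [Function.update_of_ne (hsm i his), Function.update_of_ne (hsm j hjs)] at e
        exact h1 i his j hjs e
    · intro i hi
      rcases Finset.mem_insert.1 hi with rfl | hi
      · rw [Function.update_self]; exact ⟨hxT, hxF.1⟩
      · rw [Function.update_of_ne (hsm i hi)]; exact h2 i hi

section Confined

variable {Γ : Type*} {X : Type*} [Group Γ] [TopologicalSpace X] [MulAction Γ X]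
  [IsFullAction Γ X]

/-- For disjoint `U` and `V`: the projection to `altOn Γ U` of the intersection of `N` with
`altOn Γ U * altOn Γ V`. -/
def linked (N : Subgroup Γ) {U V : Set X} (h : Disjoint U V) : Subgroup Γ where
  carrier := {a | a ∈ altOn Γ U ∧ ∃ b ∈ altOn Γ V, a * b ∈ N}
  one_mem' := ⟨one_mem _, 1, one_mem _, by simp⟩
  mul_mem' := by
    rintro a a' ⟨ha, b, hb, hN⟩ ⟨ha', b', hb', hN'⟩
    refine ⟨mul_mem ha ha', b * b', mul_mem hb hb', ?_⟩
    have := commute_of_disjoint h ha' hb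
    have e : a * a' * (b * b') = a * b * (a' * b') := by
      rw [mul_assoc, ← mul_assoc a', this.eq]; group
    rw [e]
    exact mul_mem hN hN'
  inv_mem' := by
    rintro a ⟨ha, b, hb, hN⟩
    refine ⟨inv_mem ha, b⁻¹, inv_mem hb, ?_⟩
    rw [← mul_inv_rev, ← (commute_of_disjoint h ha hb).eq]
    exact inv_mem hN

/-- The subgroup `N` is confined by the finite family `p`: every conjugate of `N` by an element of
the alternating group contains a member of the family. -/
def ConfinedBy {ι : Type*} (X : Type*) [TopologicalSpace X] [MulAction Γ X] (N : Subgroup Γ)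
    (p : ι → Γ) : Prop :=
  ∀ a ∈ altOn Γ (univ : Set X), ∃ i, a⁻¹ * p i * a ∈ N

theorem ConfinedBy.conj {ι : Type*} {N : Subgroup Γ} {p : ι → Γ} (h : ConfinedBy X N p) {a : Γ}
    (ha : a ∈ altOn Γ (univ : Set X)) :
    ConfinedBy X (N.comap (MulAut.conj a).toMonoidHom) p := by
  intro b hb
  obtain ⟨i, hi⟩ := h (b * a⁻¹) (mul_mem hb (inv_mem ha))
  refine ⟨i, ?_⟩
  rw [Subgroup.mem_comap]
  convert hi using 1
  simp [mul_assoc]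

variable [T2Space X] [PerfectSpace X] [CompactSpace X] [TotallyDisconnectedSpace X]

/-- For open sets `U i` that are disjoint from each other and from the sets `p j • U j`, a subgroup
confined by `p` projects, for some `i`, onto `altOn Γ (U i)`. Otherwise choose `n + 1` elements in
distinct cosets of the projection for each of the `n` indices, and colour the products of one
element for each index by a member of the family whose conjugate by the product is in `N`. -/
theorem ConfinedBy.exists_linked (hd : DenseOrbits Γ X) {ι : Type*} [Fintype ι] {N : Subgroup Γ}
    {p : ι → Γ} (h : ConfinedBy X N p) {U : ι → Set X} (hU : ∀ i, IsOpen (U i))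
    (hUU : ∀ i j, i ≠ j → Disjoint (U i) (U j)) (hpU : ∀ i j, Disjoint (U j) (p i • U i)) :
    ∃ i, ∀ a ∈ altOn Γ (U i), ∃ b ∈ altOn Γ (p i • U i), a * b ∈ N := by
  classical
  by_contra! hcon
  have hK : ∀ i, (linked N (hpU i i)).relIndex (altOn Γ (U i)) = 0 := by
    intro i
    by_contra hi
    obtain ⟨a, ha, hab⟩ := hcon i
    obtain ⟨-, b, hb, hN⟩ := altOn_le_of_relIndex_ne_zero hd (hU i) hi ha
    exact hab b hb hN
  have hc : ∀ i, ∃ c : Fin (Fintype.card ι + 1) → altOn Γ (U i), ∀ s t,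
      ((c s : Γ)⁻¹ * c t ∈ linked N (hpU i i)) → s = t := by
    intro i
    have hinf : Infinite (altOn Γ (U i) ⧸ (linked N (hpU i i)).subgroupOf (altOn Γ (U i))) :=
      Subgroup.index_eq_zero_iff_infinite.1 (hK i)
    refine ⟨fun s => (Infinite.natEmbedding _ s :
      altOn Γ (U i) ⧸ (linked N (hpU i i)).subgroupOf (altOn Γ (U i))).out, fun s t hst => ?_⟩
    have h1 := QuotientGroup.eq.2 (show (_ : altOn Γ (U i))⁻¹ * _ ∈
      (linked N (hpU i i)).subgroupOf (altOn Γ (U i)) from hst)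
    rw [QuotientGroup.out_eq', QuotientGroup.out_eq'] at h1
    exact Fin.ext ((Infinite.natEmbedding _).injective h1)
  choose c hc using hc
  have hcomm : Pairwise fun i j : ι => ∀ x y : Γ, x ∈ altOn Γ (U i) → y ∈ altOn Γ (U j) →
      Commute x y := fun i j hij x y hx hy => commute_of_disjoint (hUU i j hij) hx hy
  let Φ := Subgroup.noncommPiCoprod hcomm
  have hΦ : ∀ v, Φ v ∈ altOn Γ (⋃ i, U i) := by
    intro v
    have : Φ v ∈ Φ.range := ⟨v, rfl⟩
    rw [Subgroup.noncommPiCoprod_range] at this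
    exact iSup_le (fun i => altOn_mono (subset_iUnion U i)) this
  let γ : (ι → Fin (Fintype.card ι + 1)) → Γ := fun f => Φ fun i => c i (f i)
  choose col hcol using fun f => h (γ f) (altOn_mono (subset_univ _) (hΦ _))
  obtain ⟨f, f', i, rfl, hf', hne, heq⟩ := exists_pair_of_coloring col
  have h1 := hcol f
  have h2 := hcol f'
  rw [hf'] at h2
  generalize col f = i at *
  have e1 : (γ f)⁻¹ * γ f' = (c i (f i) : Γ)⁻¹ * c i (f' i) := by
    have : (fun j => c j (f j))⁻¹ * (fun j => c j (f' j)) =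
        Pi.mulSingle i ((c i (f i))⁻¹ * c i (f' i)) := by
      funext j
      by_cases hj : j = i
      · subst hj; simp
      · simp [Pi.mulSingle_eq_of_ne hj, heq j hj]
    change (Φ _)⁻¹ * Φ _ = _
    rw [← map_inv, ← map_mul, this, Subgroup.noncommPiCoprod_mulSingle]
    rfl
  have e2 : γ f * (γ f')⁻¹ = (c i (f i) : Γ) * (c i (f' i) : Γ)⁻¹ := by
    have : (fun j => c j (f j)) * (fun j => c j (f' j))⁻¹ =
        Pi.mulSingle i (c i (f i) * (c i (f' i))⁻¹) := by
      funext j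
      by_cases hj : j = i
      · subst hj; simp
      · simp [Pi.mulSingle_eq_of_ne hj, heq j hj]
    change Φ _ * (Φ _)⁻¹ = _
    rw [← map_inv, ← map_mul, this, Subgroup.noncommPiCoprod_mulSingle]
    rfl
  have hb : p i * (γ f * (γ f')⁻¹) * (p i)⁻¹ ∈ altOn Γ (p i • U i) := by
    rw [e2]
    exact conj_mem_altOn (mul_mem (c i (f i)).2 (inv_mem (c i (f' i)).2)) (p i)
  have hdis : Disjoint (⋃ j, U j) (p i • U i) := disjoint_iUnion_left.2 fun j => hpU i j
  have hcf := (commute_of_disjoint hdis (hΦ _) hb : Commute (γ f) _)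
  have hcf' := (commute_of_disjoint hdis (hΦ _) hb : Commute (γ f') _)
  refine hne (hc i _ _ ⟨mul_mem (inv_mem (c i (f i)).2) (c i (f' i)).2, _, hb, ?_⟩)
  convert mul_mem h1 (inv_mem h2) using 1
  have h3 := hcf.inv_left.eq
  have h4 := hcf'.eq
  rw [← e1]
  calc (γ f)⁻¹ * γ f' * (p i * (γ f * (γ f')⁻¹) * (p i)⁻¹)
      = (γ f)⁻¹ * (p i * (γ f * (γ f')⁻¹) * (p i)⁻¹) * γ f' := by rw [mul_assoc, h4, ← mul_assoc]
    _ = (γ f)⁻¹ * p i * γ f * ((γ f')⁻¹ * p i * γ f')⁻¹ := by group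

end Confined

end FullAction

/-! ### Confined subgroups contain the alternating group of a cofinite set -/

namespace FullAction

open Equiv Pointwise

section Moving

variable {Γ : Type*} {X : Type*} [Group Γ] [TopologicalSpace X] [MulAction Γ X]
  [IsFullAction Γ X] [T2Space X] [PerfectSpace X]

/-- For finitely many non-trivial elements there are points, in prescribed dense sets, that are
moved by these elements and such that these points and their images are all distinct. -/
theorem exists_moved {ι : Type*} [Fintype ι] (p : ι → Γ) (hp : ∀ i, p i ≠ 1) (D : ι → Set X)
    (hD : ∀ i, Dense (D i)) : ∃ u : ι → X, (∀ i, u i ∈ D i) ∧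
      Function.Injective fun q : ι × Bool => if q.2 then p q.1 • u q.1 else u q.1 := by
  classical
  have hmoved : ∀ i, ∃ x : X, x ≠ p i • x := by
    intro i
    by_contra! h
    exact hp i (ext_smul (X := X) fun x => by rw [one_smul, ← h x])
  suffices h : ∀ s : Finset ι, ∃ u : ι → X, (∀ i ∈ s, u i ∈ D i ∧ p i • u i ≠ u i) ∧
      ∀ i ∈ s, ∀ j ∈ s, i ≠ j → u i ≠ u j ∧ p i • u i ≠ p j • u j ∧ u i ≠ p j • u j by
    obtain ⟨u, h1, h2⟩ := h Finset.univ
    refine ⟨u, fun i => (h1 i (Finset.mem_univ i)).1, ?_⟩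
    rintro ⟨i, b⟩ ⟨j, b'⟩ e
    by_cases hij : i = j
    · subst hij
      have h3 := (h1 i (Finset.mem_univ i)).2
      have h4 := Ne.symm h3
      cases b <;> cases b' <;> simp_all
    · have h3 := h2 i (Finset.mem_univ i) j (Finset.mem_univ j) hij
      have h4 := h2 j (Finset.mem_univ j) i (Finset.mem_univ i) (Ne.symm hij)
      cases b <;> cases b' <;> simp_all
  intro s
  induction s using Finset.induction_on with
  | empty => exact ⟨fun i => (hmoved i).choose, by simp⟩
  | insert m s hm ih =>
    obtain ⟨u, h1, h2⟩ := ih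
    have hF : (⋃ i ∈ s, {u i, p i • u i}).Finite := s.finite_toSet.biUnion fun i _ => by simp
    obtain ⟨x, ⟨hxD, hxF⟩, hx⟩ := ((hD m).sdiff_finite
      (hF.union (hF.image ((p m)⁻¹ • ·)))).exists_mem_open (U := {x | x ≠ p m • x})
        (isOpen_ne_fun continuous_id (continuous_const_smul (p m))) (hmoved m)
    rw [mem_union, not_or] at hxF
    have hx1 : ∀ i ∈ s, u i ≠ x ∧ p i • u i ≠ x := fun i hi => by
      constructor <;> rintro rfl <;> exact hxF.1 (mem_iUnion₂.2 ⟨i, hi, by simp⟩)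
    have hx2 : ∀ i ∈ s, u i ≠ p m • x ∧ p i • u i ≠ p m • x := fun i hi => by
      constructor <;> intro e <;>
      exact hxF.2 ⟨_, mem_iUnion₂.2 ⟨i, hi, by simp⟩, inv_smul_eq_iff.2 e⟩
    have hsm : ∀ i ∈ s, i ≠ m := fun i hi e => hm (e ▸ hi)
    have e0 : ∀ i ∈ s, Function.update u m x i = u i := fun i hi =>
      Function.update_of_ne (hsm i hi) _ _
    refine ⟨Function.update u m x, ?_, ?_⟩
    · intro i hi
      rcases Finset.mem_insert.1 hi with rfl | his
      · rw [Function.update_self]; exact ⟨hxD, Ne.symm hx⟩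
      · rw [e0 i his]; exact h1 i his
    · intro i hi j hj hij
      rcases Finset.mem_insert.1 hi with rfl | his <;> rcases Finset.mem_insert.1 hj with rfl | hjs
      · exact absurd rfl hij
      · rw [Function.update_self, e0 j hjs]
        exact ⟨(hx1 j hjs).1.symm, (hx2 j hjs).2.symm, (hx1 j hjs).2.symm⟩
      · rw [Function.update_self, e0 i his]
        exact ⟨(hx1 i his).1, (hx2 i his).2, (hx2 i his).1⟩
      · rw [e0 i his, e0 j hjs]
        exact h2 i his j hjs hij

variable [CompactSpace X] [TotallyDisconnectedSpace X]

/-- Some element of the alternating group takes finitely many distinct points to prescribed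
distinct points of their orbits, or to prescribed non-empty open sets. -/
theorem exists_altOn_moving (hd : DenseOrbits Γ X) {κ κ' : Type*} [Fintype κ] [Fintype κ']
    (x : κ ⊕ κ' → X) (hx : Function.Injective x) (k : κ → Γ)
    (hk : Function.Injective fun i => k i • x (Sum.inl i)) (O : κ' → Set X)
    (hO : ∀ i, IsOpen (O i)) (hne : ∀ i, (O i).Nonempty) :
    ∃ a ∈ altOn Γ (univ : Set X), (∀ i, a • x (Sum.inl i) = k i • x (Sum.inl i)) ∧
      ∀ i, a • x (Sum.inr i) ∈ O i := by
  classical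
  obtain ⟨v, hv, hvO⟩ := exists_injective_choice
    (fun i => MulAction.orbit Γ (x (Sum.inr i)) ∩ O i)
    (fun i => hd.infinite _ (hO i) (hne i)) (finite_range fun i => k i • x (Sum.inl i))
  have hl : ∀ i, ∃ l : Γ, l • x (Sum.inr i) = v i := fun i => (hvO i).1.1
  choose l hl using hl
  let f : X → Γ := Function.extend x (Sum.elim k l) 1
  have hf : ∀ i, f (x i) = Sum.elim k l i := fun i => hx.extend_apply _ _ i
  obtain ⟨a, ha, haf⟩ := exists_altOn_finset hd (range x) (finite_range x) f (by
    rintro _ ⟨i, rfl⟩ _ ⟨j, rfl⟩ e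
    dsimp only at e
    rw [hf, hf] at e
    rcases i with i | i <;> rcases j with j | j <;>
      simp only [Sum.elim_inl, Sum.elim_inr, hl] at e
    · rw [hk e]
    · exact absurd ⟨i, e⟩ (hvO j).2
    · exact absurd ⟨j, e.symm⟩ (hvO i).2
    · rw [hv e])
  refine ⟨a, ha, fun i => ?_, fun i => ?_⟩
  · rw [(haf _ ⟨_, rfl⟩).self_of_nhds, hf]
    rfl
  · rw [(haf _ ⟨_, rfl⟩).self_of_nhds, hf, Sum.elim_inr, hl]
    exact (hvO i).1.2

/-- A confined subgroup contains the alternating group of some non-empty open set: there are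
`U₁`, `V₁` such that every element of `altOn Γ U₁` is, up to an element of `altOn Γ V₁`, in the
subgroup, and then `U₂ ⊆ U₁` and `V₂`, disjoint from `U₁` and `V₁`, with the same property; the
commutators of elements of `altOn Γ U₂` are therefore in the subgroup. -/
theorem ConfinedBy.exists_altOn_le (hd : DenseOrbits Γ X) {ι : Type*} [Fintype ι] {N : Subgroup Γ}
    {p : ι → Γ} (hp : ∀ i, p i ≠ 1) (h : ConfinedBy X N p) :
    ∃ U : Set X, IsOpen U ∧ U.Nonempty ∧ altOn Γ U ≤ N := by
  classical
  obtain ⟨u, -, hu⟩ := exists_moved p hp (fun _ => (univ : Set X)) fun _ => dense_univ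
  let P : ι × Bool → X := fun q => if q.2 then p q.1 • u q.1 else u q.1
  have hne : Nonempty X := by
    obtain ⟨i, -⟩ := h 1 (one_mem _)
    exact ⟨u i⟩
  obtain ⟨o, -, ho⟩ : ∃ o : X, o ∈ (univ : Set X) ∧ o ∉ range P := by
    obtain ⟨h, h1, h2⟩ := hd.exists_fresh hne.some isOpen_univ univ_nonempty (finite_range P)
    exact ⟨_, h1, h2⟩
  obtain ⟨B, hB, hBd⟩ := ((finite_range P).insert o).t2_separation
  have hPd : ∀ q q', q ≠ q' → Disjoint (B (P q)) (B (P q')) := fun q q' hq =>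
    hBd (Or.inr ⟨q, rfl⟩) (Or.inr ⟨q', rfl⟩) fun e => hq (hu e)
  have hod : ∀ q, Disjoint (B o) (B (P q)) := fun q =>
    hBd (Or.inl rfl) (Or.inr ⟨q, rfl⟩) fun e => ho ⟨q, e.symm⟩
  have hP0 : ∀ i, P (i, false) = u i := fun i => rfl
  have hP1 : ∀ i, P (i, true) = p i • u i := fun i => rfl
  have general : ∀ (N : Subgroup Γ), ConfinedBy X N p → ∀ C : ι → Set X, (∀ i, IsOpen (C i)) →
      (∀ i, C i ⊆ B (u i)) → (∀ i, ∀ y ∈ C i, p i • y ∈ B (p i • u i)) →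
      ∃ i, ∀ a ∈ altOn Γ (C i), ∃ b ∈ altOn Γ (p i • C i), a * b ∈ N := by
    intro N hN C hC hCB hCp
    refine hN.exists_linked hd hC (fun i j hij => ?_) fun i j => ?_
    · exact (hPd (i, false) (j, false) (by simpa using hij)).mono (hCB i) (hCB j)
    · refine (hPd (j, false) (i, true) (by simp)).mono (hCB j) ?_
      rintro _ ⟨y, hy, rfl⟩
      exact hCp i y hy
  let C : ι → Set X := fun i => B (u i) ∩ (p i • ·) ⁻¹' B (p i • u i)
  have hC : ∀ i, IsOpen (C i) := fun i =>
    (hB _).2.inter ((hB _).2.preimage (continuous_const_smul _))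
  have huC : ∀ i, u i ∈ C i := fun i => ⟨(hB _).1, (hB _).1⟩
  obtain ⟨i, hi⟩ := general N h C hC (fun i => inter_subset_left) fun i y hy => hy.2
  have hV : p i • C i ⊆ B (p i • u i) := by
    rintro _ ⟨y, hy, rfl⟩
    exact hy.2
  have hUV : Disjoint (C i) (p i • C i) :=
    (hPd (i, false) (i, true) (by simp)).mono inter_subset_left hV
  have hUO : Disjoint (C i) (B o) := (hod (i, false)).symm.mono_left inter_subset_left
  have hVO : Disjoint (p i • C i) (B o) := (hod (i, true)).symm.mono_left hV
  -- Move all points `u j` into `C i` and all points `p j • u j` into `B o`.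
  obtain ⟨a, ha, -, haO⟩ := exists_altOn_moving hd (κ := Empty) (κ' := ι × Bool)
    (Sum.elim Empty.elim P) (by
      rintro (q | q) (q' | q') e
      · exact q.elim
      · exact q.elim
      · exact q'.elim
      · exact congrArg Sum.inr (hu e)) Empty.elim (fun q => q.elim)
    (fun q => if q.2 then B o else C i) (by
      rintro ⟨j, b⟩
      cases b
      · exact hC i
      · exact (hB o).2) (by
      rintro ⟨j, b⟩
      cases b
      · exact ⟨_, huC i⟩
      · exact ⟨o, (hB o).1⟩)
  have ha0 : ∀ j, a • u j ∈ C i := fun j => haO (j, false)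
  have ha1 : ∀ j, a • p j • u j ∈ B o := fun j => haO (j, true)
  let C' : ι → Set X := fun j => C j ∩ ((a • ·) ⁻¹' C i ∩ (fun y => a • p j • y) ⁻¹' B o)
  have hC' : ∀ j, IsOpen (C' j) := fun j => (hC j).inter
    (((hC i).preimage (continuous_const_smul a)).inter ((hB o).2.preimage
      ((continuous_const_smul a).comp (continuous_const_smul (p j)))))
  obtain ⟨j, hj⟩ := general _ (h.conj ha) C' hC' (fun j y hy => hy.1.1) fun j y hy => hy.1.2
  have hoa : IsOpen (a • C' j) := by
    have := (hC' j).preimage (continuous_const_smul a⁻¹)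
    rwa [preimage_smul_inv] at this
  have hsub : a • C' j ⊆ C i := by
    rintro _ ⟨y, hy, rfl⟩
    exact hy.2.1
  refine ⟨a • C' j, hoa, ⟨_, smul_mem_smul_set ⟨huC j, ha0 j, ha1 j⟩⟩, ?_⟩
  refine altOn_le_of_commutator hd hoa fun s hs t ht => ?_
  obtain ⟨b, hb, hsb⟩ := hi s (altOn_mono hsub hs)
  obtain ⟨d, hd', htd⟩ := hj (a⁻¹ * t * a) (by
    have := conj_mem_altOn ht a⁻¹
    rwa [inv_smul_smul, _root_.inv_inv] at this)
  have hd2 : a * d * a⁻¹ ∈ altOn Γ (B o) := by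
    refine altOn_mono ?_ (conj_mem_altOn hd' a)
    rintro _ ⟨_, ⟨y, hy, rfl⟩, rfl⟩
    exact hy.2.2
  have htd' : t * (a * d * a⁻¹) ∈ N := by
    rw [Subgroup.mem_comap] at htd
    convert htd using 1
    simp only [MulEquiv.toMonoidHom_eq_coe, MonoidHom.coe_coe, MulAut.conj_apply]
    group
  generalize a * d * a⁻¹ = d at hd2 htd'
  have c1 : Commute t b := commute_of_disjoint hUV (altOn_mono hsub ht) hb
  have c2 : Commute s d := commute_of_disjoint hUO (altOn_mono hsub hs) hd2
  have c3 : Commute b d := commute_of_disjoint hVO hb hd2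
  have key : s * t * (s⁻¹ * t⁻¹) = (s * b) * (t * d) * ((s * b)⁻¹ * (t * d)⁻¹) := by
    have e1 : (s * b) * (t * d) = (s * t) * (b * d) := by
      rw [mul_assoc, ← mul_assoc b, ← c1.eq]; group
    have e2 : (t * d) * (s * b) = (t * s) * (b * d) := by
      rw [mul_assoc, ← mul_assoc d, ← c2.eq, c3.eq]; group
    rw [← mul_inv_rev, ← mul_inv_rev, e1, e2]
    group
  rw [key]
  exact mul_mem (mul_mem hsb htd') (mul_mem (inv_mem hsb) (inv_mem htd'))

/-- A confined subgroup contains the alternating group of the complement of a finite set, whose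
cardinality is bounded by that of the confining family. Otherwise let `W` be the largest open set
whose alternating group is in `N`, and let the `z i` be distinct points of its complement, one for
each member of the family. A suitable conjugate `n` of some `p i` is in `N`, takes a point of `W` to
`z i` and takes another point of `W` into `W`; so the alternating group of `W ∪ n • W` is in `N`, and
this contradicts the choice of `W`. -/
theorem ConfinedBy.exists_finite_compl (hd : DenseOrbits Γ X) {ι : Type*} [Fintype ι]
    {N : Subgroup Γ} {p : ι → Γ} (hp : ∀ i, p i ≠ 1) (h : ConfinedBy X N p) :
    ∃ W : Set X, IsOpen W ∧ W.Nonempty ∧ altOn Γ W ≤ N ∧ Wᶜ.encard ≤ Fintype.card ι := by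
  classical
  obtain ⟨U, hU, hne, hUN⟩ := h.exists_altOn_le hd hp
  obtain ⟨W, hW, hUW, hWN, hmax⟩ : ∃ W : Set X, IsOpen W ∧ U ⊆ W ∧ altOn Γ W ≤ N ∧
      ∀ V, IsOpen V → U ⊆ V → altOn Γ V ≤ N → V ⊆ W := by
    let F : Set (Set X) := {V | IsOpen V ∧ (V ∩ U).Nonempty ∧ altOn Γ V ≤ N}
    refine ⟨⋃₀ F, isOpen_sUnion fun V hV => hV.1,
      subset_sUnion_of_mem ⟨hU, by rwa [inter_self], hUN⟩,
      altOn_sUnion_le hd hU hUN F fun V hV => hV, fun V hV hUV hVN =>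
      subset_sUnion_of_mem ⟨hV, by rwa [inter_eq_self_of_subset_right hUV], hVN⟩⟩
  refine ⟨W, hW, hne.mono hUW, hWN, ?_⟩
  by_contra! hcard
  obtain ⟨z, hz, hzW⟩ : ∃ z : ι → X, Function.Injective z ∧ ∀ i, z i ∉ W := by
    obtain ⟨t, htW, htc⟩ := Set.exists_subset_encard_eq hcard.le
    have htf : t.Finite := finite_of_encard_eq_coe htc
    rw [htf.encard_eq_coe_toFinset_card] at htc
    have h1 : htf.toFinset.card = Fintype.card ι := by exact_mod_cast htc
    let e : ι ≃ htf.toFinset := Fintype.equivOfCardEq (by rw [Fintype.card_coe, h1])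
    exact ⟨fun i => e i, fun i j h => e.injective (Subtype.ext h),
      fun i => htW (htf.mem_toFinset.1 (e i).2)⟩
  -- For each `i`, one point whose image under `p i` will be moved to `z i`, and one more point.
  obtain ⟨u, huD, hu⟩ := exists_moved (fun q : ι × Bool => p q.1) (fun q => hp q.1)
    (fun q => if q.2 then univ else MulAction.orbit Γ (z q.1)) (by
      rintro ⟨i, b⟩
      cases b
      · exact hd (z i)
      · exact dense_univ)
  have hk : ∀ i, ∃ k : Γ, k • p i • u (i, false) = z i := by
    intro i
    obtain ⟨k, hk⟩ : u (i, false) ∈ MulAction.orbit Γ (z i) := huD (i, false)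
    refine ⟨k⁻¹ * (p i)⁻¹, ?_⟩
    rw [mul_smul, inv_smul_smul, ← hk]
    exact inv_smul_smul k _
  choose k hk using hk
  let e : ι ⊕ (ι × Option Bool) → (ι × Bool) × Bool :=
    Sum.elim (fun i => ((i, false), true)) fun q => match q.2 with
      | none => ((q.1, false), false)
      | some b => ((q.1, true), b)
  have he : Function.Injective e := by
    rintro (i | ⟨i, _ | b⟩) (j | ⟨j, _ | b'⟩) h <;> simp_all [e]
  obtain ⟨a, ha, hak, haO⟩ := exists_altOn_moving hd _ (hu.comp he) k
    (by intro i j h; exact hz (by simpa [e, hk] using h)) (fun _ => W) (fun _ => hW)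
    fun _ => hne.mono hUW
  obtain ⟨i, hi⟩ := h a⁻¹ (inv_mem ha)
  rw [_root_.inv_inv] at hi
  have h1 : a • u (i, false) ∈ W := haO (i, none)
  have h2 : a • u (i, true) ∈ W := haO (i, some false)
  have h3 : a • p i • u (i, true) ∈ W := haO (i, some true)
  have h4 : a • p i • u (i, false) = z i := (hak i).trans (hk i)
  generalize hn : a * p i * a⁻¹ = n at hi
  have hnW : IsOpen (n • W) := by
    have := hW.preimage (continuous_const_smul n⁻¹)
    rwa [preimage_smul_inv] at this
  have h5 : (W ∩ n • W).Nonempty := by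
    refine ⟨_, h3, _, h2, ?_⟩
    simp [← hn, mul_smul]
  have h6 : altOn Γ (n • W) ≤ N := by
    intro t ht
    have := hWN (by simpa using conj_mem_altOn ht n⁻¹)
    have h7 := mul_mem (mul_mem hi this) (inv_mem hi)
    convert h7 using 1
    group
  have h7 := hmax _ (hW.union hnW) (hUW.trans subset_union_left)
    (altOn_union_le hd hW hnW h5 hWN h6)
  refine hzW i (h7 (Or.inr ⟨_, h1, ?_⟩))
  simp [← hn, mul_smul, h4]

end Moving

end FullAction

/-! ### The action of the full group on the unit space -/

namespace EtaleGroupoid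

open Pointwise FullAction

section Action

variable {X : Type u} [TopologicalSpace X] [T2Space X] {G : EtaleGroupoid.{u, v} X}

theorem mem_iff_germ {g : G.fullGroup} {γ : G.Arr} :
    γ ∈ (g : G.Bisec) ↔ germ g (G.src γ) = γ :=
  ⟨germ_eq, fun h => h ▸ germ_mem g _⟩

theorem germ_one (x : X) : germ (1 : G.fullGroup) x = G.unit x := by
  have h : G.unit x ∈ ((1 : G.fullGroup) : G.Bisec) := ⟨x, rfl⟩
  rw [mem_iff_germ, src_unit] at h
  exact h

theorem germ_mul (g h : G.fullGroup) (x : X) :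
    germ (g * h) x = G.mul (germ g (G.rng (germ h x))) (germ h x) (src_germ _ _) := by
  have hm : G.mul (germ g (G.rng (germ h x))) (germ h x) (src_germ _ _) ∈
      ((g * h : G.fullGroup) : G.Bisec) :=
    ⟨_, germ_mem _ _, _, germ_mem _ _, src_germ _ _, rfl⟩
  rw [mem_iff_germ, src_mul, src_germ] at hm
  exact hm

/-- The action of the full group on the unit space. -/
noncomputable instance : MulAction G.fullGroup X where
  smul g x := G.rng (germ g x)
  one_smul x := by
    change G.rng (germ 1 x) = x
    rw [germ_one, rng_unit]
  mul_smul g h x := by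
    change G.rng (germ (g * h) x) = G.rng (germ g (G.rng (germ h x)))
    rw [germ_mul, rng_mul]

theorem rng_germ (g : G.fullGroup) (x : X) : G.rng (germ g x) = g • x := rfl

theorem smul_src {g : G.fullGroup} {γ : G.Arr} (h : γ ∈ (g : G.Bisec)) :
    g • G.src γ = G.rng γ := by
  rw [← rng_germ, germ_eq h]

theorem germ_mul' (g h : G.fullGroup) (x : X) :
    germ (g * h) x = G.mul (germ g (h • x)) (germ h x) (src_germ _ _) := germ_mul g h x

theorem fullGroup_ext_germ {g h : G.fullGroup} (H : ∀ x, germ g x = germ h x) : g = h :=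
  fullGroup_ext fun γ hγ => by
    rw [mem_iff_germ] at hγ ⊢
    rw [← H, hγ]

theorem germ_mul_left {g h : G.fullGroup} {x : X} (H : germ g x = germ h x) (k : G.fullGroup) :
    germ (k * g) x = germ (k * h) x := by
  rw [germ_mul, germ_mul]
  refine G.mul_congr _ ?_ H
  rw [H]

theorem germ_mul_right {g h k : G.fullGroup} {x : X} (H : germ g (k • x) = germ h (k • x)) :
    germ (g * k) x = germ (h * k) x := by
  rw [germ_mul', germ_mul']
  exact G.mul_congr _ H rfl

theorem germ_mul_left_iff {g h : G.fullGroup} {x : X} (k : G.fullGroup) :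
    germ (k * g) x = germ (k * h) x ↔ germ g x = germ h x :=
  ⟨fun H => by simpa using germ_mul_left H k⁻¹, fun H => germ_mul_left H k⟩

theorem germ_mul_right_iff {g h k : G.fullGroup} {x : X} :
    germ (g * k) x = germ (h * k) x ↔ germ g (k • x) = germ h (k • x) := by
  refine ⟨fun H => ?_, germ_mul_right⟩
  have := germ_mul_right (g := g * k) (h := h * k) (k := k⁻¹) (x := k • x)
    (by rwa [inv_smul_smul])
  simpa [_root_.mul_assoc] using this

theorem smul_eq_of_germ_eq {g h : G.fullGroup} {x : X} (H : germ g x = germ h x) :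
    g • x = h • x := by
  rw [← rng_germ, H, rng_germ]

theorem isOpen_germ_eq (g h : G.fullGroup) : IsOpen {x | germ g x = germ h x} := by
  have : {x | germ g x = germ h x} = germ g ⁻¹' ((h : G.Bisec) : Set G.Arr) := by
    ext x
    change _ ↔ germ g x ∈ (h : G.Bisec)
    rw [mem_iff_germ, src_germ]
    exact eq_comm
  rw [this]
  exact (Bisec.isOpen_coe _).preimage (continuous_germ g)

instance : ContinuousConstSMul G.fullGroup X :=
  ⟨fun g => G.isLocalHomeomorph_rng.continuous.comp (continuous_germ g)⟩

/-- The part of an element of the full group with source in an open set. -/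
def restr (g : G.fullGroup) (U : Set X) (hU : IsOpen U) : G.Bisec where
  carrier := {γ | γ ∈ (g : G.Bisec) ∧ G.src γ ∈ U}
  isOpen := (Bisec.isOpen_coe _).inter (hU.preimage G.isLocalHomeomorph_src.continuous)
  injOn_src := (g : G.Bisec).injOn_src.mono fun _ h => h.1
  injOn_rng := (g : G.Bisec).injOn_rng.mono fun _ h => h.1

theorem mem_restr {g : G.fullGroup} {U : Set X} {hU : IsOpen U} {γ : G.Arr} :
    γ ∈ restr g U hU ↔ γ ∈ (g : G.Bisec) ∧ G.src γ ∈ U := Iff.rfl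

/-- In an effective groupoid, germs are determined by the action near the point. -/
theorem germ_eq_of_eventually_smul_eq (heff : G.IsEffective) {g h : G.fullGroup} {x : X}
    (H : ∀ᶠ y in 𝓝 x, g • y = h • y) : germ g x = germ h x := by
  obtain ⟨U, hUH, hU, hx⟩ := eventually_nhds_iff.1 H
  have key : ∀ g h : G.fullGroup, (∀ y ∈ U, g • y = h • y) →
      (restr g U hU).graph ⊆ (restr h U hU).graph := by
    rintro g h hgh ⟨y, z⟩ ⟨γ, ⟨hγ, hγU⟩, rfl, rfl⟩
    refine ⟨germ h (G.src γ), ⟨germ_mem _ _, by rwa [src_germ]⟩, src_germ _ _, ?_⟩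
    rw [rng_germ, ← hgh _ hγU, smul_src hγ]
  have e := heff _ _ ((key g h hUH).antisymm (key h g fun y hy => (hUH y hy).symm))
  have hm : germ g x ∈ restr g U hU := ⟨germ_mem _ _, by rwa [src_germ]⟩
  rw [e, mem_restr, mem_iff_germ, src_germ] at hm
  exact hm.1.symm

theorem germ_eq_iff (heff : G.IsEffective) {g h : G.fullGroup} {x : X} :
    germ g x = germ h x ↔ ∀ᶠ y in 𝓝 x, g • y = h • y :=
  ⟨fun H => Filter.mem_of_superset ((isOpen_germ_eq g h).mem_nhds H) fun _ => smul_eq_of_germ_eq,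
    germ_eq_of_eventually_smul_eq heff⟩

/-- A continuous section of the source map whose composition with the range map is bijective gives
an element of the full group. -/
def ofSection (s : X → G.Arr) (hs : Continuous s) (hsrc : ∀ x, G.src (s x) = x)
    (hb : Function.Bijective fun x => G.rng (s x)) : G.fullGroup where
  val :=
    { carrier := range s
      isOpen := (G.isLocalHomeomorph_src.isOpenEmbedding_of_comp (by
        rw [show G.src ∘ s = id from funext hsrc]
        exact IsOpenEmbedding.id) hs).isOpen_range
      injOn_src := by
        rintro _ ⟨x, rfl⟩ _ ⟨y, rfl⟩ e
        rw [hsrc, hsrc] at e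
        rw [e]
      injOn_rng := by
        rintro _ ⟨x, rfl⟩ _ ⟨y, rfl⟩ e
        rw [hb.1 e] }
  property :=
    ⟨eq_univ_of_forall fun x => ⟨s x, ⟨x, rfl⟩, hsrc x⟩, eq_univ_of_forall fun x => by
      obtain ⟨y, rfl⟩ := hb.2 x
      exact ⟨s y, ⟨y, rfl⟩, rfl⟩⟩

theorem germ_ofSection {s : X → G.Arr} {hs : Continuous s} {hsrc : ∀ x, G.src (s x) = x}
    {hb : Function.Bijective fun x => G.rng (s x)} (x : X) :
    germ (ofSection s hs hsrc hb) x = s x := by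
  have h : s x ∈ ((ofSection s hs hsrc hb : G.fullGroup) : G.Bisec) := ⟨x, rfl⟩
  rwa [mem_iff_germ, hsrc] at h

/-- For an effective groupoid, the elements of the full group are the bijections of the unit space
that are locally given by bisections; the germs of such a bijection form a continuous section. -/
theorem isFullAction (heff : G.IsEffective) : IsFullAction G.fullGroup X where
  eq_of_smul_eq_smul {g h} H := fullGroup_ext_germ fun x =>
    germ_eq_of_eventually_smul_eq heff (Filter.Eventually.of_forall H)
  exists_of_locally := by
    intro f hf hloc
    choose g hg using hloc
    have hs : ∀ x y, (∀ᶠ z in 𝓝 y, f z = g x • z) → germ (g y) y = germ (g x) y := by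
      intro x y h
      refine germ_eq_of_eventually_smul_eq heff ?_
      filter_upwards [h, hg y] with z h1 h2
      rw [← h1, ← h2]
    have hcont : Continuous fun x => germ (g x) x := by
      rw [continuous_iff_continuousAt]
      intro x
      refine (continuous_germ (g x)).continuousAt.congr ?_
      filter_upwards [(hg x).eventually_nhds] with y hy
      exact (hs x y hy).symm
    have hr : (fun x => G.rng (germ (g x) x)) = f := funext fun x => (hg x).self_of_nhds.symm
    refine ⟨ofSection _ hcont (fun x => src_germ _ _) (by rwa [hr]), fun x => ?_⟩
    rw [← rng_germ, germ_ofSection]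
    exact congrFun hr x

/-- An arrow with distinct source and range is contained in an involution in the full group, which
exchanges a small clopen neighbourhood of the source with its image. -/
theorem exists_mem_of_src_ne_rng [CompactSpace X] [TotallyDisconnectedSpace X] {γ : G.Arr}
    (h : G.src γ ≠ G.rng γ) : ∃ g : G.fullGroup, γ ∈ (g : G.Bisec) := by
  obtain ⟨A, B, hA, hB, hγA, hγB, hAB⟩ := t2_separation h
  obtain ⟨O₁, hO₁, hγ₁, hi₁⟩ := G.isLocalHomeomorph_src.isLocallyInjective γ
  obtain ⟨O₂, hO₂, hγ₂, hi₂⟩ := G.isLocalHomeomorph_rng.isLocallyInjective γ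
  let O := O₁ ∩ O₂ ∩ (G.src ⁻¹' A ∩ G.rng ⁻¹' B)
  have hO : IsOpen O := (hO₁.inter hO₂).inter ((hA.preimage G.isLocalHomeomorph_src.continuous).inter
    (hB.preimage G.isLocalHomeomorph_rng.continuous))
  let T : G.Bisec := ⟨O, hO, hi₁.mono fun x hx => hx.1.1, hi₂.mono fun x hx => hx.1.2⟩
  have hγO : γ ∈ O := ⟨⟨hγ₁, hγ₂⟩, hγA, hγB⟩
  obtain ⟨U, hU, hγU, hUO⟩ := compact_exists_isClopen_in_isOpen
    (G.isLocalHomeomorph_src.isOpenMap _ hO) (mem_image_of_mem G.src hγO)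
  let S : Set G.Arr := O ∩ G.src ⁻¹' U
  have hS : IsOpen S := hO.inter (hU.isOpen.preimage G.isLocalHomeomorph_src.continuous)
  have hSc : IsCompact S := by
    have h1 : Subtype.val '' ((fun δ : T => G.src δ) ⁻¹' U) = S := by
      ext δ
      constructor
      · rintro ⟨δ, hδ, rfl⟩; exact ⟨δ.2, hδ⟩
      · rintro ⟨h1, h2⟩; exact ⟨⟨δ, h1⟩, h2, rfl⟩
    rw [← h1]
    refine IsCompact.image ?_ continuous_subtype_val
    refine T.isOpenEmbedding_src.isInducing.isCompact_preimage' hU.isClosed.isCompact ?_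
    rintro x hx
    obtain ⟨δ, hδ, rfl⟩ := hUO hx
    exact ⟨⟨δ, hδ⟩, rfl⟩
  have hV : IsClosed (G.rng '' S) :=
    (hSc.image G.isLocalHomeomorph_rng.continuous).isClosed
  let C : Set G.Arr := S ∪ G.inv ⁻¹' S ∪ G.unit '' (U ∪ G.rng '' S)ᶜ
  have hC : IsOpen C := (hS.union (hS.preimage G.continuous_inv)).union
    (G.isOpenEmbedding_unit.isOpenMap _ (hU.isClosed.union hV).isOpen_compl)
  have hCinv : ∀ δ ∈ C, G.inv δ ∈ C := by
    rintro δ ((hδ | hδ) | ⟨x, hx, rfl⟩)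
    · exact Or.inl (Or.inr (by rwa [mem_preimage, inv_inv]))
    · exact Or.inl (Or.inl hδ)
    · exact Or.inr ⟨x, hx, (G.inv_unit x).symm⟩
  have hUV : ∀ x, x ∈ U → x ∉ G.rng '' S := by
    rintro x hx ⟨δ, hδ, rfl⟩
    obtain ⟨ε, hε, e⟩ := hUO hx
    have h1 : G.rng δ ∈ A := e ▸ hε.2.1
    exact Set.disjoint_left.1 hAB h1 hδ.1.2.2
  have hsrc : InjOn G.src C := by
    rintro δ ((hδ | hδ) | ⟨x, hx, rfl⟩) ε ((hε | hε) | ⟨y, hy, rfl⟩) e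
    · exact T.src_inj hδ.1 hε.1 e
    · exact absurd ⟨_, hε, by rw [rng_inv, ← e]⟩ (hUV _ hδ.2)
    · exact absurd (Or.inl (by rw [src_unit] at e; exact e ▸ hδ.2)) hy
    · exact absurd ⟨_, hδ, by rw [rng_inv, e]⟩ (hUV _ hε.2)
    · rw [← G.inv_inv δ, ← G.inv_inv ε, T.rng_inj hδ.1 hε.1 (by rw [rng_inv, rng_inv, e])]
    · exact absurd (Or.inr ⟨_, hδ, by rw [rng_inv, e, src_unit]⟩) hy
    · exact absurd (Or.inl (by rw [src_unit] at e; exact e ▸ hε.2)) hx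
    · exact absurd (Or.inr ⟨_, hε, by rw [rng_inv, ← e, src_unit]⟩) hx
    · rw [src_unit, src_unit] at e
      rw [e]
  have hsurj : ∀ x, ∃ δ ∈ C, G.src δ = x := by
    intro x
    by_cases hx : x ∈ U
    · obtain ⟨δ, hδ, rfl⟩ := hUO hx
      exact ⟨δ, Or.inl (Or.inl ⟨hδ, hx⟩), rfl⟩
    by_cases hx' : x ∈ G.rng '' S
    · obtain ⟨δ, hδ, rfl⟩ := hx'
      exact ⟨G.inv δ, Or.inl (Or.inr (by rwa [mem_preimage, inv_inv])), src_inv _ _⟩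
    · exact ⟨G.unit x, Or.inr ⟨x, fun h => h.elim hx hx', rfl⟩, src_unit _ _⟩
  refine ⟨⟨⟨C, hC, hsrc, fun δ hδ ε hε e => ?_⟩, eq_univ_of_forall hsurj,
    eq_univ_of_forall fun x => ?_⟩, Or.inl (Or.inl ⟨hγO, hγU⟩)⟩
  · rw [← G.inv_inv δ, ← G.inv_inv ε, hsrc (hCinv δ hδ) (hCinv ε hε) (by rw [src_inv, src_inv, e])]
  · obtain ⟨δ, hδ, rfl⟩ := hsurj x
    exact ⟨G.inv δ, hCinv δ hδ, rng_inv _ _⟩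

/-- Every arrow is contained in an element of the full group. An arrow whose source is its range is a
product of two arrows with distinct source and range, through another point of the orbit. -/
theorem exists_mem_fullGroup [CompactSpace X] [TotallyDisconnectedSpace X] [PerfectSpace X]
    (hmin : G.IsMinimal) (γ : G.Arr) : ∃ g : G.fullGroup, γ ∈ (g : G.Bisec) := by
  by_cases h : G.src γ = G.rng γ
  · obtain ⟨_, ⟨δ, hδ, rfl⟩, hne⟩ := (hmin (G.src γ)).exists_mem_open
      (isOpen_compl_singleton (x := G.src γ)) (by
        obtain ⟨y, hy⟩ := (inferInstance : (𝓝[≠] (G.src γ)).NeBot).nonempty_of_mem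
          self_mem_nhdsWithin
        exact ⟨y, hy⟩)
    change G.src δ = G.src γ at hδ
    change G.rng δ ≠ G.src γ at hne
    obtain ⟨g, hg⟩ := exists_mem_of_src_ne_rng (γ := δ) (by rw [hδ]; exact hne.symm)
    have hc : G.src γ = G.rng (G.inv δ) := by rw [rng_inv, hδ]
    obtain ⟨k, hk⟩ := exists_mem_of_src_ne_rng (γ := G.mul γ (G.inv δ) hc)
      (by rw [src_mul, rng_mul, src_inv, ← h]; exact hne)
    refine ⟨k * g, _, hk, δ, hg, by simp, ?_⟩
    rw [inv_mul_cancel_right _ _ _ hδ.symm]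
  · exact exists_mem_of_src_ne_rng h

/-- Minimality in terms of the full group. -/
theorem denseOrbits [CompactSpace X] [TotallyDisconnectedSpace X] [PerfectSpace X]
    (hmin : G.IsMinimal) : DenseOrbits G.fullGroup X := by
  refine fun x => (hmin x).mono ?_
  rintro _ ⟨γ, rfl, rfl⟩
  obtain ⟨g, hg⟩ := exists_mem_fullGroup hmin γ
  exact ⟨g, smul_src hg⟩

end Action

/-! ### The alternating full group -/

section Alternating

variable {X : Type u} [TopologicalSpace X] [T2Space X] {G : EtaleGroupoid.{u, v} X}

namespace Multisection

variable {d : ℕ} (F : G.Multisection d)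

theorem germ_perm_mem (τ : Equiv.Perm (Fin d)) {j : Fin d} {x : X}
    (h : G.unit x ∈ F.toFun j j) : germ (F.perm τ) x ∈ F.toFun (τ j) j := by
  obtain ⟨γ, hγ, rfl⟩ := F.exists_src (τ j) h
  have : γ ∈ (F.perm τ : G.Bisec) := F.mem_perm.2 (Or.inl ⟨j, hγ⟩)
  rwa [germ_eq this]

theorem perm_smul_of_notMem (τ : Equiv.Perm (Fin d)) {x : X} (h : x ∉ F.domain) :
    F.perm τ • x = x := by
  have : G.unit x ∈ (F.perm τ : G.Bisec) := F.mem_perm.2 (Or.inr ⟨x, h, rfl⟩)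
  have := smul_src this
  rwa [src_unit, rng_unit] at this

end Multisection

/-- The multisection given by a frame. -/
def frameMultisection [CompactSpace X] {d : ℕ} (g : Fin d → G.fullGroup) {U : Set X}
    (hg : IsFrame g U) : G.Multisection d where
  toFun i j := restr (g i * (g j)⁻¹) (g j • U) (hg.isClopen.isOpen.smul (g j))
  exists_unit i := by
    refine ⟨g i • U, hg.isClopen.isClosed.isCompact.smul (g i), hg.isClopen.isOpen.smul (g i), ?_⟩
    ext γ
    change γ ∈ restr _ _ _ ↔ _
    rw [mem_restr, _root_.mul_inv_cancel]
    constructor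
    · rintro ⟨⟨x, rfl⟩, hx⟩
      rw [src_unit] at hx
      exact ⟨x, hx, rfl⟩
    · rintro ⟨x, hx, rfl⟩
      exact ⟨⟨x, rfl⟩, by rwa [src_unit]⟩
  disjoint i j hij := by
    rw [Set.disjoint_left]
    rintro γ ⟨-, x, hx, h⟩ ⟨-, y, hy, h'⟩
    exact hij (hg.index_eq i j x hx y hy (h.trans h'.symm))
  mul i j l := by
    apply Bisec.ext_mem
    intro ξ
    rw [Bisec.mem_mul, mem_restr]
    have e : g i * (g l)⁻¹ = (g i * (g j)⁻¹) * (g j * (g l)⁻¹) := by group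
    constructor
    · rintro ⟨γ, ⟨hγ, -⟩, δ, ⟨hδ, hδU⟩, h, rfl⟩
      rw [e, src_mul]
      exact ⟨⟨γ, hγ, δ, hδ, h, rfl⟩, hδU⟩
    · rintro ⟨hξ, hξU⟩
      rw [e] at hξ
      obtain ⟨γ, hγ, δ, hδ, h, rfl⟩ := hξ
      rw [src_mul] at hξU
      refine ⟨γ, ⟨hγ, ?_⟩, δ, ⟨hδ, hξU⟩, h, rfl⟩
      rw [h, ← smul_src hδ, mul_smul]
      exact smul_mem_smul_set (mem_smul_set_iff_inv_smul_mem.1 hξU)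

theorem unit_mem_frameMultisection [CompactSpace X] {d : ℕ} {g : Fin d → G.fullGroup} {U : Set X}
    (hg : IsFrame g U) {i : Fin d} {y : X} :
    G.unit y ∈ (frameMultisection g hg).toFun i i ↔ y ∈ g i • U := by
  change G.unit y ∈ restr (g i * (g i)⁻¹) (g i • U) (hg.isClopen.isOpen.smul (g i)) ↔ _
  rw [mem_restr, _root_.mul_inv_cancel, src_unit]
  exact ⟨fun h => h.2, fun h => ⟨⟨y, rfl⟩, h⟩⟩

theorem isShuffle_perm_frameMultisection [CompactSpace X] {d : ℕ} {g : Fin d → G.fullGroup}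
    {U : Set X} (hg : IsFrame g U) (σ : Equiv.Perm (Fin d)) :
    IsShuffle g U σ ((frameMultisection g hg).perm σ) := by
  refine ⟨fun i x hx => ?_, fun y hy => ?_⟩
  · have h := (frameMultisection g hg).germ_perm_mem σ
      ((unit_mem_frameMultisection hg).2 (smul_mem_smul_set hx : g i • x ∈ g i • U))
    rw [← rng_germ, ← smul_src h.1, src_germ, mul_smul, inv_smul_smul]
  · refine (frameMultisection g hg).perm_smul_of_notMem σ ?_
    rintro ⟨i, hi⟩
    rw [unit_mem_frameMultisection] at hi
    obtain ⟨x, hx, rfl⟩ := hi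
    exact hy i x hx rfl

/-- The alternating full group is the group generated by the `3`-cycles of the action on the unit
space. -/
theorem altGroup_eq_altOn [CompactSpace X] (heff : G.IsEffective) :
    G.altGroup = altOn G.fullGroup (univ : Set X) := by
  have := isFullAction heff
  refine le_antisymm ?_ ?_
  · rw [altGroup, Subgroup.closure_le]
    rintro _ ⟨d, hd, F, σ, hσ, rfl⟩
    let o : Fin d := ⟨0, by omega⟩
    let g : Fin d → G.fullGroup := fun i => F.perm (Equiv.swap o i)
    let U : Set X := {x | G.unit x ∈ F.toFun o o}
    have hU : IsClopen U := by
      obtain ⟨V, hV, hVo, e⟩ := F.exists_unit o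
      have h : U = V := by
        ext x
        change G.unit x ∈ (F.toFun o o : Set G.Arr) ↔ _
        rw [e, G.isOpenEmbedding_unit.injective.mem_set_image]
      rw [h]
      exact ⟨hV.isClosed, hVo⟩
    have hgm : ∀ i, ∀ x ∈ U, germ (g i) x ∈ F.toFun i o := by
      intro i x hx
      have := F.germ_perm_mem (Equiv.swap o i) hx
      rwa [Equiv.swap_apply_left] at this
    have hgu : ∀ i, ∀ x ∈ U, G.unit (g i • x) ∈ F.toFun i i :=
      fun i x hx => F.unit_rng_mem (hgm i x hx)
    have hg : IsFrame g U := ⟨hU, fun i j x hx y hy e =>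
      F.eq_of_mem (hgu i x hx) (by rw [e]; exact hgu j y hy)⟩
    have hs : IsShuffle g U σ (F.perm σ) := by
      refine ⟨fun i x hx => ?_, fun y hy => ?_⟩
      · have h1 : germ (F.perm σ * g i) x ∈ F.toFun (σ i) o := by
          rw [germ_mul', ← F.mul (σ i) i o]
          exact ⟨_, F.germ_perm_mem σ (hgu i x hx), _, hgm i x hx, src_germ _ _, rfl⟩
        have h2 := (F.toFun (σ i) o).src_inj h1 (hgm (σ i) x hx) (by rw [src_germ, src_germ])
        rw [← mul_smul]
        exact smul_eq_of_germ_eq h2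
      · refine F.perm_smul_of_notMem σ ?_
        rintro ⟨i, hi⟩
        obtain ⟨γ, hγ, rfl⟩ := F.exists_rng o hi
        have hx : G.src γ ∈ U := F.unit_src_mem hγ
        refine hy i _ hx ?_
        rw [← rng_germ, (F.toFun i o).src_inj (hgm i _ hx) hγ (src_germ _ _)]
    rw [← hs.eq]
    exact shuffle_mem_altOn hg (fun _ _ _ => mem_univ _) hσ
  · rw [altOn, Subgroup.closure_le]
    rintro _ ⟨a, b, c, U, hg, -, rfl⟩
    refine Subgroup.subset_closure ⟨3, le_rfl, frameMultisection _ hg, finRotate 3, ?_, ?_⟩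
    · exact Equiv.Perm.finRotate_bit1_mem_alternatingGroup (n := 1)
    · exact (isShuffle_perm_frameMultisection hg (finRotate 3)).eq.symm

end Alternating

/-! ### Cantor spaces -/

section Cantor

variable {X : Type u} [TopologicalSpace X]

theorem compactSpace_of_cantor (hX : Nonempty (X ≃ₜ (ℕ → Bool))) : CompactSpace X :=
  hX.some.symm.compactSpace

theorem totallyDisconnectedSpace_of_cantor (hX : Nonempty (X ≃ₜ (ℕ → Bool))) :
    TotallyDisconnectedSpace X :=
  hX.some.symm.totallyDisconnectedSpace

theorem perfectSpace_of_cantor (hX : Nonempty (X ≃ₜ (ℕ → Bool))) : PerfectSpace X := by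
  have hc : ∀ f : ℕ → Bool, (𝓝[≠] f).NeBot := by
    intro f
    rw [← mem_closure_iff_nhdsWithin_neBot]
    refine mem_closure_of_tendsto (b := Filter.atTop)
      (f := fun n : ℕ => Function.update f n (!(f n))) ?_ ?_
    · rw [tendsto_pi_nhds]
      intro i
      refine tendsto_const_nhds.congr' ?_
      filter_upwards [Filter.eventually_gt_atTop i] with n hn
      rw [Function.update_of_ne hn.ne]
    · refine Filter.Eventually.of_forall fun n h => ?_
      have := congrFun (mem_singleton_iff.1 h) n
      simp at this
  rw [perfectSpace_iff_forall_not_isolated]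
  intro x
  have e := hX.some
  rw [← mem_closure_iff_nhdsWithin_neBot]
  have h := mem_closure_iff_nhdsWithin_neBot.2 (hc (e x))
  have h2 := mem_closure_image (f := e.symm) e.symm.continuous.continuousAt h
  rw [e.symm_apply_apply] at h2
  refine closure_mono ?_ h2
  rintro _ ⟨f, hf, rfl⟩ h3
  exact hf (by rw [mem_singleton_iff] at h3 ⊢; rw [← h3, e.apply_symm_apply])

end Cantor

end EtaleGroupoid

/-! ### Germs of a homomorphism and their supports -/

namespace EtaleGroupoid

open Pointwise FullAction

section Isotropy

variable {Y : Type w} [TopologicalSpace Y] [T2Space Y] {H : EtaleGroupoid.{w, z} Y}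

/-- The subgroup of the elements of the full group whose germ at `y` is a unit. -/
def unitGroup (y : Y) : Subgroup H.fullGroup where
  carrier := {g | germ g y = germ 1 y}
  one_mem' := rfl
  mul_mem' {g h} hg hh := by
    change germ (g * h) y = germ 1 y
    have hg' : germ g y = germ 1 y := hg
    have hh' : germ h y = germ 1 y := hh
    have e : h • y = y := by simpa using smul_eq_of_germ_eq hh'
    have h1 : germ (g * h) y = germ (1 * h) y := germ_mul_right (by rwa [e])
    rw [h1, one_mul, hh']
  inv_mem' {g} hg := by
    change germ g⁻¹ y = germ 1 y
    have hg' : germ g y = germ 1 y := hg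
    rw [← germ_mul_left_iff g, mul_inv_cancel, mul_one, hg']

theorem mem_unitGroup {y : Y} {g : H.fullGroup} : g ∈ unitGroup y ↔ germ g y = germ 1 y := Iff.rfl

theorem mem_unitGroup_iff {y : Y} {g : H.fullGroup} : g ∈ unitGroup y ↔ germ g y = H.unit y := by
  rw [mem_unitGroup, germ_one]

theorem smul_eq_of_mem_unitGroup {y : Y} {g : H.fullGroup} (h : g ∈ unitGroup y) : g • y = y := by
  simpa using smul_eq_of_germ_eq (mem_unitGroup.1 h)

theorem inv_mul_mem_unitGroup {y : Y} {g h : H.fullGroup} :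
    g⁻¹ * h ∈ unitGroup y ↔ germ h y = germ g y := by
  rw [mem_unitGroup, ← germ_mul_left_iff g, mul_inv_cancel_left, mul_one]

theorem mem_unitGroup_smul {y : Y} {g k : H.fullGroup} :
    k ∈ unitGroup (g • y) ↔ g⁻¹ * k * g ∈ unitGroup y := by
  rw [mem_unitGroup, ← germ_mul_right_iff, _root_.mul_assoc, inv_mul_mem_unitGroup, one_mul]

theorem isOpen_mem_unitGroup (g : H.fullGroup) : IsOpen {y | g ∈ unitGroup y} :=
  isOpen_germ_eq g 1

end Isotropy

section Support

variable {X : Type u} [TopologicalSpace X] [T2Space X] {Y : Type w} [TopologicalSpace Y]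
  [T2Space Y] {G : EtaleGroupoid.{u, v} X} {H : EtaleGroupoid.{w, z} Y}
  {K : Subgroup G.fullGroup} (ρ : K →* H.fullGroup)

/-- The group of the elements of `K` whose image has a unit germ at `y`, as a subgroup of the full
group of `G`. -/
def isotropy (y : Y) : Subgroup G.fullGroup := ((unitGroup y).comap ρ).map K.subtype

variable {ρ}

theorem coe_mem_isotropy {y : Y} {g : K} :
    (g : G.fullGroup) ∈ isotropy ρ y ↔ ρ g ∈ unitGroup y := by
  constructor
  · rintro ⟨g', h, e⟩
    rwa [← Subtype.ext e]
  · exact fun h => ⟨g, h, rfl⟩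

theorem mem_isotropy_smul {y : Y} (g : K) {n : G.fullGroup} :
    n ∈ isotropy ρ (ρ g • y) ↔ (g : G.fullGroup)⁻¹ * n * g ∈ isotropy ρ y := by
  by_cases hn : n ∈ K
  · obtain ⟨n, rfl⟩ : ∃ n' : K, (n' : G.fullGroup) = n := ⟨⟨n, hn⟩, rfl⟩
    have e : (g : G.fullGroup)⁻¹ * n * g = ((g⁻¹ * n * g : K) : G.fullGroup) := rfl
    rw [e, coe_mem_isotropy, coe_mem_isotropy, mem_unitGroup_smul]
    simp only [map_mul, map_inv]
  · refine iff_of_false ?_ ?_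
    · rintro ⟨n', -, rfl⟩
      exact hn n'.2
    · rintro ⟨n', -, e⟩
      refine hn ?_
      have : n = g * n' * (g : G.fullGroup)⁻¹ := by
        rw [show (n' : G.fullGroup) = (g : G.fullGroup)⁻¹ * n * g from e]
        group
      rw [this]
      exact (g * n' * g⁻¹).2

theorem mem_unitGroup_of_notMem_altSupp {y : Y} (hy : y ∉ altSupp ρ) {a : K}
    (ha : (a : G.fullGroup) ∈ G.altGroup) : ρ a ∈ unitGroup y := by
  by_contra h
  refine hy (subset_closure (mem_iUnion₂.2 ⟨ρ a, ⟨a, ha, rfl⟩, ?_⟩))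
  rwa [mem_unitGroup_iff] at h

theorem supp_subset_altSupp {a : K} (ha : (a : G.fullGroup) ∈ G.altGroup) :
    supp (ρ a) ⊆ altSupp ρ := fun y hy => by
  by_contra h
  exact hy (mem_unitGroup_iff.1 (mem_unitGroup_of_notMem_altSupp h ha))

/-- An element of the full group that normalises the image of the alternating full group preserves
the support of this image. -/
theorem smul_mem_altSupp {k : H.fullGroup} (hk : ∀ a : K, (a : G.fullGroup) ∈ G.altGroup →
    ∃ b : K, (b : G.fullGroup) ∈ G.altGroup ∧ k * ρ a * k⁻¹ = ρ b) {y : Y} (hy : y ∈ altSupp ρ) :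
    k • y ∈ altSupp ρ := by
  refine map_mem_closure (continuous_const_smul k) hy ?_
  intro x hx
  obtain ⟨_, ⟨a, ha, rfl⟩, hx⟩ := mem_iUnion₂.1 hx
  obtain ⟨b, hb, e⟩ := hk a ha
  refine mem_iUnion₂.2 ⟨ρ b, ⟨b, hb, rfl⟩, fun h => hx ?_⟩
  have h' := mem_unitGroup_smul.1 (mem_unitGroup_iff.2 h)
  rw [← e, show k⁻¹ * (k * ρ a * k⁻¹) * k = ρ a by group] at h'
  exact mem_unitGroup_iff.1 h'

theorem map_smul_mem_altSupp (g : K) {y : Y} (hy : y ∈ altSupp ρ) : ρ g • y ∈ altSupp ρ := by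
  refine smul_mem_altSupp (fun a ha => ⟨g * a * g⁻¹, ?_, by simp⟩) hy
  exact Subgroup.Normal.conj_mem inferInstance _ ha _

variable (ρ) in
/-- The support in `X` of the germs at `y`: the points of `X` without open neighbourhood `U` such
that the alternating group of `U` has unit germs at `y`. -/
def germSupp (y : Y) : Set X :=
  {x | ∀ U : Set X, IsOpen U → x ∈ U → ¬ altOn G.fullGroup U ≤ isotropy ρ y}

theorem compl_germSupp (y : Y) : (germSupp ρ y)ᶜ =
    ⋃₀ {U : Set X | IsOpen U ∧ U.Nonempty ∧ altOn G.fullGroup U ≤ isotropy ρ y} := by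
  ext x
  simp only [germSupp, mem_compl_iff, mem_ofPred_eq, not_forall, not_not, mem_sUnion]
  constructor
  · rintro ⟨U, hU, hx, h⟩
    exact ⟨U, ⟨hU, ⟨x, hx⟩, h⟩, hx⟩
  · rintro ⟨U, ⟨hU, -, h⟩, hx⟩
    exact ⟨U, hU, hx, h⟩

theorem isOpen_compl_germSupp (y : Y) : IsOpen (germSupp ρ y)ᶜ := by
  rw [compl_germSupp]
  exact isOpen_sUnion fun U hU => hU.1

variable (ρ) in
/-- The homomorphism `ρ`, on a group that contains the alternating full group of a minimal effective
groupoid, has supports of at most `n` points: the elements of the alternating full group that are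
generated by `3`-cycles outside the support of a point `y` have unit germs at `y`. -/
structure FinitelySupported (n : ℕ) : Prop where
  minimal : G.IsMinimal
  effective : G.IsEffective
  altGroup_le : G.altGroup ≤ K
  altOn_le : ∀ y ∈ altSupp ρ, altOn G.fullGroup (germSupp ρ y)ᶜ ≤ isotropy ρ y
  encard_le : ∀ y ∈ altSupp ρ, (germSupp ρ y).encard ≤ n

variable [CompactSpace X] [TotallyDisconnectedSpace X] [PerfectSpace X]

/-- If no germ map is injective, then by compactness the isotropy groups of all points of the
support are confined by one finite set of non-trivial elements. -/
theorem exists_finitelySupported [CompactSpace Y] (hmin : G.IsMinimal) (heff : G.IsEffective)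
    (hK : G.altGroup ≤ K) (hρ : ¬ HasInjectiveGermMap ρ) : ∃ n, FinitelySupported ρ n := by
  have hd := denseOrbits hmin
  have := isFullAction heff
  have hA := altGroup_eq_altOn heff
  have hZ : IsCompact (altSupp ρ) := isClosed_closure.isCompact
  obtain ⟨t, ht⟩ := hZ.elim_finite_subcover
    (fun g : {g : K // g ≠ 1} => {y | ρ g ∈ unitGroup y}) (fun g => isOpen_mem_unitGroup _) (by
      intro y hy
      have h : ¬ Function.Injective fun g : K => germ (ρ g) y := fun h => hρ ⟨y, hy, h⟩
      simp only [Function.Injective, not_forall] at h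
      obtain ⟨g, h, e, hne⟩ := h
      refine mem_iUnion.2 ⟨⟨h⁻¹ * g, fun e' => hne (inv_mul_eq_one.1 e').symm⟩, ?_⟩
      change ρ (h⁻¹ * g) ∈ unitGroup y
      rwa [map_mul, map_inv, inv_mul_mem_unitGroup])
  have key : ∀ y ∈ altSupp ρ, ∃ W : Set X, IsOpen W ∧ W.Nonempty ∧
      altOn G.fullGroup W ≤ isotropy ρ y ∧ Wᶜ.encard ≤ Fintype.card t := by
    intro y hy
    refine ConfinedBy.exists_finite_compl hd (p := fun i : t => ((i.1.1 : K) : G.fullGroup))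
      (fun i h => i.1.2 (Subtype.ext h)) ?_
    intro a ha
    have haK : a ∈ K := hK (hA ▸ ha)
    obtain ⟨i, hi, h⟩ := mem_iUnion₂.1 (ht (map_smul_mem_altSupp ⟨a, haK⟩ hy))
    exact ⟨⟨i, hi⟩, (mem_isotropy_smul ⟨a, haK⟩).1 (coe_mem_isotropy.2 h)⟩
  refine ⟨Fintype.card t, hmin, heff, hK, fun y hy => ?_, fun y hy => ?_⟩
  · obtain ⟨W, hW, -, hWN, hWc⟩ := key y hy
    rw [compl_germSupp]
    refine altOn_sUnion_le hd hW hWN _ fun U hU => ⟨hU.1, ?_, hU.2.2⟩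
    by_contra h
    have hUW : U ⊆ Wᶜ := fun x hx hxW => h ⟨x, hx, hxW⟩
    obtain ⟨x, hx⟩ := hU.2.1
    exact (hd.infinite x hU.1 ⟨x, hx⟩)
      ((finite_of_encard_le_coe hWc).subset (inter_subset_right.trans hUW))
  · obtain ⟨W, hW, -, hWN, hWc⟩ := key y hy
    refine (encard_le_encard fun x hx hxW => ?_).trans hWc
    exact hx W hW hxW hWN

namespace FinitelySupported

variable {n : ℕ}

theorem altOn_le_altGroup (hs : FinitelySupported ρ n) (U : Set X) :
    altOn G.fullGroup U ≤ G.altGroup := by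
  rw [altGroup_eq_altOn hs.effective]
  exact altOn_mono (subset_univ _)

theorem finite (hs : FinitelySupported ρ n) {y : Y} (hy : y ∈ altSupp ρ) :
    (germSupp ρ y).Finite := finite_of_encard_le_coe (hs.encard_le y hy)

/-- An element of the alternating full group has a unit germ at `y` if its germs at the points of
the support of `y` are units. -/
theorem map_mem_unitGroup (hs : FinitelySupported ρ n) {y : Y} (hy : y ∈ altSupp ρ) {a : K}
    (ha : (a : G.fullGroup) ∈ G.altGroup)
    (h : ∀ q ∈ germSupp ρ y, germ (a : G.fullGroup) q = germ 1 q) : ρ a ∈ unitGroup y := by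
  have := isFullAction hs.effective
  rw [← coe_mem_isotropy]
  refine hs.altOn_le y hy (mem_altOn_compl (denseOrbits hs.minimal)
    (altGroup_eq_altOn hs.effective ▸ ha) (hs.finite hy) fun q hq => ?_)
  simpa using (germ_eq_iff hs.effective).1 (h q hq)

/-- The germ of `ρ a` at `y` is determined by the germs of `a` at the support of `y`. -/
theorem germ_map_eq (hs : FinitelySupported ρ n) {y : Y} (hy : y ∈ altSupp ρ) {a b : K}
    (ha : (a : G.fullGroup) ∈ G.altGroup) (hb : (b : G.fullGroup) ∈ G.altGroup)
    (h : ∀ q ∈ germSupp ρ y, germ (a : G.fullGroup) q = germ (b : G.fullGroup) q) :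
    germ (ρ a) y = germ (ρ b) y := by
  rw [← inv_mul_mem_unitGroup, ← map_inv, ← map_mul]
  refine hs.map_mem_unitGroup hy (mul_mem (inv_mem hb) ha) fun q hq => ?_
  exact inv_mul_mem_unitGroup.2 (h q hq)

theorem germSupp_smul (hs : FinitelySupported ρ n) (g : K) (y : Y) :
    germSupp ρ (ρ g • y) = (g : G.fullGroup) • germSupp ρ y := by
  have := isFullAction hs.effective
  have key : ∀ (g : K) (y : Y), (g : G.fullGroup) • germSupp ρ y ⊆ germSupp ρ (ρ g • y) := by
    rintro g y _ ⟨x, hx, rfl⟩ U hU hxU hN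
    refine hx ((g : G.fullGroup)⁻¹ • U) (hU.smul _) (mem_inv_smul_set_iff.2 hxU) fun t ht => ?_
    have h := conj_mem_altOn ht (g : G.fullGroup)
    rw [smul_inv_smul] at h
    have h' := (mem_isotropy_smul g).1 (hN h)
    rwa [show (g : G.fullGroup)⁻¹ * (g * t * (g : G.fullGroup)⁻¹) * g = t by group] at h'
  refine Subset.antisymm ?_ (key g y)
  have h := key g⁻¹ (ρ g • y)
  rw [map_inv, inv_smul_smul] at h
  have h2 := smul_set_mono (a := (g : G.fullGroup)) h
  rwa [Subgroup.coe_inv, smul_inv_smul] at h2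

theorem smul_germSupp_eq (hs : FinitelySupported ρ n) {g : K} {y : Y} (h : ρ g • y = y) :
    (g : G.fullGroup) • germSupp ρ y = germSupp ρ y := by
  rw [← hs.germSupp_smul, h]

/-- Near `y`, supports do not come close to a point outside the support of `y`: such a point has
more than `n` distinct images under elements with unit germs near `y`, which preserve supports. -/
theorem exists_nhds_disjoint (hs : FinitelySupported ρ n) {y : Y} (hy : y ∈ altSupp ρ) {x : X}
    (hx : x ∉ germSupp ρ y) : ∃ C ∈ 𝓝 x, ∀ᶠ y' in 𝓝[altSupp ρ] y, Disjoint (germSupp ρ y') C := by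
  have := isFullAction hs.effective
  have hd := denseOrbits hs.minimal
  have hW := isOpen_compl_germSupp (ρ := ρ) y
  obtain ⟨t, hts, htc⟩ := (hd.infinite x hW ⟨x, hx⟩).exists_subset_card_eq (n + 1)
  have hb : ∀ z : t, ∃ b : K, (b : G.fullGroup) ∈ altOn G.fullGroup (germSupp ρ y)ᶜ ∧
      (b : G.fullGroup) • x = z := by
    rintro ⟨z, hz⟩
    obtain ⟨⟨k, rfl⟩, hzW⟩ := hts hz
    obtain ⟨b, hb, e⟩ := exists_altOn hd hW (u := x) (k := k) hx hzW
    exact ⟨⟨b, hs.altGroup_le (hs.altOn_le_altGroup _ hb)⟩, hb, e.self_of_nhds⟩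
  choose b hb hbx using hb
  refine ⟨{c | ∀ z z' : t, z ≠ z' → (b z : G.fullGroup) • c ≠ (b z' : G.fullGroup) • c}, ?_, ?_⟩
  · suffices h : ∀ᶠ c in 𝓝 x, ∀ z z' : t, z ≠ z' →
        (b z : G.fullGroup) • c ≠ (b z' : G.fullGroup) • c from h
    simp only [Filter.eventually_all]
    intro z z' hz
    have ho : IsOpen {c : X | (b z : G.fullGroup) • c ≠ (b z' : G.fullGroup) • c} :=
      isOpen_ne_fun (continuous_const_smul _) (continuous_const_smul _)
    refine ho.mem_nhds ?_
    change (b z : G.fullGroup) • x ≠ (b z' : G.fullGroup) • x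
    rw [hbx, hbx]
    exact fun h => hz (Subtype.ext h)
  · have h1 : ∀ᶠ y' in 𝓝 y, ∀ z : t, ρ (b z) ∈ unitGroup y' := by
      rw [Filter.eventually_all]
      intro z
      exact (isOpen_mem_unitGroup (ρ (b z))).mem_nhds (coe_mem_isotropy.1 (hs.altOn_le y hy (hb z)))
    filter_upwards [nhdsWithin_le_nhds h1, self_mem_nhdsWithin] with y' hy' hZ
    rw [Set.disjoint_left]
    intro c hc hcC
    have hinj : Function.Injective fun z : t => (b z : G.fullGroup) • c := fun z z' h => by
      by_contra hne
      exact hcC z z' hne h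
    have hsub : range (fun z : t => (b z : G.fullGroup) • c) ⊆ germSupp ρ y' := by
      rintro _ ⟨z, rfl⟩
      change (b z : G.fullGroup) • c ∈ _
      rw [← hs.smul_germSupp_eq (smul_eq_of_mem_unitGroup (hy' z))]
      exact smul_mem_smul_set hc
    have h2 := (encard_le_encard hsub).trans (hs.encard_le y' hZ)
    rw [← image_univ, hinj.encard_image, encard_univ, ENat.card_eq_coe_fintype_card,
      Fintype.card_coe, htc] at h2
    exact absurd (Nat.cast_le.1 h2) (by omega)

/-- Supports are upper semicontinuous. -/
theorem eventually_subset (hs : FinitelySupported ρ n) {y : Y} (hy : y ∈ altSupp ρ) {V : Set X}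
    (hV : IsOpen V) (hyV : germSupp ρ y ⊆ V) : ∀ᶠ y' in 𝓝[altSupp ρ] y, germSupp ρ y' ⊆ V := by
  have h : ∀ᶠ y' in 𝓝[altSupp ρ] y, Disjoint (germSupp ρ y') Vᶜ := by
    refine hV.isClosed_compl.isCompact.induction_on
      (p := fun C => ∀ᶠ y' in 𝓝[altSupp ρ] y, Disjoint (germSupp ρ y') C) ?_ ?_ ?_ ?_
    · simp
    · exact fun C C' hC h => h.mono fun y' hy' => hy'.mono_right hC
    · intro C C' h h'
      filter_upwards [h, h'] with y' h1 h2 using h1.union_right h2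
    · intro x hx
      obtain ⟨C, hC, h⟩ := hs.exists_nhds_disjoint hy (x := x) fun h => hx (hyV h)
      exact ⟨C, mem_nhdsWithin_of_mem_nhds hC, h⟩
  exact h.mono fun y' hy' => disjoint_compl_right_iff_subset.1 hy'

/-- If the support of `y` were empty, the supports of the points near `y` would be empty, so that the
alternating full group would have unit germs near `y`. -/
theorem germSupp_nonempty (hs : FinitelySupported ρ n) {y : Y} (hy : y ∈ altSupp ρ) :
    (germSupp ρ y).Nonempty := by
  rw [nonempty_iff_ne_empty]
  intro he
  have h := hs.eventually_subset hy isOpen_empty he.subset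
  rw [eventually_nhdsWithin_iff] at h
  obtain ⟨y', ⟨_, ⟨a, ha, rfl⟩, hy'⟩, hsub⟩ :
      ∃ y', (∃ k ∈ (G.altGroup.subgroupOf K).map ρ, y' ∈ supp k) ∧
        (y' ∈ altSupp ρ → germSupp ρ y' ⊆ ∅) := by
    obtain ⟨y', h1, h2⟩ := ((mem_closure_iff_frequently.1 hy).and_eventually h).exists
    exact ⟨y', by simpa using mem_iUnion₂.1 h1, h2⟩
  have hZ : y' ∈ altSupp ρ := supp_subset_altSupp ha hy'
  refine hy' (mem_unitGroup_iff.1 (hs.map_mem_unitGroup hZ ha fun q hq => absurd (hsub hZ hq) ?_))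
  exact notMem_empty q

/-- Every support point `q` of `y` is moved away from the support, by an element of the alternating
group of a given neighbourhood of `q`. -/
theorem exists_smul_notMem (hs : FinitelySupported ρ n) {y : Y} (hy : y ∈ altSupp ρ) {q : X}
    {B : Set X} (hB : IsOpen B) (hqB : q ∈ B) : ∃ a : K, (a : G.fullGroup) ∈ altOn G.fullGroup B ∧
      (a : G.fullGroup) • q ∉ germSupp ρ y := by
  have := isFullAction hs.effective
  have hd := denseOrbits hs.minimal
  obtain ⟨h, h1, h2⟩ := hd.exists_fresh q hB ⟨q, hqB⟩ (hs.finite hy)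
  obtain ⟨a, ha, e⟩ := exists_altOn hd hB hqB h1
  refine ⟨⟨a, hs.altGroup_le (hs.altOn_le_altGroup _ ha)⟩, ha, ?_⟩
  change a • q ∉ _
  rwa [e.self_of_nhds]

/-- Supports are lower semicontinuous: if supports of points arbitrarily near `y` missed the
neighbourhood `B` of `q`, then an element of the alternating group of `B` that moves `q` out of the
support would fix these points and hence `y`, and so preserve the support of `y`. -/
theorem eventually_nonempty (hs : FinitelySupported ρ n) {y : Y} (hy : y ∈ altSupp ρ) {q : X}
    (hq : q ∈ germSupp ρ y) {B : Set X} (hB : IsOpen B) (hqB : q ∈ B) :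
    ∀ᶠ y' in 𝓝[altSupp ρ] y, (germSupp ρ y' ∩ B).Nonempty := by
  by_contra h
  obtain ⟨a, ha, haq⟩ := hs.exists_smul_notMem hy hB hqB
  have hf : ∃ᶠ y' in 𝓝 y, ρ a • y' = y' := by
    refine ((Filter.not_eventually.1 h).and_eventually self_mem_nhdsWithin).filter_mono
      nhdsWithin_le_nhds |>.mono ?_
    rintro y' ⟨h1, hZ⟩
    refine smul_eq_of_mem_unitGroup (coe_mem_isotropy.1 (hs.altOn_le y' hZ (altOn_mono ?_ ha)))
    exact fun x hx hxQ => h1 ⟨x, hxQ, hx⟩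
  have e : ρ a • y = y :=
    (isClosed_eq (continuous_const_smul (ρ a)) continuous_id).mem_of_frequently_of_tendsto hf
      Filter.tendsto_id
  rw [← hs.smul_germSupp_eq e] at haq
  exact haq (smul_mem_smul_set hq)

/-- An element of the alternating full group that does not preserve the support of `y` moves `y` and
the points near `y`. -/
theorem isOpen_altSupp (hs : FinitelySupported ρ n) : IsOpen (altSupp ρ) := by
  rw [isOpen_iff_mem_nhds]
  intro y hy
  obtain ⟨q, hq⟩ := hs.germSupp_nonempty hy
  obtain ⟨a, ha, haq⟩ := hs.exists_smul_notMem hy isOpen_univ (mem_univ q)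
  have hne : ρ a • y ≠ y := fun e => by
    rw [← hs.smul_germSupp_eq e] at haq
    exact haq (smul_mem_smul_set hq)
  have ho : IsOpen {y' | ρ a • y' ≠ y'} :=
    isOpen_ne_fun (continuous_const_smul (T := Y) (ρ a)) continuous_id
  refine Filter.mem_of_superset (ho.mem_nhds hne) fun y' hy' => ?_
  refine supp_subset_altSupp (hs.altOn_le_altGroup _ ha) fun h => hy' ?_
  exact smul_eq_of_mem_unitGroup (mem_unitGroup_iff.2 h)

theorem isClopen_altSupp (hs : FinitelySupported ρ n) : IsClopen (altSupp ρ) :=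
  ⟨isClosed_closure, hs.isOpen_altSupp⟩

/-- The support of the germs at a point, as a point of the symmetric power of `X`. -/
def suppPt (hs : FinitelySupported ρ n) (y : altSupp ρ) : SymSpace X (n + 1) :=
  ⟨germSupp ρ y.1, hs.germSupp_nonempty y.2,
    (hs.encard_le y.1 y.2).trans (Nat.cast_le.2 n.le_succ)⟩

theorem continuous_suppPt (hs : FinitelySupported ρ n) : Continuous hs.suppPt := by
  rw [continuous_def]
  intro O hO
  rw [isOpen_iff_mem_nhds]
  rintro ⟨y, hy⟩ hyO
  obtain ⟨N, hN, -, -, hNO⟩ := SymArr.exists_box (G := G) (hO.preimage SymArr.continuous_src)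
    (SymArr.unit (hs.suppPt ⟨y, hy⟩)) (by
      change SymArr.src (SymArr.unit _) ∈ O
      rwa [show SymArr.src (G := G) (SymArr.unit (hs.suppPt ⟨y, hy⟩)) = hs.suppPt ⟨y, hy⟩ from
        Subtype.ext (image_src_unit _)])
  have hV : ∀ x, IsOpen (G.unit ⁻¹' N (G.unit x)) := fun x => (hN _).1.preimage G.continuous_unit
  have h1 := hs.eventually_subset hy
    (isOpen_biUnion fun x (_ : x ∈ germSupp ρ y) => hV x) (fun x hx => mem_iUnion₂.2 ⟨x, hx, (hN _).2⟩)
  have h2 : ∀ᶠ y' in 𝓝[altSupp ρ] y, ∀ x ∈ germSupp ρ y,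
      (germSupp ρ y' ∩ G.unit ⁻¹' N (G.unit x)).Nonempty :=
    (hs.finite hy).eventually_all.2 fun x hx => hs.eventually_nonempty hy hx (hV x) (hN _).2
  have h3 : ∀ᶠ y' : altSupp ρ in 𝓝 ⟨y, hy⟩, hs.suppPt y' ∈ O := by
    have h := h1.and h2
    rw [nhdsWithin_eq_map_subtype_coe hy, Filter.eventually_map] at h
    refine h.mono fun y' h => ?_
    have h4 := hNO (SymArr.unit (hs.suppPt y')) ?_ ?_
    · change SymArr.src (SymArr.unit _) ∈ O at h4
      rwa [show SymArr.src (G := G) (SymArr.unit (hs.suppPt y')) = hs.suppPt y' from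
        Subtype.ext (image_src_unit _)] at h4
    · rintro _ ⟨x, hx, rfl⟩
      obtain ⟨x', hx', h5⟩ := mem_iUnion₂.1 (h.1 hx)
      exact mem_iUnion₂.2 ⟨_, ⟨x', hx', rfl⟩, h5⟩
    · rintro _ ⟨x, hx, rfl⟩
      obtain ⟨x', hx', h5⟩ := h.2 x hx
      exact ⟨_, ⟨x', hx', rfl⟩, h5⟩
  exact h3

end FinitelySupported

end Support

end EtaleGroupoid

/-! ### The full group in the symmetric power -/

namespace EtaleGroupoid

open Pointwise FullAction

section SymmetricPower

theorem mul_right_cancel_arr {X : Type u} [TopologicalSpace X] [T2Space X]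
    {G : EtaleGroupoid.{u, v} X} {γ γ' δ : G.Arr} (h : G.src γ = G.rng δ) (h' : G.src γ' = G.rng δ)
    (e : G.mul γ δ h = G.mul γ' δ h') : γ = γ' := by
  rw [← G.mul_inv_cancel_right γ δ h, G.mul_congr _ e rfl, mul_inv_cancel_right]

variable {X : Type u} [TopologicalSpace X] [T2Space X] {G : EtaleGroupoid.{u, v} X} {r : ℕ}
  [NeZero r]

theorem coe_germ_powFull (g : G.fullGroup) (A : SymSpace X r) :
    (germ (powFull r g) A).1 = germ g '' A.1 := by
  have h1 : (germ (powFull r g) A).1 ⊆ ((g : G.Bisec) : Set G.Arr) := germ_mem (powFull r g) A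
  have h2 : G.src '' (germ (powFull r g) A).1 = A.1 := congrArg Subtype.val (src_germ (powFull r g) A)
  rw [← h2, image_image]
  ext γ
  constructor
  · exact fun h => ⟨γ, h, germ_eq (h1 h)⟩
  · rintro ⟨δ, h, rfl⟩
    change germ g (G.src δ) ∈ _
    rwa [germ_eq (h1 h)]

theorem germ_powFull_eq_iff {g h : G.fullGroup} {A : SymSpace X r} :
    germ (powFull r g) A = germ (powFull r h) A ↔ ∀ x ∈ A.1, germ g x = germ h x := by
  constructor
  · intro e x hx
    have h1 : germ g x ∈ germ h '' A.1 := by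
      rw [← coe_germ_powFull, ← e, coe_germ_powFull]
      exact mem_image_of_mem _ hx
    obtain ⟨x', -, h2⟩ := h1
    have h3 : x' = x := by rw [← src_germ h x', h2, src_germ]
    rw [← h2, h3]
  · intro e
    refine Subtype.ext ?_
    rw [coe_germ_powFull, coe_germ_powFull]
    exact image_congr e

theorem coe_powFull_smul (g : G.fullGroup) (A : SymSpace X r) :
    (powFull r g • A : SymSpace X r).1 = g • A.1 := by
  change G.rng '' (germ (powFull r g) A).1 = _
  rw [coe_germ_powFull, image_image]
  rfl

theorem powFull_mul (g h : G.fullGroup) : powFull r (g * h) = powFull r g * powFull r h := by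
  refine (fullGroup_ext ?_).symm
  rintro _ ⟨P, hP, Q, hQ, e, rfl⟩ _ ⟨γ, hγ, δ, hδ, e', rfl⟩
  exact ⟨γ, hP hγ, δ, hQ hδ, e', rfl⟩

theorem powFull_one : powFull r (1 : G.fullGroup) = 1 := by
  refine (fullGroup_ext ?_).symm
  rintro _ ⟨A, rfl⟩ _ ⟨x, -, rfl⟩
  exact ⟨x, rfl⟩

/-- Every arrow of the symmetric power is contained in an element of the alternating full group. -/
theorem exists_mem_powFull [CompactSpace X] [TotallyDisconnectedSpace X] [PerfectSpace X]
    (hmin : G.IsMinimal) (heff : G.IsEffective) (Q : G.SymArr r) :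
    ∃ a ∈ G.altGroup, Q ∈ (powFull r a : (G.symPow r).Bisec) := by
  have := isFullAction heff
  have h : ∀ x : X, ∃ k : G.fullGroup, ∀ γ ∈ Q.1, G.src γ = x → γ ∈ (k : G.Bisec) := by
    intro x
    by_cases hx : ∃ γ ∈ Q.1, G.src γ = x
    · obtain ⟨γ, hγ, rfl⟩ := hx
      obtain ⟨k, hk⟩ := exists_mem_fullGroup hmin γ
      exact ⟨k, fun δ hδ e => by rwa [Q.2.2.2.1 hδ hγ e]⟩
    · exact ⟨1, fun γ hγ e => absurd ⟨γ, hγ, e⟩ hx⟩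
  choose k hk using h
  obtain ⟨a, ha, hak⟩ := exists_altOn_finset (denseOrbits hmin) (G.src '' Q.1)
    (Q.finite.image _) k (by
      rintro _ ⟨γ, hγ, rfl⟩ _ ⟨δ, hδ, rfl⟩ e
      change k (G.src γ) • G.src γ = k (G.src δ) • G.src δ at e
      rw [smul_src (hk _ γ hγ rfl), smul_src (hk _ δ hδ rfl)] at e
      rw [Q.2.2.2.2 hγ hδ e])
  refine ⟨a, altGroup_eq_altOn heff ▸ ha, fun γ hγ => ?_⟩
  have e := germ_eq_of_eventually_smul_eq heff (hak _ ⟨γ, hγ, rfl⟩)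
  change γ ∈ (a : G.Bisec)
  rw [mem_iff_germ, e, germ_eq (hk _ γ hγ rfl)]

end SymmetricPower

/-! ### Construction of the extension -/

section Extension

variable {X : Type u} [TopologicalSpace X] [T2Space X] {Y : Type w} [TopologicalSpace Y]
  [T2Space Y] {G : EtaleGroupoid.{u, v} X} {H : EtaleGroupoid.{w, z} Y}
  {K : Subgroup G.fullGroup} {ρ : K →* H.fullGroup}
  [CompactSpace X] [TotallyDisconnectedSpace X] [PerfectSpace X] {n : ℕ}

namespace FinitelySupported

theorem suppPt_eq (hs : FinitelySupported ρ n) {g : K} {y y' : altSupp ρ} (h : ρ g • y.1 = y'.1) :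
    powFull (n + 1) (g : G.fullGroup) • hs.suppPt y = hs.suppPt y' := by
  refine Subtype.ext ?_
  rw [coe_powFull_smul]
  change (g : G.fullGroup) • germSupp ρ y.1 = germSupp ρ y'.1
  rw [← h, hs.germSupp_smul]

theorem germ_eq_of_germ_powFull_eq (hs : FinitelySupported ρ n) {y : altSupp ρ} {a b : K}
    (ha : (a : G.fullGroup) ∈ G.altGroup) (hb : (b : G.fullGroup) ∈ G.altGroup)
    (h : germ (powFull (n + 1) (a : G.fullGroup)) (hs.suppPt y) =
      germ (powFull (n + 1) (b : G.fullGroup)) (hs.suppPt y)) :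
    germ (ρ a) y.1 = germ (ρ b) y.1 :=
  hs.germ_map_eq y.2 ha hb (germ_powFull_eq_iff.1 h)

/-- The image of a bisection `S` of the symmetric power under the extension of `ρ`: the germs at
`y` of the elements `ρ a`, for `a` in the alternating full group whose germ at the support of `y`
belongs to `S`. -/
def extBisec (hs : FinitelySupported ρ n) (S : (G.symPow (n + 1)).Bisec) :
    (H.restrict (altSupp ρ) hs.isOpen_altSupp).Bisec where
  carrier := {η | ∃ a : K, (a : G.fullGroup) ∈ G.altGroup ∧ η.1 ∈ (ρ a : H.Bisec) ∧
    germ (powFull (n + 1) (a : G.fullGroup))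
      (hs.suppPt ((H.restrict (altSupp ρ) hs.isOpen_altSupp).src η)) ∈ S}
  isOpen := by
    have h : {η : (H.restrict (altSupp ρ) hs.isOpen_altSupp).Arr | ∃ a : K,
        (a : G.fullGroup) ∈ G.altGroup ∧ η.1 ∈ (ρ a : H.Bisec) ∧
          germ (powFull (n + 1) (a : G.fullGroup))
            (hs.suppPt ((H.restrict (altSupp ρ) hs.isOpen_altSupp).src η)) ∈ S} =
        ⋃ a ∈ {a : K | (a : G.fullGroup) ∈ G.altGroup},
          Subtype.val ⁻¹' ((ρ a : H.Bisec) : Set H.Arr) ∩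
            (fun η => germ (powFull (n + 1) (a : G.fullGroup))
              (hs.suppPt ((H.restrict (altSupp ρ) hs.isOpen_altSupp).src η))) ⁻¹'
                (S : Set (G.symPow (n + 1)).Arr) := by
      ext η
      exact ⟨fun ⟨a, ha, h⟩ => mem_iUnion₂.2 ⟨a, ha, h⟩, fun h => by
        obtain ⟨a, ha, h⟩ := mem_iUnion₂.1 h
        exact ⟨a, ha, h⟩⟩
    rw [h]
    refine isOpen_biUnion fun a _ => ((Bisec.isOpen_coe _).preimage continuous_subtype_val).inter
      (S.isOpen_coe.preimage ?_)
    exact (continuous_germ _).comp (hs.continuous_suppPt.comp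
      (H.restrict (altSupp ρ) hs.isOpen_altSupp).isLocalHomeomorph_src.continuous)
  injOn_src := by
    rintro η ⟨a, ha, hηa, haS⟩ η' ⟨b, hb, hηb, hbS⟩ e
    rw [← e] at hbS
    have h := hs.germ_eq_of_germ_powFull_eq ha hb (S.src_inj haS hbS (by rw [src_germ, src_germ]))
    have e' : H.src η.1 = H.src η'.1 := congrArg Subtype.val e
    refine Subtype.ext ?_
    rw [← germ_eq hηa, ← germ_eq hηb, ← e']
    exact h
  injOn_rng := by
    rintro η ⟨a, ha, hηa, haS⟩ η' ⟨b, hb, hηb, hbS⟩ e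
    have h1 := hs.suppPt_eq (g := a) (y := (H.restrict _ hs.isOpen_altSupp).src η)
      (y' := (H.restrict _ hs.isOpen_altSupp).rng η) (smul_src hηa)
    have h2 := hs.suppPt_eq (g := b) (y := (H.restrict _ hs.isOpen_altSupp).src η')
      (y' := (H.restrict _ hs.isOpen_altSupp).rng η') (smul_src hηb)
    rw [← e, ← h1] at h2
    have h3 := S.rng_inj haS hbS h2.symm
    have h4 := congrArg (G.symPow (n + 1)).src h3
    rw [src_germ, src_germ] at h4
    have h5 : germ (ρ a) (H.src η'.1) = germ (ρ b) (H.src η'.1) := by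
      refine hs.germ_eq_of_germ_powFull_eq (y := (H.restrict _ hs.isOpen_altSupp).src η') ha hb ?_
      exact Eq.trans (by rw [h4]) h3
    have h6 : ρ a • H.src η.1 = ρ a • H.src η'.1 := by
      rw [smul_eq_of_germ_eq h5, smul_src hηa, smul_src hηb]
      exact congrArg Subtype.val e
    have h7 := smul_left_cancel _ h6
    refine Subtype.ext ?_
    rw [← germ_eq hηa, ← germ_eq hηb, h7, h5]

theorem mem_extBisec (hs : FinitelySupported ρ n) {S : (G.symPow (n + 1)).Bisec}
    {η : (H.restrict (altSupp ρ) hs.isOpen_altSupp).Arr} : η ∈ hs.extBisec S ↔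
      ∃ a : K, (a : G.fullGroup) ∈ G.altGroup ∧ η.1 ∈ (ρ a : H.Bisec) ∧
        germ (powFull (n + 1) (a : G.fullGroup))
          (hs.suppPt ((H.restrict (altSupp ρ) hs.isOpen_altSupp).src η)) ∈ S := Iff.rfl

/-- The germ of `ρ g` at a point of the support, as an arrow of the restriction. -/
noncomputable def mapGerm (hs : FinitelySupported ρ n) (g : K) (y : altSupp ρ) :
    (H.restrict (altSupp ρ) hs.isOpen_altSupp).Arr :=
  ⟨germ (ρ g) y.1, by rw [src_germ]; exact y.2, map_smul_mem_altSupp g y.2⟩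

theorem src_mapGerm (hs : FinitelySupported ρ n) (g : K) (y : altSupp ρ) :
    (H.restrict (altSupp ρ) hs.isOpen_altSupp).src (hs.mapGerm g y) = y :=
  Subtype.ext (src_germ _ _)

theorem mapGerm_mem_extBisec (hs : FinitelySupported ρ n) {S : (G.symPow (n + 1)).Bisec} {a : K}
    (ha : (a : G.fullGroup) ∈ G.altGroup) {y : altSupp ρ}
    (h : germ (powFull (n + 1) (a : G.fullGroup)) (hs.suppPt y) ∈ S) :
    hs.mapGerm a y ∈ hs.extBisec S :=
  ⟨a, ha, germ_mem _ _, by rwa [src_mapGerm]⟩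

theorem exists_of_mem_extBisec (hs : FinitelySupported ρ n) {S : (G.symPow (n + 1)).Bisec}
    {η : (H.restrict (altSupp ρ) hs.isOpen_altSupp).Arr} (h : η ∈ hs.extBisec S) :
    ∃ a : K, (a : G.fullGroup) ∈ G.altGroup ∧ ∃ y : altSupp ρ, η = hs.mapGerm a y ∧
      germ (powFull (n + 1) (a : G.fullGroup)) (hs.suppPt y) ∈ S := by
  obtain ⟨a, ha, hη, hS⟩ := h
  exact ⟨a, ha, (H.restrict _ hs.isOpen_altSupp).src η, Subtype.ext (EtaleGroupoid.germ_eq hη).symm, hS⟩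

theorem extBisec_mul (hs : FinitelySupported ρ n) (S T : (G.symPow (n + 1)).Bisec) :
    hs.extBisec (S * T) = hs.extBisec S * hs.extBisec T := by
  apply Bisec.ext_mem
  intro η
  rw [Bisec.mem_mul]
  constructor
  · intro h
    obtain ⟨a, ha, y, rfl, γ, hγ, δ, hδ, e, he⟩ := hs.exists_of_mem_extBisec h
    obtain ⟨b, hb, hδb⟩ := exists_mem_powFull hs.minimal hs.effective δ
    have hbK := hs.altGroup_le hb
    have hδs : (G.symPow (n + 1)).src δ = hs.suppPt y := by
      rw [← src_germ (powFull (n + 1) (a : G.fullGroup)) (hs.suppPt y), he, src_mul]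
    have hδe : germ (powFull (n + 1) b) (hs.suppPt y) = δ := by rw [← hδs, germ_eq hδb]
    have hy := hs.suppPt_eq (g := ⟨b, hbK⟩) (y := y)
      (y' := ⟨ρ ⟨b, hbK⟩ • y.1, map_smul_mem_altSupp _ y.2⟩) rfl
    have ha' : (a : G.fullGroup) * b⁻¹ ∈ G.altGroup := mul_mem ha (inv_mem hb)
    refine ⟨hs.mapGerm (a * ⟨b, hbK⟩⁻¹) ⟨ρ ⟨b, hbK⟩ • y.1, map_smul_mem_altSupp _ y.2⟩,
      hs.mapGerm_mem_extBisec ha' ?_, hs.mapGerm ⟨b, hbK⟩ y, hs.mapGerm_mem_extBisec hb ?_,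
      src_mapGerm _ _ _, Subtype.ext ?_⟩
    · have h1 : germ (powFull (n + 1) (a : G.fullGroup)) (hs.suppPt y) =
          (G.symPow (n + 1)).mul (germ (powFull (n + 1) ((a : G.fullGroup) * b⁻¹))
            (powFull (n + 1) b • hs.suppPt y)) (germ (powFull (n + 1) b) (hs.suppPt y))
            (src_germ _ _) := by
        rw [← germ_mul', ← powFull_mul, _root_.inv_mul_cancel_right]
      have h2 := mul_right_cancel_arr e _
        (he.symm.trans (h1.trans ((G.symPow (n + 1)).mul_congr _ rfl hδe)))
      change germ (powFull (n + 1) ((a : G.fullGroup) * b⁻¹)) _ ∈ S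
      rw [← hy, ← h2]
      exact hγ
    · change germ (powFull (n + 1) b) (hs.suppPt y) ∈ T
      rwa [hδe]
    · change germ (ρ a) y.1 = H.mul (germ (ρ (a * ⟨b, hbK⟩⁻¹)) (ρ ⟨b, hbK⟩ • y.1)) (germ (ρ ⟨b, hbK⟩) y.1) _
      rw [← germ_mul', ← map_mul, _root_.inv_mul_cancel_right]
  · rintro ⟨η₁, h₁, η₂, h₂, e, rfl⟩
    obtain ⟨a, ha, y₁, rfl, hS⟩ := hs.exists_of_mem_extBisec h₁
    obtain ⟨b, hb, y₂, rfl, hT⟩ := hs.exists_of_mem_extBisec h₂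
    rw [src_mapGerm] at e
    subst e
    have hy := hs.suppPt_eq (g := b) (y := y₂)
      (y' := (H.restrict (altSupp ρ) hs.isOpen_altSupp).rng (hs.mapGerm b y₂)) rfl
    have hab : ((a * b : K) : G.fullGroup) ∈ G.altGroup := G.altGroup.mul_mem ha hb
    have h : hs.mapGerm (a * b) y₂ ∈ hs.extBisec (S * T) := by
      refine hs.mapGerm_mem_extBisec hab ⟨_, hS, _, hT, ?_, ?_⟩
      · rw [src_germ, ← hy]; rfl
      · change germ (powFull (n + 1) ((a : G.fullGroup) * (b : G.fullGroup))) _ = _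
        rw [powFull_mul, germ_mul']
        exact (G.symPow (n + 1)).mul_congr _ (by rw [hy]) rfl
    convert h using 1
    refine Subtype.ext ?_
    change _ = germ (ρ (a * b)) y₂.1
    rw [map_mul, germ_mul']
    rfl

/-- The extension of `ρ` to the pseudogroup of the symmetric power. -/
def extension (hs : FinitelySupported ρ n) :
    ContMorphism (G.symPow (n + 1)) (H.restrict (altSupp ρ) hs.isClopen_altSupp.isOpen) where
  toFun := hs.extBisec
  map_mul := hs.extBisec_mul
  map_zero := Bisec.ext_mem fun η => by
    constructor
    · rintro ⟨a, -, -, h⟩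
      exact h
    · exact fun h => absurd h (Bisec.notMem_zero η)
  map_one := Bisec.ext_mem fun η => by
    constructor
    · intro h
      obtain ⟨a, ha, y, rfl, h1⟩ := hs.exists_of_mem_extBisec h
      have h2 : germ (powFull (n + 1) (a : G.fullGroup)) (hs.suppPt y) =
          germ (powFull (n + 1) ((1 : K) : G.fullGroup)) (hs.suppPt y) := by
        have h3 : germ (1 : (G.symPow (n + 1)).fullGroup) ((G.symPow (n + 1)).src
          (germ (powFull (n + 1) (a : G.fullGroup)) (hs.suppPt y))) = _ := germ_eq h1
        rw [src_germ] at h3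
        rw [← h3, OneMemClass.coe_one, powFull_one]
      refine ⟨y, Subtype.ext ?_⟩
      change H.unit y.1 = germ (ρ a) y.1
      rw [hs.germ_eq_of_germ_powFull_eq ha (one_mem _) h2, map_one, germ_one]
    · rintro ⟨y, rfl⟩
      have h : hs.mapGerm 1 y ∈ hs.extBisec 1 := by
        refine hs.mapGerm_mem_extBisec (one_mem _) ?_
        rw [OneMemClass.coe_one, powFull_one]
        exact germ_mem (1 : (G.symPow (n + 1)).fullGroup) _
      convert h using 1
      refine Subtype.ext ?_
      change H.unit y.1 = germ (ρ 1) y.1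
      rw [map_one, germ_one]
  map_sUnion F hF := by
    ext η
    rw [mem_iUnion₂, SetLike.mem_coe, mem_extBisec]
    constructor
    · rintro ⟨a, ha, hη, h⟩
      obtain ⟨S, hS, h'⟩ := mem_iUnion₂.1 h
      exact ⟨S, hS, a, ha, hη, h'⟩
    · rintro ⟨S, hS, h⟩
      obtain ⟨a, ha, hη, h⟩ := hs.mem_extBisec.1 h
      exact ⟨a, ha, hη, mem_iUnion₂.2 ⟨S, hS, h⟩⟩

end FinitelySupported

end Extension

end EtaleGroupoid

/-! ### Continuous morphisms and units -/

namespace EtaleGroupoid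

open Pointwise FullAction

section Morphism

variable {X : Type u} [TopologicalSpace X] [T2Space X] {Y : Type w} [TopologicalSpace Y]
  [T2Space Y] {G : EtaleGroupoid.{u, v} X} {H : EtaleGroupoid.{w, z} Y}

/-- The idempotent bisection of the units over an open set. -/
def unitBisec (G : EtaleGroupoid.{u, v} X) (U : Set X) (hU : IsOpen U) : G.Bisec where
  carrier := G.unit '' U
  isOpen := G.isOpenEmbedding_unit.isOpenMap _ hU
  injOn_src := by
    rintro _ ⟨x, -, rfl⟩ _ ⟨y, -, rfl⟩ e
    rw [src_unit, src_unit] at e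
    rw [e]
  injOn_rng := by
    rintro _ ⟨x, -, rfl⟩ _ ⟨y, -, rfl⟩ e
    rw [rng_unit, rng_unit] at e
    rw [e]

theorem mem_unitBisec {U : Set X} {hU : IsOpen U} {γ : G.Arr} :
    γ ∈ unitBisec G U hU ↔ ∃ x ∈ U, G.unit x = γ := Iff.rfl

theorem mem_mul_unitBisec {U : Set X} {hU : IsOpen U} {T : G.Bisec} {γ : G.Arr} :
    γ ∈ T * unitBisec G U hU ↔ γ ∈ T ∧ G.src γ ∈ U := by
  rw [Bisec.mem_mul]
  constructor
  · rintro ⟨γ, hγ, _, ⟨x, hx, rfl⟩, h, rfl⟩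
    rw [mul_unit', h, rng_unit]
    exact ⟨hγ, hx⟩
  · rintro ⟨hγ, hx⟩
    exact ⟨γ, hγ, _, ⟨_, hx, rfl⟩, by simp, (G.mul_unit γ).symm⟩

theorem unitBisec_mul_self (U : Set X) (hU : IsOpen U) :
    IsIdempotentElem (unitBisec G U hU) := by
  apply Bisec.ext_mem
  intro γ
  rw [mem_mul_unitBisec]
  refine ⟨fun h => h.1, fun h => ⟨h, ?_⟩⟩
  obtain ⟨x, hx, rfl⟩ := h
  rwa [src_unit]

theorem unitBisec_inv (U : Set X) (hU : IsOpen U) : (unitBisec G U hU)⁻¹ = unitBisec G U hU := by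
  apply Bisec.ext_mem
  intro γ
  rw [Bisec.mem_inv, mem_unitBisec, mem_unitBisec]
  constructor
  · rintro ⟨x, hx, e⟩
    exact ⟨x, hx, by rw [← G.inv_inv γ, ← e, inv_unit]⟩
  · rintro ⟨x, hx, rfl⟩
    exact ⟨x, hx, (G.inv_unit x).symm⟩

theorem unitBisec_mul (U V : Set X) (hU : IsOpen U) (hV : IsOpen V) :
    unitBisec G U hU * unitBisec G V hV = unitBisec G (U ∩ V) (hU.inter hV) := by
  apply Bisec.ext_mem
  intro γ
  rw [mem_mul_unitBisec, mem_unitBisec, mem_unitBisec]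
  constructor
  · rintro ⟨⟨x, hx, rfl⟩, h⟩
    rw [src_unit] at h
    exact ⟨x, ⟨hx, h⟩, rfl⟩
  · rintro ⟨x, ⟨hx, h⟩, rfl⟩
    exact ⟨⟨x, hx, rfl⟩, by rwa [src_unit]⟩

theorem compatible_unitBisec (U V : Set X) (hU : IsOpen U) (hV : IsOpen V) :
    Bisec.Compatible (unitBisec G U hU) (unitBisec G V hV) := by
  rw [Bisec.Compatible, unitBisec_inv, unitBisec_inv, unitBisec_mul]
  exact ⟨unitBisec_mul_self _ _, unitBisec_mul_self _ _⟩

theorem unitBisec_univ : unitBisec G univ isOpen_univ = 1 := by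
  apply Bisec.ext_mem
  intro γ
  rw [mem_unitBisec, Bisec.mem_one]
  simp

namespace ContMorphism

theorem toFun_injective :
    Function.Injective (toFun : ContMorphism G H → G.Bisec → H.Bisec) := by
  rintro ⟨⟩ ⟨⟩ h
  cases h
  rfl

variable (φ : ContMorphism G H)

theorem exists_unit_of_mem {U : Set X} {hU : IsOpen U} {η : H.Arr}
    (h : η ∈ φ.toFun (unitBisec G U hU)) : ∃ y, H.unit y = η :=
  Bisec.mem_one_of_isIdempotentElem (E := φ.toFun (unitBisec G U hU))
    ((φ.map_mul _ _).symm.trans (congrArg φ.toFun (unitBisec_mul_self U hU))) h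

theorem mul_unitBisec_src (S : G.Bisec) :
    S * unitBisec G (G.src '' (S : Set G.Arr)) (G.isLocalHomeomorph_src.isOpenMap _ S.isOpen) = S := by
  apply Bisec.ext_mem
  intro γ
  rw [mem_mul_unitBisec]
  exact ⟨fun h => h.1, fun h => ⟨h, γ, h, rfl⟩⟩

theorem unit_src_mem {S : G.Bisec} {η : H.Arr} (h : η ∈ φ.toFun S) : H.unit (H.src η) ∈
    φ.toFun (unitBisec G (G.src '' (S : Set G.Arr))
      (G.isLocalHomeomorph_src.isOpenMap _ S.isOpen)) := by
  rw [← mul_unitBisec_src S, φ.map_mul] at h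
  obtain ⟨γ, hγ, δ, hδ, e, rfl⟩ := h
  obtain ⟨y, rfl⟩ := φ.exists_unit_of_mem hδ
  rwa [src_mul, src_unit]

theorem mem_map_mul_unitBisec {S : G.Bisec} {U : Set X} {hU : IsOpen U} {η : H.Arr}
    (h : η ∈ φ.toFun S) (hη : H.unit (H.src η) ∈ φ.toFun (unitBisec G U hU)) :
    η ∈ φ.toFun (S * unitBisec G U hU) := by
  rw [φ.map_mul]
  exact ⟨η, h, _, hη, by simp, (H.mul_unit η).symm⟩

theorem mono {S T : G.Bisec} (hST : ∀ γ ∈ S, γ ∈ T) {η : H.Arr} (h : η ∈ φ.toFun S) :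
    η ∈ φ.toFun T := by
  have e : T * unitBisec G (G.src '' (S : Set G.Arr))
      (G.isLocalHomeomorph_src.isOpenMap _ S.isOpen) = S := by
    apply Bisec.ext_mem
    intro γ
    rw [mem_mul_unitBisec]
    constructor
    · rintro ⟨hγ, δ, hδ, e⟩
      rwa [← T.src_inj (hST δ hδ) hγ e]
    · exact fun hγ => ⟨hST γ hγ, γ, hγ, rfl⟩
  rw [← e, φ.map_mul] at h
  obtain ⟨γ, hγ, δ, hδ, e, rfl⟩ := h
  obtain ⟨y, rfl⟩ := φ.exists_unit_of_mem hδ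
  rwa [mul_unit']

/-- A continuous morphism preserves unions of open sets of units, so that every unit in the image
of the units over `U` comes from a point of `U`. -/
theorem exists_point {U : Set X} {hU : IsOpen U} {y : Y}
    (h : H.unit y ∈ φ.toFun (unitBisec G U hU)) :
    ∃ x ∈ U, ∀ (V : Set X) (hV : IsOpen V), x ∈ V → H.unit y ∈ φ.toFun (unitBisec G V hV) := by
  by_contra! hn
  choose! V hV hxV hyV using hn
  let F : Set G.Bisec := {S | ∃ x, ∃ hx : x ∈ U, S = unitBisec G (V x ∩ U) ((hV x hx).inter hU)}
  have hF : ∀ S ∈ F, ∀ T ∈ F, Bisec.Compatible S T := by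
    rintro _ ⟨x, hx, rfl⟩ _ ⟨x', hx', rfl⟩
    exact compatible_unitBisec _ _ _ _
  have e : Bisec.sUnion F hF = unitBisec G U hU := by
    apply Bisec.ext_mem
    intro γ
    constructor
    · intro h
      obtain ⟨_, ⟨x, hx, rfl⟩, x', hx', rfl⟩ := mem_iUnion₂.1 h
      exact ⟨x', hx'.2, rfl⟩
    · rintro ⟨x, hx, rfl⟩
      exact mem_iUnion₂.2 ⟨_, ⟨x, hx, rfl⟩, x, ⟨hxV x hx, hx⟩, rfl⟩
  have h1 : H.unit y ∈ (φ.toFun (Bisec.sUnion F hF) : Set H.Arr) := by rw [e]; exact h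
  rw [φ.map_sUnion] at h1
  obtain ⟨_, ⟨x, hx, rfl⟩, h2⟩ := mem_iUnion₂.1 h1
  refine hyV x hx (φ.mono ?_ h2)
  rintro _ ⟨x', hx', rfl⟩
  exact ⟨x', hx'.1, rfl⟩

end ContMorphism

end Morphism

/-! ### Uniqueness of the extension and the commuting homomorphism -/

section Induced

variable {X : Type u} [TopologicalSpace X] [T2Space X] {Y : Type w} [TopologicalSpace Y]
  [T2Space Y] {G : EtaleGroupoid.{u, v} X} {H : EtaleGroupoid.{w, z} Y}
  {Z : Set Y} {hZ : IsClopen Z} {r : ℕ} [NeZero r]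
  {φ : ContMorphism (G.symPow r) (H.restrict Z hZ.isOpen)}

theorem germ_inducedFull_of_notMem (g : G.fullGroup) {y : Y} (hy : y ∉ Z) :
    germ (inducedFull hZ φ g) y = H.unit y := by
  have h : H.unit y ∈ (inducedFull hZ φ g : H.Bisec) := Or.inr ⟨y, hy, rfl⟩
  simpa using germ_eq h

theorem germ_inducedFull_of_mem {g : G.fullGroup} {η : (H.restrict Z hZ.isOpen).Arr}
    (h : η ∈ φ.toFun (powFull r g)) : germ (inducedFull hZ φ g) (H.src η.1) = η.1 := by
  have h : η.1 ∈ (inducedFull hZ φ g : H.Bisec) := Or.inl ⟨η, h, rfl⟩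
  exact germ_eq h

theorem exists_mem_of_inducedFull (g : G.fullGroup) {y : Y} (hy : y ∈ Z) :
    ∃ η ∈ φ.toFun (powFull r g), germ (inducedFull hZ φ g) y = η.1 := by
  obtain ⟨η, hη, e⟩ | ⟨x, hx, e⟩ := germ_mem (inducedFull hZ φ g) y
  · exact ⟨η, hη, e.symm⟩
  · have := congrArg H.src e
    rw [src_unit, src_germ] at this
    exact absurd hy (this ▸ hx)

end Induced

section Extension

variable {X : Type u} [TopologicalSpace X] [T2Space X] {Y : Type w} [TopologicalSpace Y]
  [T2Space Y] {G : EtaleGroupoid.{u, v} X} {H : EtaleGroupoid.{w, z} Y}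
  {K : Subgroup G.fullGroup} {ρ : K →* H.fullGroup}

/-- If `φ` extends `ρ`, then every point `y` has a set of at most `r` points of `X` such that
the elements of the alternating full group with unit germs at these points are mapped by `ρ` to
elements with unit germ at `y`. -/
theorem Extends.map_mem_unitGroup {Z : Set Y} {hZ : IsClopen Z} {r : ℕ} [NeZero r]
    {φ : ContMorphism (G.symPow r) (H.restrict Z hZ.isOpen)} (hφ : Extends ρ hZ φ) {y : Z}
    {A : SymSpace X r} (hA : ∀ (V : Set (SymSpace X r)) (hV : IsOpen V), A ∈ V →
      (H.restrict Z hZ.isOpen).unit y ∈ φ.toFun (unitBisec (G.symPow r) V hV)) {a : K}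
    (ha : (a : G.fullGroup) ∈ G.altGroup) (haA : ∀ x ∈ A.1, germ (a : G.fullGroup) x = germ 1 x) :
    ρ a ∈ unitGroup y.1 := by
  have h := hA _ ((Bisec.isOpen_coe (powFull r (a : G.fullGroup) : (G.symPow r).Bisec)).preimage
    (G.symPow r).continuous_unit) (by
      rintro _ ⟨x, hx, rfl⟩
      change G.unit x ∈ ((a : G.fullGroup) : G.Bisec)
      rw [mem_iff_germ, src_unit, haA x hx, germ_one])
  have h1 := germ_inducedFull_of_mem (hZ := hZ) (φ := φ) (g := (a : G.fullGroup)) (φ.mono (by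
    rintro _ ⟨B, hB, rfl⟩
    exact hB) h)
  rw [hφ a ha] at h1
  change germ (ρ a) (H.src (H.unit y.1)) = H.unit y.1 at h1
  rw [src_unit] at h1
  exact mem_unitGroup_iff.2 h1

variable [CompactSpace X] [TotallyDisconnectedSpace X] [PerfectSpace X] {n : ℕ}

namespace FinitelySupported

/-- The set of points of `X` attached to `y` by any extension of `ρ` is the support of `y`. -/
theorem eq_suppPt (hs : FinitelySupported ρ n) {hZ : IsClopen (altSupp ρ)}
    {φ : ContMorphism (G.symPow (n + 1)) (H.restrict (altSupp ρ) hZ.isOpen)}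
    (hφ : Extends ρ hZ φ) {y : altSupp ρ} {A : SymSpace X (n + 1)}
    (hA : ∀ (V : Set (SymSpace X (n + 1))) (hV : IsOpen V), A ∈ V →
      (H.restrict _ hZ.isOpen).unit y ∈ φ.toFun (unitBisec (G.symPow (n + 1)) V hV)) :
    A = hs.suppPt y := by
  have := isFullAction hs.effective
  have hAf : A.1.Finite := finite_of_encard_le_coe A.2.2
  refine Subtype.ext (Subset.antisymm (fun q hq => ?_) fun q hq => ?_)
  · -- An element `a` with a unit germ at `y` that moves `A` maps units over a neighbourhood of `A` to
    -- units over a disjoint set, but its image contains the unit at `y`.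
    by_contra hqs
    obtain ⟨k, hk1, hk2⟩ := (denseOrbits hs.minimal).exists_fresh q (isOpen_compl_germSupp y.1)
      ⟨q, hqs⟩ hAf
    obtain ⟨a, ha, e⟩ := exists_altOn (denseOrbits hs.minimal) (isOpen_compl_germSupp y.1) hqs hk1
    have haA := hs.altOn_le_altGroup _ ha
    have h1 : ρ ⟨a, hs.altGroup_le haA⟩ ∈ unitGroup y.1 :=
      coe_mem_isotropy.1 (hs.altOn_le y.1 y.2 ha)
    have hne : A ≠ powFull (n + 1) a • A := fun h => by
      rw [← e.self_of_nhds] at hk2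
      refine hk2 ?_
      rw [h, coe_powFull_smul]
      exact smul_mem_smul_set hq
    obtain ⟨V₁, V₂, hV₁, hV₂, hA₁, hA₂, hd⟩ := t2_separation hne
    obtain ⟨η, hη, e1⟩ := exists_mem_of_inducedFull (hZ := hZ) (φ := φ) a y.2
    rw [hφ ⟨a, hs.altGroup_le haA⟩ haA, mem_unitGroup_iff.1 h1] at e1
    have e2 : (H.restrict _ hZ.isOpen).unit y = η := Subtype.ext e1
    have hV := hV₁.inter (hV₂.preimage (continuous_const_smul (powFull (n + 1) a)))
    have h2 := hA _ hV ⟨hA₁, hA₂⟩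
    have h3 : (H.restrict _ hZ.isOpen).unit y ∈ φ.toFun (unitBisec _ _ hV *
        ((powFull (n + 1) a : (G.symPow (n + 1)).Bisec) * unitBisec _ _ hV)) := by
      rw [φ.map_mul]
      refine ⟨_, h2, _, φ.mem_map_mul_unitBisec (e2 ▸ hη) ?_, by simp, (unit_mul' _ _ _ _).symm⟩
      rwa [src_unit]
    have h4 : unitBisec _ _ hV * ((powFull (n + 1) a : (G.symPow (n + 1)).Bisec) *
        unitBisec _ _ hV) = 0 := by
      apply Bisec.ext_mem
      intro γ
      refine iff_of_false ?_ (Bisec.notMem_zero γ)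
      rintro ⟨_, ⟨B, hB, rfl⟩, δ, hδ, h5, rfl⟩
      obtain ⟨hδ1, hδ2⟩ := mem_mul_unitBisec.1 hδ
      rw [src_unit, ← smul_src hδ1] at h5
      exact Set.disjoint_left.1 hd hB.1 (h5 ▸ hδ2.2)
    rw [h4, φ.map_zero] at h3
    exact Bisec.notMem_zero _ h3
  · -- The alternating group of the complement of `A` has unit germs at `y`.
    by_contra hqA
    refine hq A.1ᶜ hAf.isClosed.isOpen_compl hqA fun t ht => ?_
    have htA := hs.altOn_le_altGroup _ ht
    refine (coe_mem_isotropy (g := ⟨t, hs.altGroup_le htA⟩)).2 ?_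
    refine hφ.map_mem_unitGroup hA htA fun x hx => germ_eq_of_eventually_smul_eq hs.effective ?_
    simpa using eventually_smul_eq ht (fun h => h hx)

theorem germ_inducedFull_extension (hs : FinitelySupported ρ n) {y : Y} (hy : y ∈ altSupp ρ)
    {g : G.fullGroup} {a : K} (ha : (a : G.fullGroup) ∈ G.altGroup)
    (h : ∀ q ∈ germSupp ρ y, germ (a : G.fullGroup) q = germ g q) :
    germ (inducedFull hs.isClopen_altSupp hs.extension g) y = germ (ρ a) y := by
  have h1 : hs.mapGerm a ⟨y, hy⟩ ∈ hs.extBisec (powFull (n + 1) g) := by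
    refine hs.mapGerm_mem_extBisec ha ?_
    rw [germ_powFull_eq_iff (h := g) |>.2 h]
    exact germ_mem _ _
  have h2 := germ_inducedFull_of_mem (hZ := hs.isClopen_altSupp) (φ := hs.extension) h1
  change germ _ (H.src (germ (ρ a) y)) = germ (ρ a) y at h2
  rwa [src_germ] at h2

theorem extends_extension (hs : FinitelySupported ρ n) :
    Extends ρ hs.isClopen_altSupp hs.extension := by
  intro a ha
  refine fullGroup_ext_germ fun y => ?_
  by_cases hy : y ∈ altSupp ρ
  · exact hs.germ_inducedFull_extension hy ha fun _ _ => rfl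
  · rw [germ_inducedFull_of_notMem _ hy]
    exact (mem_unitGroup_iff.1 (mem_unitGroup_of_notMem_altSupp hy ha)).symm

/-- An extension is determined by `ρ`: the units over an open set `V` are mapped to the units at the
points `y` whose support is in `V`, and every bisection is locally the product of an element of the
alternating full group and such a set of units. -/
theorem eq_extension (hs : FinitelySupported ρ n)
    {φ : ContMorphism (G.symPow (n + 1)) (H.restrict (altSupp ρ) hs.isClopen_altSupp.isOpen)}
    (hφ : Extends ρ hs.isClopen_altSupp φ) : φ = hs.extension := by
  refine ContMorphism.toFun_injective (funext fun S => ?_)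
  have key : ∀ η ∈ hs.extBisec S, η ∈ φ.toFun S := by
    intro η h
    obtain ⟨a, ha, y, rfl, hS⟩ := hs.exists_of_mem_extBisec h
    have h1 : (H.restrict _ hs.isOpen_altSupp).unit y ∈
        φ.toFun (unitBisec (G.symPow (n + 1)) univ isOpen_univ) := by
      rw [unitBisec_univ, φ.map_one]
      exact ⟨y, rfl⟩
    obtain ⟨A, -, hA⟩ := φ.exists_point h1
    have e := hs.eq_suppPt hφ hA
    subst e
    have h2 := hA _ (S.isOpen_coe.preimage (continuous_germ (powFull (n + 1) (a : G.fullGroup)))) hS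
    obtain ⟨η, hη, e1⟩ := exists_mem_of_inducedFull (hZ := hs.isClopen_altSupp) (φ := φ)
      (a : G.fullGroup) y.2
    rw [hφ a ha] at e1
    have e2 : hs.mapGerm a y = η := Subtype.ext e1
    rw [e2]
    refine φ.mono ?_ (φ.mem_map_mul_unitBisec hη (by rw [← e2, src_mapGerm]; exact h2))
    intro γ hγ
    obtain ⟨h3, h4⟩ := mem_mul_unitBisec.1 hγ
    change germ _ _ ∈ S at h4
    rwa [germ_eq h3] at h4
  refine Bisec.ext_mem fun η => ⟨fun h => ?_, key η⟩
  obtain ⟨A, hAS, hA⟩ := φ.exists_point (φ.unit_src_mem h)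
  rw [hs.eq_suppPt hφ hA] at hAS
  obtain ⟨T, hT, e⟩ := hAS
  obtain ⟨b, hb, hTb⟩ := exists_mem_powFull hs.minimal hs.effective T
  have h1 : hs.mapGerm ⟨b, hs.altGroup_le hb⟩ ((H.restrict _ hs.isOpen_altSupp).src η) ∈
      hs.extBisec S := by
    refine hs.mapGerm_mem_extBisec hb ?_
    change germ (powFull (n + 1) b) _ ∈ S
    rw [← e, germ_eq hTb]
    exact hT
  have h2 := (φ.toFun S).src_inj h (key _ h1) (src_mapGerm _ _ _).symm
  rw [h2]
  exact h1

/-- Near the support of a point, every element of the full group agrees with an element of the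
alternating full group. -/
theorem exists_germ_eq (hs : FinitelySupported ρ n) {y : Y} (hy : y ∈ altSupp ρ)
    (g : G.fullGroup) : ∃ a : K, (a : G.fullGroup) ∈ G.altGroup ∧
      ∀ q ∈ germSupp ρ y, germ (a : G.fullGroup) q = germ g q := by
  obtain ⟨a, ha, h⟩ := exists_mem_powFull hs.minimal hs.effective
    (germ (powFull (n + 1) g) (hs.suppPt ⟨y, hy⟩))
  refine ⟨⟨a, hs.altGroup_le ha⟩, ha, (germ_powFull_eq_iff (A := hs.suppPt ⟨y, hy⟩)).1 ?_⟩
  have e := germ_eq h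
  rwa [src_germ] at e

theorem inducedFull_extension_mul (hs : FinitelySupported ρ n) (g h : G.fullGroup) :
    inducedFull hs.isClopen_altSupp hs.extension (g * h) =
      inducedFull hs.isClopen_altSupp hs.extension g *
        inducedFull hs.isClopen_altSupp hs.extension h := by
  refine fullGroup_ext_germ fun y => ?_
  by_cases hy : y ∈ altSupp ρ
  · obtain ⟨b, hb, hbh⟩ := hs.exists_germ_eq hy h
    obtain ⟨a, ha, hag⟩ := hs.exists_germ_eq (map_smul_mem_altSupp b hy) g
    rw [germ_mul_left (hs.germ_inducedFull_extension hy hb hbh),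
      germ_mul_right (hs.germ_inducedFull_extension (map_smul_mem_altSupp b hy) ha hag), ← map_mul]
    refine hs.germ_inducedFull_extension hy (mul_mem ha hb) fun q hq => ?_
    have h1 : germ ((a * b : K) : G.fullGroup) q = germ (g * (b : G.fullGroup)) q := by
      refine germ_mul_right (hag _ ?_)
      rw [hs.germSupp_smul]
      exact smul_mem_smul_set hq
    rw [h1]
    exact germ_mul_left (hbh q hq) g
  · have e : inducedFull hs.isClopen_altSupp hs.extension h • y = y := by
      rw [← rng_germ, germ_inducedFull_of_notMem _ hy, rng_unit]
    rw [germ_inducedFull_of_notMem _ hy]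
    have h1 : germ (inducedFull hs.isClopen_altSupp hs.extension h) y = germ 1 y := by
      rw [germ_inducedFull_of_notMem _ hy, germ_one]
    rw [germ_mul_left h1, mul_one, germ_inducedFull_of_notMem _ hy]

/-- An element that commutes with the image of the alternating full group preserves the supports of
points and hence commutes with the image of the full group under the extension. -/
theorem commute_inducedFull (hs : FinitelySupported ρ n) {k : H.fullGroup}
    (hk : ∀ a : K, (a : G.fullGroup) ∈ G.altGroup → Commute k (ρ a)) (h : G.fullGroup) :
    Commute k (inducedFull hs.isClopen_altSupp hs.extension h) := by
  have hinv : ∀ k : H.fullGroup, (∀ a : K, (a : G.fullGroup) ∈ G.altGroup → Commute k (ρ a)) →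
      ∀ y ∈ altSupp ρ, k • y ∈ altSupp ρ := fun k hk y hy =>
    smul_mem_altSupp (fun a ha => ⟨a, ha, by rw [(hk a ha).eq, _root_.mul_inv_cancel_right]⟩) hy
  refine fullGroup_ext_germ fun y => ?_
  by_cases hy : y ∈ altSupp ρ
  · have hsupp : germSupp ρ (k • y) = germSupp ρ y := by
      ext x
      refine forall₃_congr fun U hU hx => not_congr ?_
      refine forall₂_congr fun t ht => ?_
      have htA := hs.altOn_le_altGroup _ ht
      have e1 := coe_mem_isotropy (ρ := ρ) (y := k • y) (g := ⟨t, hs.altGroup_le htA⟩)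
      have e2 := coe_mem_isotropy (ρ := ρ) (y := y) (g := ⟨t, hs.altGroup_le htA⟩)
      rw [mem_unitGroup_smul, _root_.mul_assoc, ← (hk ⟨t, hs.altGroup_le htA⟩ htA).eq,
        _root_.inv_mul_cancel_left] at e1
      exact e1.trans e2.symm
    obtain ⟨b, hb, hbh⟩ := hs.exists_germ_eq hy h
    rw [germ_mul_left (hs.germ_inducedFull_extension hy hb hbh), (hk b hb).eq]
    refine (germ_mul_right (hs.germ_inducedFull_extension (hinv k hk y hy) hb ?_)).symm
    rwa [hsupp]
  · have hky : k • y ∉ altSupp ρ := fun h' => hy (by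
      simpa using hinv k⁻¹ (fun a ha => (hk a ha).inv_left) _ h')
    have h1 : germ (inducedFull hs.isClopen_altSupp hs.extension h) y = germ 1 y := by
      rw [germ_inducedFull_of_notMem _ hy, germ_one]
    have h2 : germ (inducedFull hs.isClopen_altSupp hs.extension h) (k • y) = germ 1 (k • y) := by
      rw [germ_inducedFull_of_notMem _ hky, germ_one]
    rw [germ_mul_left h1, germ_mul_right h2, mul_one, one_mul]

/-- The homomorphism induced by the extension on the full group. -/
def inducedHom (hs : FinitelySupported ρ n) : G.fullGroup →* H.fullGroup :=
  MonoidHom.mk' _ hs.inducedFull_extension_mul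

theorem inducedHom_of_mem (hs : FinitelySupported ρ n) {a : K}
    (ha : (a : G.fullGroup) ∈ G.altGroup) : hs.inducedHom a = ρ a := hs.extends_extension a ha

theorem commute_inv_mul (hs : FinitelySupported ρ n) (g : K) (h : G.fullGroup) :
    Commute ((hs.inducedHom g)⁻¹ * ρ g) (hs.inducedHom h) := by
  refine hs.commute_inducedFull (fun a ha => ?_) h
  have hc : (g : G.fullGroup) * a * (g : G.fullGroup)⁻¹ ∈ G.altGroup :=
    Subgroup.Normal.conj_mem inferInstance _ ha _
  have e : hs.inducedHom g * ρ a * (hs.inducedHom g)⁻¹ = ρ g * ρ a * (ρ g)⁻¹ := by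
    have h1 : hs.inducedHom ((g : G.fullGroup) * a * (g : G.fullGroup)⁻¹) = ρ (g * a * g⁻¹) :=
      hs.inducedHom_of_mem (a := g * a * g⁻¹) hc
    rwa [map_mul, map_mul, map_inv, map_mul, map_mul, map_inv, hs.inducedHom_of_mem ha] at h1
  have e' : ρ g * ρ a = hs.inducedHom g * ρ a * (hs.inducedHom g)⁻¹ * ρ g := by rw [e]; group
  change (hs.inducedHom g)⁻¹ * ρ g * ρ a = ρ a * ((hs.inducedHom g)⁻¹ * ρ g)
  rw [_root_.mul_assoc, e']
  group

/-- The homomorphism that measures the difference between `ρ` and its extension. -/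
def diffHom (hs : FinitelySupported ρ n) : K →* H.fullGroup :=
  MonoidHom.mk' (fun g => (hs.inducedHom g)⁻¹ * ρ g) fun g h => by
    have e := (hs.commute_inv_mul g h).inv_right.eq
    calc (hs.inducedHom ((g * h : K) : G.fullGroup))⁻¹ * ρ (g * h)
        = (hs.inducedHom h)⁻¹ * ((hs.inducedHom g)⁻¹ * ρ g) * ρ h := by
          rw [Subgroup.coe_mul, map_mul, map_mul, _root_.mul_inv_rev]
          group
      _ = _ := by rw [← e]; group

theorem hasUniqueExtension (hs : FinitelySupported ρ n) (hne : (altSupp ρ).Nonempty) :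
    HasUniqueExtension ρ := by
  refine ⟨hne, hs.isClopen_altSupp, n + 1, inferInstance, hs.extension, hs.extends_extension,
    fun φ hφ => hs.eq_extension hφ, QuotientGroup.lift _ hs.diffHom ?_, ?_, fun g => ?_⟩
  · intro a ha
    change (hs.inducedHom a)⁻¹ * ρ a = 1
    rw [hs.inducedHom_of_mem ha, inv_mul_cancel]
  · intro x g
    obtain ⟨k, rfl⟩ := QuotientGroup.mk_surjective x
    exact hs.commute_inv_mul k g
  · exact (mul_inv_cancel_left (hs.inducedHom g) (ρ g)).symm

end FinitelySupported

/-- A non-trivial element of the alternating full group with unit germs at finitely many given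
points shows that the germ maps of an extendable homomorphism are not injective. -/
theorem HasUniqueExtension.not_hasInjectiveGermMap (hmin : G.IsMinimal) (heff : G.IsEffective)
    (hK : G.altGroup ≤ K) (h : HasUniqueExtension ρ) : ¬ HasInjectiveGermMap ρ := by
  rintro ⟨y, hy, hinj⟩
  obtain ⟨-, hZ, r, hr, φ, hφ, -⟩ := h
  have := isFullAction heff
  have hd := denseOrbits hmin
  have h1 : (H.restrict _ hZ.isOpen).unit ⟨y, hy⟩ ∈
      φ.toFun (unitBisec (G.symPow r) univ isOpen_univ) := by
    rw [unitBisec_univ, φ.map_one]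
    exact ⟨_, rfl⟩
  obtain ⟨A, -, hA⟩ := φ.exists_point h1
  have hAf : A.1.Finite := finite_of_encard_le_coe A.2.2
  obtain ⟨x, hx⟩ := A.2.1
  obtain ⟨k, -, hk⟩ := hd.exists_fresh x isOpen_univ ⟨x, mem_univ x⟩ hAf
  obtain ⟨l, hl, hlk⟩ := hd.exists_fresh (k • x) hAf.isClosed.isOpen_compl ⟨k • x, hk⟩
    (finite_singleton (k • x))
  obtain ⟨a, ha, e⟩ := exists_altOn hd hAf.isClosed.isOpen_compl hk hl
  have haA : a ∈ G.altGroup := by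
    rw [altGroup_eq_altOn heff]
    exact altOn_mono (subset_univ _) ha
  have h2 := hφ.map_mem_unitGroup hA (a := ⟨a, hK haA⟩) haA fun q hq =>
    germ_eq_of_eventually_smul_eq heff (by simpa using eventually_smul_eq ha (fun h => h hq))
  have h3 : (⟨a, hK haA⟩ : K) = 1 := hinj (by
    change germ (ρ _) y = germ (ρ 1) y
    rw [map_one]
    exact h2)
  have h4 : a = 1 := congrArg Subtype.val h3
  refine hlk ?_
  rw [← e.self_of_nhds, h4, one_smul]
  rfl

end Extension

end EtaleGroupoid

theorem mainTheorem1 {X : Type u} [TopologicalSpace X] [T2Space X]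
    (hX : Nonempty (X ≃ₜ (ℕ → Bool))) {Y : Type w} [TopologicalSpace Y] [T2Space Y]
    [CompactSpace Y] (𝒢 : EtaleGroupoid.{u, v} X) (hmin : 𝒢.IsMinimal) (heff : 𝒢.IsEffective)
    (ℋ : EtaleGroupoid.{w, z} Y) (G : Subgroup 𝒢.fullGroup) (hG : 𝒢.altGroup ≤ G)
    (ρ : G →* ℋ.fullGroup) :
    (EtaleGroupoid.altSupp ρ = ∅ ∨ EtaleGroupoid.HasInjectiveGermMap ρ ∨
      EtaleGroupoid.HasUniqueExtension ρ) ∧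
    ¬ (EtaleGroupoid.altSupp ρ = ∅ ∧ EtaleGroupoid.HasInjectiveGermMap ρ) ∧
    ¬ (EtaleGroupoid.altSupp ρ = ∅ ∧ EtaleGroupoid.HasUniqueExtension ρ) ∧
    ¬ (EtaleGroupoid.HasInjectiveGermMap ρ ∧ EtaleGroupoid.HasUniqueExtension ρ) ∧
    (EtaleGroupoid.altSupp ρ = ∅ → ∃ ρ' : G ⧸ 𝒢.altGroup.subgroupOf G →* ℋ.fullGroup,
      ∀ g : G, ρ g = ρ' (QuotientGroup.mk g)) := by
  have := EtaleGroupoid.compactSpace_of_cantor hX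
  have := EtaleGroupoid.totallyDisconnectedSpace_of_cantor hX
  have := EtaleGroupoid.perfectSpace_of_cantor hX
  refine ⟨?_, ?_, ?_, ?_, fun h => ⟨QuotientGroup.lift _ ρ fun a ha => ?_, fun g => rfl⟩⟩
  · by_cases hZ : EtaleGroupoid.altSupp ρ = ∅
    · exact Or.inl hZ
    by_cases hi : EtaleGroupoid.HasInjectiveGermMap ρ
    · exact Or.inr (Or.inl hi)
    obtain ⟨n, hs⟩ := EtaleGroupoid.exists_finitelySupported hmin heff hG hi
    exact Or.inr (Or.inr (hs.hasUniqueExtension (nonempty_iff_ne_empty.2 hZ)))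
  · rintro ⟨h, y, hy, -⟩
    exact notMem_empty y (h ▸ hy)
  · rintro ⟨h, h', -⟩
    exact h'.ne_empty h
  · rintro ⟨h, h'⟩
    exact h'.not_hasInjectiveGermMap hmin heff hG h
  · refine EtaleGroupoid.fullGroup_ext_germ fun y => ?_
    exact EtaleGroupoid.mem_unitGroup_of_notMem_altSupp (h ▸ notMem_empty y) ha
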